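/- Let $n\ge 4$, and let $Q$ be an orientation of the Dynkin diagram of type $D_n$ with vertices $0,\dots,n-1$, i.e. the path $0 - 1 - \cdots - (n-3) - (n-2)$ together with the edge $(n-3) - (n-1)$. Let $\underline d=(d_0,\dots,d_{n-1})\in\Phi_+$ be a positive root of type $D_n$ in simple-root coordinates: $\sum_{k=i}^{j}\alpha_k$ ($i\le j$, $(i,j)\ne(n-2,n-1)$), or $\alpha_i+\dots+\alpha_{n-3}+\alpha_{n-1}$ ($i\le n-3$), or $\alpha_i+\dots+\alpha_{j-1}+2\alpha_j+\dots+2\alpha_{n-3}+\alpha_{n-2}+\alpha_{n-1}$ ($i<j\le n-3$). **Base graph.** $G$ is the planar bipartite (black/white) graph made of a hexagonal tile $n-3$ and square tiles for the other vertices of $Q$; tiles $i,j$ share an edge when $i,j$ are adjacent in $Q$, and an arrow $i\to j$ crosses that edge with the white vertex on its right, so the edge runs from black to white clockwise around $i$. The squares $0,\dots,n-4$ form a snake graph: $k-1,k,k+1$ ($1\le k\le n-4$) are placed straight if the two arrows at $k$ between them are both directed into $k$ or both out of $k$, and otherwise zig-zag, successive turns being alternately to the left and to the right. In clockwise order the hexagon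 has vertices $b_0,w_0,b_1,w_1,b_2,w_2$ ($b$ black, $w$ white). For $t=0,1,2$ the tile $n-4$, $n-2$, $n-1$, respectively, is glued to the side $b_tw_t$ if the arrow leaves $n-3$, and to the side $w_tb_{t+1}$ (indices mod $3$) if it enters $n-3$; and if the tiles $n-5,n-4,n-3$ zig-zag, their common vertex is $w_0$. **Configurations.** A mixed dimer configuration is a multiset of edges of $G$ in which every vertex has valence at most $2$. It satisfies the valence condition if every vertex of a tile $i$ with $d_i=2$ has valence $2$ and every vertex of a tile $i$ with $d_i=1$ has valence at least $1$. Let $G_1$ (resp. $G_2$) be the union of the tiles with $d_i\ge1$ (resp. $d_i=2$), and let $M_-=M_1\sqcup M_2$, where $M_a$ is the set of boundary edges of $G_a$ running from black to white clockwise. The weighted flip of tile $i$ lowers by $1$ the weight of each side of $i$ running black to white clockwise and raises by $1$ the weight of each side running white to black. Applied to a configuration (with multiplicities as weights) it is allowable if $d_i>0$ and all black-to-white sides of $i$ occur in the configuration. **Nodes.** The red (blue) nodes are the two vertices of the tile $n-1$ ($n-2$) not on the hexagon. If some $d_j=2$, let $j$ be the least such index (so $j\ge1$). If $j=1$, or if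 $j-2,j-1,j$ are placed straight, the green nodes are the two vertices of the tile $j-1$ not on the tile $j$. If $j-2,j-1,j$ zig-zag, they are $y$, the endpoint not on the tile $j$ of the edge shared by the tiles $j-1$ and $j-2$, and the vertex of the tile $j-2$ diagonally opposite to $y$. A configuration is node-monochromatic if no path of its edges joins nodes of different colours. Let $P$ be the set of mixed dimer configurations that satisfy the valence condition, are reachable from $M_-$ by a sequence of allowable flips, and are node-monochromatic. **Tran's conditions** on $\underline e\in\mathbb Z^n$: (1) $0\le e_i\le d_i$ for all $i$; (2) every arrow $i\to j$ is acceptable, i.e. $e_i-e_j\le\max(d_i-d_j,0)$; (3) $\nu(C)\le1$ for every connected component $C$ of $S$, the subgraph of $Q$ induced on $\{i:(d_i,e_i)=(2,1)\}$. Here an arrow $i\to j$ is critical if $(d_i,e_i)=(2,1)$ and $(d_j,e_j)=(1,0)$, or $(d_i,e_i)=(1,1)$ and $(d_j,e_j)=(2,1)$, and $\nu(C)$ is the number of critical arrows having a vertex in $C$. **Theorem.** There is a bijection $\Phi$ from $P$ to the set of vectors $\underline e$ satisfying Tran's conditions, such that: (a) For every $\underline e$ satisfying Tran's conditions, $\Phi^{-1}(\underline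 e)$ is obtained by starting from $M_-$ (multiplicities as weights) and performing, for $i=0,1,\dots,n-1$ in this order, $e_i$ weighted flips of tile $i$; in particular all final weights are non-negative. (b) Let $D\in P$. Start with the multigraph $D\sqcup M_-$ and $\underline v=0$. As long as the multigraph contains a cycle of length greater than $2$, choose one of maximal length, add $1$ to $v_i$ for every tile $i$ enclosed by it, and delete it (one copy of each of its edges). The procedure can be carried out to the end, and whatever choices are made it ends with $\underline v=\Phi(D)$ and a multigraph consisting only of $2$-cycles (every multiplicity is even, and there is no cycle of length greater than $2$). (c) For every $D\in P$, the number of cycles of length greater than $2$ formed by edges of $D$ and enclosing at least one tile equals the number of connected components $C$ of $S$ (formed for $\underline e=\Phi(D)$) with $\nu(C)=0$. -/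

import Mathlib

namespace MixedDimer

/-- The Dynkin diagram of type `D_n` on `0, …, n - 1`: the path `0 - 1 - ⋯ - (n-3) - (n-2)` together
with the edge `(n-3) - (n-1)`, so that `n - 3` is the trivalent vertex (for `n ≥ 4`). -/
def dynkinD (n : ℕ) : SimpleGraph (Fin n) :=
  SimpleGraph.fromRel fun i j =>
    ((j : ℕ) = i + 1 ∧ (j : ℕ) + 2 ≤ n) ∨ ((i : ℕ) + 3 = n ∧ (j : ℕ) + 1 = n)

/-- An acyclic quiver of type `D_n`: an orientation of every edge of the Dynkin diagram.
`arrow i j = true` means that there is an arrow `i → j`. -/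
structure DQuiver (n : ℕ) where
  arrow : Fin n → Fin n → Bool
  adj_iff : ∀ i j, (dynkinD n).Adj i j ↔ (arrow i j = true ∨ arrow j i = true)
  asymm : ∀ i j, arrow i j = true → arrow j i = false

/-- The positive roots of type `D_n`, written in the basis of simple roots `e_0, …, e_{n-1}`:
* `e_i + ⋯ + e_j` with `i ≤ j`, except for `e_{n-2} + e_{n-1}` (not a root, since the vertices `n-2`
  and `n-1` are not joined);
* `e_i + ⋯ + e_{n-3} + e_{n-1}` with `i ≤ n - 3`;
* `e_i + ⋯ + e_{j-1} + 2 e_j + ⋯ + 2 e_{n-3} + e_{n-2} + e_{n-1}` with `i < j ≤ n - 3`. -/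
def IsPositiveRoot (n : ℕ) (d : Fin n → ℤ) : Prop :=
  (∃ i j : ℕ, i ≤ j ∧ j < n ∧ ¬ (i + 2 = n ∧ j + 1 = n) ∧
    d = fun k : Fin n => if i ≤ (k : ℕ) ∧ (k : ℕ) ≤ j then 1 else 0) ∨
  (∃ i : ℕ, i + 3 ≤ n ∧
    d = fun k : Fin n => if (i ≤ (k : ℕ) ∧ (k : ℕ) + 3 ≤ n) ∨ (k : ℕ) + 1 = n then 1 else 0) ∨
  (∃ i j : ℕ, i < j ∧ j + 3 ≤ n ∧
    d = fun k : Fin n => if (k : ℕ) < i then 0 else if (k : ℕ) < j then 1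
      else if (k : ℕ) + 3 ≤ n then 2 else 1)

/-! ### The base graph

There is one tile for each vertex of the quiver: a hexagon for `n - 3` and a square for every other
vertex.  Each square tile `k` is glued along one edge to the tile of its neighbour in the direction
of the trivalent vertex (its *parent*).  Hence every vertex of the base graph is either one of the
six vertices of the hexagon or one of the two vertices of a unique square tile that do not lie on
its parent, and every edge is one of the six sides of the hexagon or one of the three sides of a
unique square tile that are not shared with its parent.

All the tiles alternate black and white vertices, so the clockwise boundary of a tile alternately
has sides that run from black to white and sides that run from white to black.  An arrow `i → j`
crosses the common side of the tiles `i` and `j` with the white vertex on its right; that is, this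
side runs from black to white clockwise around `i`, and from white to black clockwise around `j`. -/

/-- The two colours of the vertices of the bipartite base graph. -/
inductive Color
  | black
  | white
  deriving DecidableEq

/-- The labels of the square tiles. -/
abbrev Square (n : ℕ) : Type := {k : Fin n // (k : ℕ) + 3 ≠ n}

/-- The neighbour of a square tile in the direction of the hexagon: `k + 1` for `k ≤ n - 4`, and
`n - 3` for `k = n - 2` and `k = n - 1`. -/
def parent {n : ℕ} (s : Square n) : Fin n :=
  ⟨min ((s.1 : ℕ) + 1) (n - 3), by have := s.1.2; omega⟩

/-- The vertices of the base graph.  The vertices of the hexagon are, in clockwise order,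
`b₀, w₀, b₁, w₁, b₂, w₂`, with `bₜ = hex t black` and `wₜ = hex t white`; `sq s c` is the vertex of
colour `c` of the square tile `s` that does not lie on the parent of `s`. -/
inductive Vertex (n : ℕ)
  | hex (t : Fin 3) (c : Color)
  | sq (s : Square n) (c : Color)
  deriving DecidableEq

/-- The edges of the base graph.  `hexOut t` is the side `bₜ wₜ` of the hexagon and `hexIn t` is its
side `wₜ bₜ₊₁` (indices modulo 3).  If `B W` is the side that the square tile `s` shares with its
parent and `b = sq s black`, `w = sq s white`, then `s` is the 4-cycle `B W b w`, and `far s` is the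
side `b w` opposite to the parent, `sideB s` is the side `B w` and `sideW s` is the side `W b`. -/
inductive Edge (n : ℕ)
  | hexOut (t : Fin 3)
  | hexIn (t : Fin 3)
  | far (s : Square n)
  | sideB (s : Square n)
  | sideW (s : Square n)
  deriving DecidableEq, Fintype

/-- The position, in clockwise order around the hexagon, of the square tiles that are glued to it:
first `n - 4`, then `n - 2`, then `n - 1`. -/
def slot {n : ℕ} (s : Square n) : Fin 3 :=
  if (s.1 : ℕ) + 4 = n then 0 else if (s.1 : ℕ) + 2 = n then 1 else 2

/-- The next square tile after `k` in the direction of the hexagon, for `k < n - 4`. -/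
def nextSquare {n : ℕ} (s : Square n) (h : (s.1 : ℕ) + 4 < n) : Square n :=
  ⟨⟨(s.1 : ℕ) + 1, by omega⟩, by simp only [ne_eq]; omega⟩

/-- For the square tile `p` and its neighbour `k` on the side away from the hexagon: the tiles `k`,
`p` and the parent of `p` are placed straight (`k → p ←` or `k ← p →`), as opposed to zig-zagging. -/
def Straight {n : ℕ} (Q : DQuiver n) (k p : Square n) : Prop :=
  Q.arrow k.1 p.1 = Q.arrow (parent p) p.1

instance {n : ℕ} (Q : DQuiver n) (k p : Square n) : Decidable (Straight Q k p) :=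
  inferInstanceAs (Decidable (_ = _))

/-- The edge that a square tile shares with its parent.

For `k < n - 4` it is the side of `p = k + 1` opposite to the parent of `p` if the three tiles are
placed straight, and a side of `p` adjacent to the parent of `p` if they zig-zag.  Since the squares
form a staircase (going only North and East), the turns alternate between left and right; as the
colouring is a checkerboard colouring, this says that the common vertex of the three tiles is white
if `p = n - 4, n - 6, …` and black if `p = n - 5, n - 7, …`.

The tile `n - 4`, `n - 2` or `n - 1` in position `t` is glued to the side `bₜ wₜ` (which runs from
black to white clockwise) or to the side `wₜ bₜ₊₁` (white to black clockwise) of the hexagon,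
according to the direction of the arrow. -/
def attach {n : ℕ} (Q : DQuiver n) (s : Square n) : Edge n :=
  if h : (s.1 : ℕ) + 4 < n then
    if Straight Q s (nextSquare s h) then .far (nextSquare s h)
    else if Even (n + ((s.1 : ℕ) + 1)) then .sideW (nextSquare s h)
    else .sideB (nextSquare s h)
  else if Q.arrow (parent s) s.1 then .hexOut (slot s) else .hexIn (slot s)

/-- An auxiliary measure (the distance from the hexagon) for the recursion below. -/
def Edge.rank {n : ℕ} : Edge n → ℕ
  | .hexOut _ => 0
  | .hexIn _ => 0
  | .far s => n - s.1
  | .sideB s => n - s.1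
  | .sideW s => n - s.1

theorem rank_attach_lt {n : ℕ} (Q : DQuiver n) (s : Square n) : (attach Q s).rank < n - s.1 := by
  have := s.1.2
  unfold attach
  split_ifs <;> simp only [Edge.rank, nextSquare] <;> omega

/-- The black, respectively white, end point of an edge of the base graph. -/
def endpoint {n : ℕ} (Q : DQuiver n) : Color → Edge n → Vertex n
  | c, .hexOut t => .hex t c
  | .black, .hexIn t => .hex (t + 1) .black
  | .white, .hexIn t => .hex t .white
  | c, .far s => .sq s c
  | .black, .sideB s => endpoint Q .black (attach Q s)
  | .white, .sideB s => .sq s .white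
  | .black, .sideW s => .sq s .black
  | .white, .sideW s => endpoint Q .white (attach Q s)
termination_by _ x => x.rank
decreasing_by
  all_goals simpa only [Edge.rank] using rank_attach_lt Q s

/-- The sides of the tile `k` that run from black to white in the clockwise direction. -/
def bwSides {n : ℕ} (Q : DQuiver n) (k : Fin n) : Finset (Edge n) :=
  if h : (k : ℕ) + 3 = n then {.hexOut 0, .hexOut 1, .hexOut 2}
  else if Q.arrow k (parent ⟨k, h⟩) then {attach Q ⟨k, h⟩, .far ⟨k, h⟩}
  else {.sideB ⟨k, h⟩, .sideW ⟨k, h⟩}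

/-- The sides of the tile `k` that run from white to black in the clockwise direction. -/
def wbSides {n : ℕ} (Q : DQuiver n) (k : Fin n) : Finset (Edge n) :=
  if h : (k : ℕ) + 3 = n then {.hexIn 0, .hexIn 1, .hexIn 2}
  else if Q.arrow k (parent ⟨k, h⟩) then {.sideB ⟨k, h⟩, .sideW ⟨k, h⟩}
  else {attach Q ⟨k, h⟩, .far ⟨k, h⟩}

/-- All the sides of the tile `k`. -/
def sides {n : ℕ} (Q : DQuiver n) (k : Fin n) : Finset (Edge n) := bwSides Q k ∪ wbSides Q k

/-- The vertex `v` is incident to the tile `k`. -/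
def IsCorner {n : ℕ} (Q : DQuiver n) (k : Fin n) (v : Vertex n) : Prop :=
  ∃ x ∈ sides Q k, ∃ c, v = endpoint Q c x

/-- The pair of end points of an edge. -/
def ends {n : ℕ} (Q : DQuiver n) (x : Edge n) : Sym2 (Vertex n) :=
  s(endpoint Q .black x, endpoint Q .white x)

/-- The base graph of `Q`, as a simple graph. -/
def baseGraph {n : ℕ} (Q : DQuiver n) : SimpleGraph (Vertex n) :=
  SimpleGraph.fromEdgeSet (Set.range (ends Q))

/-! ### Mixed dimer configurations

A multiset of edges of the base graph is given by its multiplicity function `Edge n → ℕ`. -/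

/-- The number of edges of the multiset `M` that contain the vertex `v`. -/
def valence {n : ℕ} (Q : DQuiver n) (M : Edge n → ℕ) (v : Vertex n) : ℕ :=
  ∑ x ∈ Finset.univ.filter (fun x => endpoint Q .black x = v ∨ endpoint Q .white x = v), M x

/-- A mixed dimer configuration: every vertex is contained in zero, one or two edges. -/
def IsMixedDimer {n : ℕ} (Q : DQuiver n) (M : Edge n → ℕ) : Prop :=
  ∀ v, valence Q M v ≤ 2

/-- The valence condition with respect to `d`. -/
def ValenceCondition {n : ℕ} (Q : DQuiver n) (d : Fin n → ℤ) (M : Edge n → ℕ) : Prop :=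
  ∀ k v, IsCorner Q k v → (d k = 2 → valence Q M v = 2) ∧ (d k = 1 → 1 ≤ valence Q M v)

/-- The boundary edges of the union of the tiles in `R` that run from black to white clockwise. -/
def boundaryMatching {n : ℕ} (Q : DQuiver n) (R : Finset (Fin n)) (x : Edge n) : ℕ :=
  if (∃ k ∈ R, x ∈ bwSides Q k) ∧ ¬ (∃ k ∈ R, x ∈ wbSides Q k) then 1 else 0

/-- The minimal mixed dimer configuration `M_- = M₁ ⊔ M₂`. -/
def minimalMatching {n : ℕ} (Q : DQuiver n) (d : Fin n → ℤ) (x : Edge n) : ℕ :=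
  boundaryMatching Q (Finset.univ.filter fun k => 1 ≤ d k) x +
    boundaryMatching Q (Finset.univ.filter fun k => d k = 2) x

/-- The weighted flip of the tile `k`: the weight of each side that runs from black to white
clockwise decreases by one, and that of each side that runs from white to black increases by one.
The weights may become negative. -/
def weightedFlip {n : ℕ} (Q : DQuiver n) (k : Fin n) (w : Edge n → ℤ) (x : Edge n) : ℤ :=
  w x - (if x ∈ bwSides Q k then 1 else 0) + (if x ∈ wbSides Q k then 1 else 0)

/-- `M'` is obtained from `M` by an allowable flip of a tile. -/
def AllowableFlip {n : ℕ} (Q : DQuiver n) (d : Fin n → ℤ) (M M' : Edge n → ℕ) : Prop :=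
  ∃ k, 0 < d k ∧ (∀ x ∈ bwSides Q k, 0 < M x) ∧
    (fun x => (M' x : ℤ)) = weightedFlip Q k (fun x => (M x : ℤ))

/-- The graph formed by the edges that occur in the multiset `M`. -/
def supportGraph {n : ℕ} (Q : DQuiver n) (M : Edge n → ℕ) : SimpleGraph (Vertex n) :=
  SimpleGraph.fromEdgeSet (ends Q '' {x | 0 < M x})

/-- The colours of the nodes. -/
inductive NodeColor
  | red
  | blue
  | green

/-- The nodes.  The red (blue) nodes are the two vertices of the tile `n - 1` (`n - 2`) that are not
on the hexagon.  For the green nodes let `j` be the least index with `d_j = 2`, and `p = j - 1`.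
If `j = 1`, or if the tiles `j - 2, j - 1, j` are placed straight, they are the two vertices of the
tile `p` that are not on the tile `j`.  If the tiles zig-zag, the first is the vertex `y` not on the
tile `j` of the edge between the tiles `p` and `k = j - 2`, and the second is the vertex of the tile
`k` diagonally across from `y`, i.e. the other vertex of `k` of the same colour. -/
def IsNode {n : ℕ} (Q : DQuiver n) (d : Fin n → ℤ) : NodeColor → Vertex n → Prop
  | .red, v => ∃ s : Square n, (s.1 : ℕ) + 1 = n ∧ ∃ c, v = .sq s c
  | .blue, v => ∃ s : Square n, (s.1 : ℕ) + 2 = n ∧ ∃ c, v = .sq s c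
  | .green, v => ∃ j : Fin n, d j = 2 ∧ (∀ i < j, d i ≠ 2) ∧
      ∃ p : Square n, (p.1 : ℕ) + 1 = j ∧
        ((((j : ℕ) = 1 ∨ ∃ k : Square n, (k.1 : ℕ) + 2 = j ∧ Straight Q k p) ∧ ∃ c, v = .sq p c) ∨
        (∃ k : Square n, (k.1 : ℕ) + 2 = j ∧ ¬ Straight Q k p ∧
          ∃ c, ¬ IsCorner Q j (endpoint Q c (attach Q k)) ∧
            (v = endpoint Q c (attach Q k) ∨ v = .sq k c)))

/-- Node-monochromatic: no path of edges of `M` connects two nodes of different colours. -/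
def NodeMonochromatic {n : ℕ} (Q : DQuiver n) (d : Fin n → ℤ) (M : Edge n → ℕ) : Prop :=
  ∀ a b u v, a ≠ b → IsNode Q d a u → IsNode Q d b v → ¬ (supportGraph Q M).Reachable u v

/-- The (underlying set of the) poset `P`: the mixed dimer configurations that satisfy the valence
condition, are reachable from `M_-` by allowable flips, and are node-monochromatic. -/
def posetP {n : ℕ} (Q : DQuiver n) (d : Fin n → ℤ) : Set (Edge n → ℕ) :=
  {D | IsMixedDimer Q D ∧ ValenceCondition Q d D ∧
    Relation.ReflTransGen (AllowableFlip Q d) (minimalMatching Q d) D ∧ NodeMonochromatic Q d D}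

/-! ### From vectors to configurations -/

/-- Starting from the weights `w`, flip the tiles `i = 0, 1, …, n - 1` in this order, the tile `i`
exactly `e_i` times, by weighted flips. -/
def weightedFlips {n : ℕ} (Q : DQuiver n) (e : Fin n → ℤ) (w : Edge n → ℤ) : Edge n → ℤ :=
  (List.finRange n).foldl (fun w i => (weightedFlip Q i)^[(e i).toNat] w) w

/-! ### Cycles, and from configurations to vectors -/

/-- `C` is the edge set of a cycle of the base graph (which then has length greater than 2). -/
def IsCycle {n : ℕ} (Q : DQuiver n) (C : Finset (Edge n)) : Prop :=
  ∃ (v : Vertex n) (p : (baseGraph Q).Walk v v), p.IsCycle ∧ ∀ x, x ∈ C ↔ ends Q x ∈ p.edges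

/-- The cycles of length greater than 2 that can be formed from the edges of the multiset `M`. -/
def cyclesIn {n : ℕ} (Q : DQuiver n) (M : Edge n → ℕ) : Set (Finset (Edge n)) :=
  {C | IsCycle Q C ∧ ∀ x ∈ C, 0 < M x}

/-- `T` is the set of tiles enclosed by the cycle `C`: the edges of `C` are those with exactly one of
their two faces in `T`, the outer face never being in `T`. -/
def Encloses {n : ℕ} (Q : DQuiver n) (C : Finset (Edge n)) (T : Finset (Fin n)) : Prop :=
  ∀ x, x ∈ C ↔ ∃! k, k ∈ T ∧ x ∈ sides Q k

/-- The cycles in `M` that enclose at least one tile. -/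
def enclosingCycles {n : ℕ} (Q : DQuiver n) (M : Edge n → ℕ) : Set (Finset (Edge n)) :=
  {C | C ∈ cyclesIn Q M ∧ ∃ T : Finset (Fin n), T.Nonempty ∧ Encloses Q C T}

/-- One step of the peeling procedure on a pair (multigraph, vector): choose a cycle `C` of maximal
length among the cycles of length greater than 2 in the multigraph, delete one copy of each of its
edges, and add 1 to the entries of the vector at the tiles enclosed by `C`. -/
def PeelStep {n : ℕ} (Q : DQuiver n) (s s' : (Edge n → ℕ) × (Fin n → ℤ)) : Prop :=
  ∃ C T, C ∈ cyclesIn Q s.1 ∧ (∀ C' ∈ cyclesIn Q s.1, C'.card ≤ C.card) ∧ Encloses Q C T ∧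
    (∀ x, s.1 x = s'.1 x + if x ∈ C then 1 else 0) ∧
    (∀ k, s'.2 k = s.2 k + if k ∈ T then 1 else 0)

/-- `(N, v)` is the outcome of a complete run of the peeling procedure: it is reached by peeling
steps from the superimposition `D ⊔ M_-` and the zero vector, and no further step is possible. -/
def PeelOutcome {n : ℕ} (Q : DQuiver n) (d : Fin n → ℤ) (D N : Edge n → ℕ) (v : Fin n → ℤ) : Prop :=
  Relation.ReflTransGen (PeelStep Q) (fun x => D x + minimalMatching Q d x, 0) (N, v) ∧
    ¬ ∃ s, PeelStep Q (N, v) s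

/-! ### Tran's conditions -/

/-- The arrow `i → j` is critical with respect to `(e, d)`. -/
def IsCritical {n : ℕ} (Q : DQuiver n) (d e : Fin n → ℤ) (i j : Fin n) : Prop :=
  Q.arrow i j = true ∧
    ((d i = 2 ∧ e i = 1 ∧ d j = 1 ∧ e j = 0) ∨ (d i = 1 ∧ e i = 1 ∧ d j = 2 ∧ e j = 1))

/-- The induced subgraph `S` of `Q` on the vertices with `(d_i, e_i) = (2, 1)`. -/
abbrev graphS {n : ℕ} (d e : Fin n → ℤ) : SimpleGraph {i : Fin n // d i = 2 ∧ e i = 1} :=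
  (dynkinD n).induce {i : Fin n | d i = 2 ∧ e i = 1}

/-- The number `ν(C)` of critical arrows having a vertex in the connected component `C` of `S`. -/
noncomputable def nu {n : ℕ} (Q : DQuiver n) (d e : Fin n → ℤ)
    (C : (graphS d e).ConnectedComponent) : ℕ :=
  Set.ncard {a : Fin n × Fin n | IsCritical Q d e a.1 a.2 ∧
    (a.1 ∈ Subtype.val '' C.supp ∨ a.2 ∈ Subtype.val '' C.supp)}

/-- Tran's conditions on `e`. -/
structure TranConditions {n : ℕ} (Q : DQuiver n) (d e : Fin n → ℤ) : Prop where
  bounds : ∀ i, 0 ≤ e i ∧ e i ≤ d i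
  acceptable : ∀ i j, Q.arrow i j = true → e i - e j ≤ max (d i - d j) 0
  critical : ∀ C : (graphS d e).ConnectedComponent, nu Q d e C ≤ 1

end MixedDimer

open MixedDimer

/-!
Every edge `x` of the base graph is either a boundary edge, which bounds a single tile, or the edge
`attach Q s` that a square `s` shares with its parent.  The weight of an edge after `e k` flips of
each tile `k` is therefore explicit (`wt_outer`, `wt_attach`): on a boundary edge of the tile `k` it
is `d k - e k` or `e k`, and on the edge crossed by the arrow `i → j` it is
`max (d i - d j) 0 - (e i - e j)`.  Hence the weights determine `e`, and they are non-negative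
exactly if `e` satisfies the first two of Tran's conditions (`Acceptable`); here `e ≤ d` follows by
induction from the leaves of the diagram, since every tile has own edges in both directions
(`exists_own_eq`).  As the quiver is acyclic, every acceptable vector is reached by allowable flips
(`Acceptable.reachable`).  Flips do not change valences, which gives the valence conditions.  So the
configurations reachable from `M_-` correspond to the acceptable vectors, and it remains to compare
node-monochromaticity with Tran's third condition and to study cycles.

*Cycles.*  Modulo 2, an even set of edges is the boundary of a unique set of tiles, because every
tile has a boundary edge.  Cycles are the minimal nonempty even sets, so they are the boundaries of
the connected sets of tiles (`isCycle_iff`), and their lengths are strictly monotone in these sets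
(`TileConnected.eq_of_card_bd_le`).

*Peeling.*  The peeling procedure keeps the following invariant (`PeelState`): `0 ≤ v ≤ e`, two
adjacent tiles are filled equally until one of them is full, and the remaining multiplicities are
given by a formula in `d`, `e`, `v`.  In such a state every cycle encloses only tiles with `v < e`,
and the boundary of each connected component of `{v < e}` is available; so the longest cycles are
among these boundaries, and removing one preserves the invariant.  The procedure stops exactly if
`v = e`, when the remaining multiplicities are even.  In the same way, the cycles in the
configuration itself enclose components of `S`, and the boundary of a component is available exactly
if none of its edges is crossed by a critical arrow (`nu_eq_zero_iff`).

*Nodes.*  For a square `s`, the edges below `s` meet each of the two vertices that `s` shares with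
its parent with the same total weight `lowerSum Q d e s`.  If this is 0, or if it exhausts the
valence together with the weight of the common edge, then no path of edges leaves the part below `s`
through its parent (`Acceptable.exists_isCut`).  If `d = 2` at the parent, then in the remaining
case either the arrow between `s` and its parent is critical or both tiles belong to `S`.  Hence, if
no component of `S` meets two critical arrows, any two nodes of different colours are separated by a
cut (`Acceptable.nodeMonochromatic`).  Conversely, critical arrows only occur at the two leaves
`n - 2`, `n - 1` and at the first tile `j` with `d j = 2`.  Two of them at one component of `S` are
joined by a path along the boundary of that component and the hexagon, which extends to nodes of the
corresponding colours (`Acceptable.nu_le_one`).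
-/

set_option linter.unusedSectionVars false

namespace MixedDimer

/-! ### Edges and the tiles they bound -/

section

variable {n : ℕ} [hn : Fact (4 ≤ n)] (Q : DQuiver n)

theorem adj_parent (s : Square n) : (dynkinD n).Adj s.1 (parent s) := by
  have := hn.out
  obtain ⟨⟨k, hk⟩, hs⟩ := s
  simp only [dynkinD, SimpleGraph.fromRel_adj, parent, ne_eq, Fin.mk.injEq] at hs ⊢
  omega

theorem adj_iff_parent {i j : Fin n} :
    (dynkinD n).Adj i j ↔ ∃ s : Square n, s.1 = i ∧ parent s = j ∨ s.1 = j ∧ parent s = i := by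
  constructor
  · intro h
    simp only [dynkinD, SimpleGraph.fromRel_adj, ne_eq] at h
    have aux : ∀ i j : Fin n, ((j : ℕ) = i + 1 ∧ (j : ℕ) + 2 ≤ n) ∨
        ((i : ℕ) + 3 = n ∧ (j : ℕ) + 1 = n) →
        ∃ s : Square n, s.1 = i ∧ parent s = j ∨ s.1 = j ∧ parent s = i := by
      intro i j h
      by_cases hi : (i : ℕ) + 3 = n
      · exact ⟨⟨j, by omega⟩, Or.inr ⟨rfl, by simp only [parent, Fin.ext_iff]; omega⟩⟩
      · exact ⟨⟨i, hi⟩, Or.inl ⟨rfl, by simp only [parent, Fin.ext_iff]; omega⟩⟩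
    rcases h.2 with h | h
    · exact aux i j h
    · obtain ⟨s, hs⟩ := aux j i h
      exact ⟨s, hs.symm⟩
  · rintro ⟨s, ⟨rfl, rfl⟩ | ⟨rfl, rfl⟩⟩
    exacts [adj_parent s, (adj_parent s).symm]

theorem parent_ne (s : Square n) : parent s ≠ s.1 := (adj_parent s).ne'

theorem arrow_parent (s : Square n) : Q.arrow (parent s) s.1 = !Q.arrow s.1 (parent s) := by
  rcases (Q.adj_iff _ _).1 (adj_parent s) with h | h
  · rw [h, Q.asymm _ _ h]; rfl
  · rw [h, Q.asymm _ _ h]; rfl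

/-- The square tile `s` is glued to its parent along a side whose two ends are on the parent; `side
c s` is the side of `s` that joins the end of colour `c` of that side to `s` itself. -/
def side : Color → Square n → Edge n
  | .black, s => .sideB s
  | .white, s => .sideW s

/-- The opposite colour. -/
def Color.other : Color → Color
  | .black => .white
  | .white => .black

/-- The edge `x` runs from black to white clockwise around the tile that it belongs to in the
enumeration of `Edge` (the hexagon, or the square tile `s` for `far s`, `sideB s`, `sideW s`). -/
def outward : Edge n → Bool
  | .hexOut _ => true
  | .hexIn _ => false
  | .far s => Q.arrow s.1 (parent s)
  | .sideB s => Q.arrow (parent s) s.1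
  | .sideW s => Q.arrow (parent s) s.1

@[simp] theorem outward_side (c : Color) (s : Square n) :
    outward Q (side c s) = Q.arrow (parent s) s.1 := by cases c <;> rfl

/-- The gluing of the squares of the snake. -/
theorem attach_of_lt (s : Square n) (h : (s.1 : ℕ) + 4 < n) :
    attach Q s = if Straight Q s (nextSquare s h) then .far (nextSquare s h)
      else if Even (n + ((s.1 : ℕ) + 1)) then .sideW (nextSquare s h)
      else .sideB (nextSquare s h) := dif_pos h

/-- The gluing of the three squares adjacent to the hexagon. -/
theorem attach_of_le (s : Square n) (h : n ≤ (s.1 : ℕ) + 4) :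
    attach Q s = if Q.arrow (parent s) s.1 then .hexOut (slot s) else .hexIn (slot s) :=
  dif_neg (by omega)

theorem nextSquare_val (s : Square n) (h : (s.1 : ℕ) + 4 < n) : (nextSquare s h).1 = parent s := by
  simp only [nextSquare, parent, Fin.ext_iff]; omega

/-- The common edge of a square and its parent is oriented as prescribed by the arrow of the quiver:
the three cases of the definition of `attach` (straight, zig-zag, hexagon) agree in this. -/
theorem outward_attach (s : Square n) : outward Q (attach Q s) = Q.arrow (parent s) s.1 := by
  by_cases h : (s.1 : ℕ) + 4 < n
  · have h2 := arrow_parent Q (nextSquare s h)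
    have h3 := arrow_parent Q s
    rw [attach_of_lt Q s h]
    simp only [Straight]
    rw [← nextSquare_val s h] at *
    split_ifs <;> simp only [outward] <;> grind
  · rw [attach_of_le Q s (by omega)]
    split_ifs with h1 <;> simp [outward, h1]

theorem attach_injective : Function.Injective (attach Q) := by
  intro s s' hss
  have key : ∀ (s s' : Square n), attach Q s = attach Q s' → (s.1 : ℕ) + 4 < n →
      (s'.1 : ℕ) + 4 < n → s = s' := by
    intro s s' hss h h'
    rw [attach_of_lt Q s h, attach_of_lt Q s' h'] at hss
    have : nextSquare s h = nextSquare s' h' := by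
      split_ifs at hss <;> simpa using hss
    simp only [nextSquare, Subtype.mk.injEq, Fin.mk.injEq] at this
    exact Subtype.ext (Fin.ext (by omega))
  have key2 : ∀ (s s' : Square n), (s.1 : ℕ) + 4 < n → ¬ (s'.1 : ℕ) + 4 < n →
      attach Q s ≠ attach Q s' := by
    intro s s' h h' hss
    rw [attach_of_lt Q s h, attach_of_le Q s' (by omega)] at hss
    split_ifs at hss
  by_cases h : (s.1 : ℕ) + 4 < n <;> by_cases h' : (s'.1 : ℕ) + 4 < n
  · exact key s s' hss h h'
  · exact absurd hss (key2 s s' h h')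
  · exact absurd hss.symm (key2 s' s h' h)
  · rw [attach_of_le Q s (by omega), attach_of_le Q s' (by omega)] at hss
    have : slot s = slot s' := by split_ifs at hss <;> simpa using hss
    have hs := s.2
    have hs' := s'.2
    have b := s.1.2
    have b' := s'.1.2
    apply Subtype.ext; apply Fin.ext
    simp only [slot] at this
    split_ifs at this <;> omega

/-- The trivalent vertex `n - 3` of the diagram, whose tile is the hexagon. -/
def hexTile : Fin n := ⟨n - 3, by have := hn.out; omega⟩

theorem eq_hexTile {k : Fin n} : k = hexTile ↔ (k : ℕ) + 3 = n := by
  have := hn.out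
  simp only [hexTile, Fin.ext_iff]; omega

/-- The tile that the edge `x` belongs to in the enumeration of `Edge`.  Every edge is either a
boundary edge of the base graph, in which case this is the only tile it bounds, or equal to
`attach Q s` for a unique square tile `s`, in which case it bounds `s` and `own x = parent s`. -/
def own : Edge n → Fin n
  | .hexOut _ => hexTile
  | .hexIn _ => hexTile
  | .far s => s.1
  | .sideB s => s.1
  | .sideW s => s.1

@[simp] theorem own_hexOut (t : Fin 3) : own (.hexOut t : Edge n) = hexTile := rfl

@[simp] theorem own_hexIn (t : Fin 3) : own (.hexIn t : Edge n) = hexTile := rfl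

@[simp] theorem own_far (s : Square n) : own (.far s) = s.1 := rfl

@[simp] theorem own_side (c : Color) (s : Square n) : own (side c s) = s.1 := by cases c <;> rfl

theorem parent_eq_hexTile (s : Square n) (h : n ≤ (s.1 : ℕ) + 4) : parent s = hexTile := by
  simp only [hexTile, parent, Fin.ext_iff]; omega

theorem own_attach (s : Square n) : own (attach Q s) = parent s := by
  by_cases h : (s.1 : ℕ) + 4 < n
  · rw [attach_of_lt Q s h, ← nextSquare_val s h]
    split_ifs <;> rfl
  · rw [attach_of_le Q s (by omega), parent_eq_hexTile s (by omega)]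
    split_ifs <;> rfl

theorem own_attach_ne (s : Square n) : own (attach Q s) ≠ s.1 := by
  rw [own_attach]; exact parent_ne s

theorem mem_bwSides {k : Fin n} {x : Edge n} : x ∈ bwSides Q k ↔
    (own x = k ∧ outward Q x = true) ∨ ∃ s : Square n, s.1 = k ∧ attach Q s = x ∧
      outward Q x = false := by
  unfold bwSides
  split_ifs with h h1
  · have hk := eq_hexTile.2 h
    subst hk
    have h0 : ¬ ∃ s : Square n, s.1 = hexTile ∧ attach Q s = x ∧ outward Q x = false := by
      rintro ⟨s, hs, -⟩; exact s.2 (eq_hexTile.1 hs)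
    simp only [h0, or_false]
    rcases x with t | t | s | s | s
    · fin_cases t <;> simp [own, outward]
    · simp [outward]
    all_goals
      have : s.1 ≠ hexTile := fun e => s.2 (eq_hexTile.1 e)
      simp [own, this]
  · set s : Square n := ⟨k, h⟩
    have h2 := arrow_parent Q s
    have h3 : Q.arrow s.1 (parent s) = true := h1
    rw [h3] at h2
    have h4 : (∃ s : Square n, s.1 = k ∧ attach Q s = x ∧ outward Q x = false) ↔
        attach Q s = x := by
      constructor
      · rintro ⟨s', rfl, h, -⟩; exact h
      · intro h; exact ⟨s, rfl, h, by rw [← h, outward_attach, h2]; rfl⟩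
    rw [h4]
    simp only [Finset.mem_insert, Finset.mem_singleton]
    have h5 : k ≠ hexTile := fun e => h (eq_hexTile.1 e)
    have : (own x = k ∧ outward Q x = true) ↔ x = .far s := by
      constructor
      · rintro ⟨ho, hx⟩
        rcases x with t | t | s' | s' | s'
        · exact absurd ho.symm h5
        · exact absurd ho.symm h5
        all_goals
          have : s' = s := Subtype.ext ho
          subst this
          simp_all [outward]
      · rintro rfl; exact ⟨rfl, h1⟩
    rw [this, or_comm, eq_comm (a := x) (b := attach Q s)]
  · set s : Square n := ⟨k, h⟩
    have h2 := arrow_parent Q s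
    have h3 : Q.arrow s.1 (parent s) = false := by simpa using h1
    rw [h3] at h2
    have h4 : ¬ (∃ s : Square n, s.1 = k ∧ attach Q s = x ∧ outward Q x = false) := by
      rintro ⟨s', hs, h, h6⟩
      have : s' = s := Subtype.ext hs
      subst this
      rw [← h, outward_attach, h2] at h6; simp at h6
    simp only [h4, or_false]
    simp only [Finset.mem_insert, Finset.mem_singleton]
    have h5 : k ≠ hexTile := fun e => h (eq_hexTile.1 e)
    constructor
    · rintro (rfl | rfl)
      · exact ⟨rfl, h2⟩
      · exact ⟨rfl, h2⟩
    · rintro ⟨ho, hx⟩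
      rcases x with t | t | s' | s' | s'
      · exact absurd ho.symm h5
      · exact absurd ho.symm h5
      all_goals
        have : s' = s := Subtype.ext ho
        subst this
        simp_all [outward]

theorem mem_sides {k : Fin n} {x : Edge n} : x ∈ sides Q k ↔
    own x = k ∨ ∃ s : Square n, s.1 = k ∧ attach Q s = x := by
  unfold sides bwSides wbSides
  split_ifs with h h1
  · have hk := eq_hexTile.2 h
    subst hk
    have h0 : ¬ ∃ s : Square n, s.1 = hexTile ∧ attach Q s = x := by
      rintro ⟨s, hs, -⟩; exact s.2 (eq_hexTile.1 hs)
    simp only [h0, or_false]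
    rcases x with t | t | s | s | s
    · fin_cases t <;> simp [own]
    · fin_cases t <;> simp [own]
    all_goals
      have : s.1 ≠ hexTile := fun e => s.2 (eq_hexTile.1 e)
      simp [own, this]
  all_goals
    set s : Square n := ⟨k, h⟩
    have h4 : (∃ s : Square n, s.1 = k ∧ attach Q s = x) ↔ x = attach Q s := by
      constructor
      · rintro ⟨s', hs, hx⟩
        rw [← hx, show s' = s from Subtype.ext hs]
      · intro h; exact ⟨s, rfl, h.symm⟩
    rw [h4]
    simp only [Finset.mem_insert, Finset.mem_singleton, Finset.mem_union]
    have h5 : k ≠ hexTile := fun e => h (eq_hexTile.1 e)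
    have : own x = k ↔ x = .far s ∨ x = .sideB s ∨ x = .sideW s := by
      constructor
      · intro ho
        rcases x with t | t | s' | s' | s'
        · exact absurd ho.symm h5
        · exact absurd ho.symm h5
        all_goals
          have : s' = s := Subtype.ext ho
          subst this
          simp
      · rintro (rfl | rfl | rfl) <;> rfl
    rw [this]
    tauto

theorem disjoint_bwSides_wbSides (k : Fin n) {x : Edge n} (hx : x ∈ bwSides Q k) :
    x ∉ wbSides Q k := by
  unfold bwSides at hx
  unfold wbSides
  split_ifs at hx ⊢ with h h1
  · simp only [Finset.mem_insert, Finset.mem_singleton] at hx ⊢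
    rcases hx with rfl | rfl | rfl <;> simp
  all_goals
    have h1 : ∀ y, own y = k → attach Q ⟨k, h⟩ ≠ y := by
      rintro y rfl h2
      exact own_attach_ne Q ⟨own y, h⟩ (congrArg own h2)
    have := h1 (.far ⟨k, h⟩) rfl
    have := h1 (.sideB ⟨k, h⟩) rfl
    have := h1 (.sideW ⟨k, h⟩) rfl
    simp only [Finset.mem_insert, Finset.mem_singleton] at hx ⊢
    rcases hx with rfl | rfl <;> grind

theorem mem_wbSides {k : Fin n} {x : Edge n} : x ∈ wbSides Q k ↔
    (own x = k ∧ outward Q x = false) ∨ ∃ s : Square n, s.1 = k ∧ attach Q s = x ∧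
      outward Q x = true := by
  have h1 := mem_bwSides Q (k := k) (x := x)
  have h2 := mem_sides Q (k := k) (x := x)
  have h3 := disjoint_bwSides_wbSides Q k (x := x)
  have h4 : x ∈ sides Q k ↔ x ∈ bwSides Q k ∨ x ∈ wbSides Q k := Finset.mem_union
  have h5 : ¬ (own x = k ∧ ∃ s : Square n, s.1 = k ∧ attach Q s = x) := by
    rintro ⟨h, s, rfl, rfl⟩; exact own_attach_ne Q s h
  cases hx : outward Q x <;> simp only [hx] at h1 ⊢ <;> grind

/-- A boundary edge of the base graph. -/
def IsOuter (x : Edge n) : Prop := ∀ s, attach Q s ≠ x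

theorem isOuter_or_attach (x : Edge n) : IsOuter Q x ∨ ∃ s, attach Q s = x := by
  unfold IsOuter
  by_cases h : ∃ s, attach Q s = x
  · exact Or.inr h
  · exact Or.inl (fun s hs => h ⟨s, hs⟩)

/-- Every tile has own edges in both directions.  Such an edge is a boundary edge or is shared with
a child of the tile, so that statements about tiles can be proved by induction from the leaves. -/
theorem exists_own_eq (k : Fin n) (b : Bool) : ∃ x, own x = k ∧ outward Q x = b := by
  by_cases h : (k : ℕ) + 3 = n
  · have hk := eq_hexTile.2 h
    subst hk
    cases b
    · exact ⟨.hexIn 0, rfl, rfl⟩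
    · exact ⟨.hexOut 0, rfl, rfl⟩
  · have h1 := arrow_parent Q ⟨k, h⟩
    by_cases h2 : Q.arrow k (parent ⟨k, h⟩) = b
    · exact ⟨.far ⟨k, h⟩, rfl, h2⟩
    · exact ⟨.sideB ⟨k, h⟩, rfl, by simp only [outward]; cases b <;> simp_all⟩

/-- Every tile has a boundary edge, since a tile has fewer children than own edges. -/
theorem exists_isOuter (k : Fin n) : ∃ x, own x = k ∧ IsOuter Q x := by
  by_cases h : (k : ℕ) + 3 = n
  · have hk := eq_hexTile.2 h
    subst hk
    by_contra! hc
    have h1 := hc (.hexOut 0) rfl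
    have h2 := hc (.hexIn 0) rfl
    simp only [IsOuter, not_forall, not_not] at h1 h2
    obtain ⟨s, hs⟩ := h1
    obtain ⟨s', hs'⟩ := h2
    have a1 : n ≤ s.1 + 4 := by
      by_contra! h; rw [attach_of_lt Q s h] at hs; split_ifs at hs
    have a2 : n ≤ s'.1 + 4 := by
      by_contra! h; rw [attach_of_lt Q s' h] at hs'; split_ifs at hs'
    have e : s = s' := by
      rw [attach_of_le Q s a1] at hs
      rw [attach_of_le Q s' a2] at hs'
      have e1 : slot s = 0 := by split_ifs at hs; simpa using hs
      have e2 : slot s' = 0 := by split_ifs at hs'; simpa using hs'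
      simp only [slot] at e1 e2
      apply Subtype.ext; apply Fin.ext
      split_ifs at e1 e2 <;> omega
    subst e
    rw [hs] at hs'; simp at hs'
  · by_contra! hc
    have h1 := hc (.sideB ⟨k, h⟩) rfl
    have h2 := hc (.far ⟨k, h⟩) rfl
    simp only [IsOuter, not_forall, not_not] at h1 h2
    obtain ⟨s, hs⟩ := h1
    obtain ⟨s', hs'⟩ := h2
    have a1 : s.1 + 4 < n := by
      by_contra! h; rw [attach_of_le Q s h] at hs; split_ifs at hs
    have a2 : s'.1 + 4 < n := by
      by_contra! h; rw [attach_of_le Q s' h] at hs'; split_ifs at hs'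
    have e : s = s' := by
      have e1 : (parent s : ℕ) = k := by rw [← own_attach Q s, hs]; rfl
      have e2 : (parent s' : ℕ) = k := by rw [← own_attach Q s', hs']; rfl
      simp only [parent] at e1 e2
      apply Subtype.ext; apply Fin.ext
      omega
    subst e
    rw [hs] at hs'; simp at hs'

/-- Induction from the leaves of the diagram towards the trivalent vertex. -/
theorem leaf_induction {P : Fin n → Prop}
    (h : ∀ k, (∀ s : Square n, parent s = k → P s.1) → P k) (k : Fin n) : P k := by
  have hsq : ∀ m : ℕ, ∀ k : Fin n, (k : ℕ) = m → m + 3 < n → P k := by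
    intro m
    induction m with
    | zero =>
      intro k hk hm
      refine h k fun s hs => ?_
      simp only [parent, Fin.ext_iff] at hs; omega
    | succ m ih =>
      intro k hk hm
      refine h k fun s hs => ih s.1 ?_ (by omega)
      simp only [parent, Fin.ext_iff] at hs; omega
  have hleaf : ∀ k : Fin n, n < k + 3 → P k := by
    intro k hk
    refine h k fun s hs => ?_
    have := hn.out
    simp only [parent, Fin.ext_iff] at hs; omega
  rcases lt_trichotomy ((k : ℕ) + 3) n with hk | hk | hk
  · exact hsq k k rfl hk
  · refine h k fun s hs => ?_
    rcases lt_or_gt_of_ne s.2 with hk | hk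
    · exact hsq _ _ rfl hk
    · exact hleaf _ hk
  · exact hleaf k hk

/-- Induction from the trivalent vertex of the diagram towards the leaves. -/
theorem root_induction {P : Fin n → Prop} (h0 : P hexTile)
    (h : ∀ s : Square n, P (parent s) → P s.1) (k : Fin n) : P k := by
  by_cases hk : (k : ℕ) + 3 = n
  · exact (eq_hexTile.2 hk) ▸ h0
  · have hp : ∀ m : ℕ, ∀ k : Fin n, (k : ℕ) + 3 + m = n → P k := by
      intro m
      induction m with
      | zero => intro k hk; exact (eq_hexTile.2 hk) ▸ h0
      | succ m ih =>
        intro k hk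
        exact h ⟨k, by omega⟩ (ih _ (by simp only [parent]; omega))
    by_cases hk' : (k : ℕ) + 3 < n
    · exact hp (n - (k + 3)) k (by omega)
    · refine h ⟨k, hk⟩ ?_
      rwa [parent_eq_hexTile _ (by simp only; omega)]

end

/-! ### Vertices and vertex sums -/

section

variable {n : ℕ} [hn : Fact (4 ≤ n)] (Q : DQuiver n)

/-- The colour of a vertex. -/
def Vertex.color : Vertex n → Color
  | .hex _ c => c
  | .sq _ c => c

@[simp] theorem other_ne (c : Color) : c.other ≠ c := by cases c <;> simp [Color.other]

@[simp] theorem other_other (c : Color) : c.other.other = c := by cases c <;> rfl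

theorem eq_or_eq_other (c c' : Color) : c' = c ∨ c' = c.other := by
  cases c <;> cases c' <;> simp [Color.other]

@[simp] theorem endpoint_far (c : Color) (s : Square n) : endpoint Q c (.far s) = .sq s c := by
  simp [endpoint]

@[simp] theorem endpoint_side (c : Color) (s : Square n) :
    endpoint Q c (side c s) = endpoint Q c (attach Q s) := by
  cases c <;> simp [side, endpoint]

@[simp] theorem endpoint_other_side (c : Color) (s : Square n) :
    endpoint Q c.other (side c s) = .sq s c.other := by
  cases c <;> simp [side, endpoint, Color.other]

@[simp] theorem endpoint_side_other (c : Color) (s : Square n) :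
    endpoint Q c (side c.other s) = .sq s c := by
  cases c <;> simp [side, endpoint, Color.other]

/-- The edge of the hexagon other than `hexOut t` at the vertex `hex t c`. -/
def hexInAt (c : Color) (t : Fin 3) : Edge n :=
  match c with
  | .black => .hexIn (t - 1)
  | .white => .hexIn t

@[simp] theorem endpoint_hexOut (c : Color) (t : Fin 3) :
    endpoint Q c (.hexOut t) = .hex t c := by simp [endpoint]

@[simp] theorem endpoint_hexInAt (c : Color) (t : Fin 3) :
    endpoint Q c (hexInAt c t) = .hex t c := by
  cases c <;> simp [endpoint, hexInAt]

/-- The edges are the sides of the hexagon and the three own sides of the squares. -/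
theorem edge_cases {P : Edge n → Prop} (h1 : ∀ t, P (.hexOut t)) (h2 : ∀ t, P (.hexIn t))
    (h3 : ∀ s, P (.far s)) (h4 : ∀ c s, P (side c s)) (x : Edge n) : P x := by
  cases x with
  | hexOut t => exact h1 t
  | hexIn t => exact h2 t
  | far s => exact h3 s
  | sideB s => exact h4 .black s
  | sideW s => exact h4 .white s

/-- A square is glued to the hexagon, to the side of the next square opposite to its parent, or to
one of the two sides adjacent to the parent. -/
theorem attach_cases (s : Square n) :
    (n ≤ (s.1 : ℕ) + 4 ∧ ∃ t, attach Q s = .hexOut t ∨ attach Q s = .hexIn t) ∨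
    ((s.1 : ℕ) + 4 < n ∧ ∃ p : Square n, (p.1 : ℕ) = s.1 + 1 ∧ p.1 = parent s ∧
      (attach Q s = .far p ∨ ∃ c, attach Q s = side c p)) := by
  by_cases h : (s.1 : ℕ) + 4 < n
  · right
    refine ⟨h, nextSquare s h, rfl, nextSquare_val s h, ?_⟩
    rw [attach_of_lt Q s h]
    split_ifs
    exacts [Or.inl rfl, Or.inr ⟨.white, rfl⟩, Or.inr ⟨.black, rfl⟩]
  · left
    refine ⟨by omega, slot s, ?_⟩
    rw [attach_of_le Q s (by omega)]
    split_ifs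
    exacts [Or.inl rfl, Or.inr rfl]

/-- Induction along the squares, towards the hexagon. -/
theorem square_induction {P : Square n → Prop}
    (h : ∀ s : Square n, (∀ p : Square n, (p.1 : ℕ) = s.1 + 1 → (s.1 : ℕ) + 4 < n → P p) → P s)
    (s : Square n) : P s := by
  have : ∀ m : ℕ, ∀ s : Square n, n - s.1 ≤ m → P s := by
    intro m
    induction m with
    | zero => intro s hs; have := s.1.2; omega
    | succ m ih =>
      intro s hs
      exact h s fun p hp _ => ih p (by omega)
  exact this _ s le_rfl

theorem endpoint_hex (c : Color) (t : Fin 3) :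
    (∃ t', endpoint Q c (.hexOut t) = .hex t' c) ∧ ∃ t', endpoint Q c (.hexIn t) = .hex t' c := by
  cases c <;> simp [endpoint]

theorem endpoint_attach_cases (c : Color) (s : Square n) :
    (∃ t, endpoint Q c (attach Q s) = .hex t c) ∨
      ∃ p : Square n, s.1 < p.1 ∧ (p.1 : ℕ) + 4 ≤ n ∧ endpoint Q c (attach Q s) = .sq p c := by
  induction s using square_induction with
  | h s ih =>
    rcases attach_cases Q s with ⟨-, t, h | h⟩ | ⟨hs, p, hp, -, h | ⟨c', h⟩⟩
    · rw [h]; exact Or.inl (endpoint_hex Q c t).1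
    · rw [h]; exact Or.inl (endpoint_hex Q c t).2
    · right; exact ⟨p, by simp only [Fin.lt_def]; omega, by omega, by simp [h]⟩
    · rw [h]
      rcases eq_or_eq_other c c' with rfl | rfl
      · rw [endpoint_side]
        rcases ih p hp hs with h1 | ⟨p', hp', hn', h1⟩
        · exact Or.inl h1
        · right; exact ⟨p', by simp only [Fin.lt_def] at *; omega, hn', h1⟩
      · right; exact ⟨p, by simp only [Fin.lt_def]; omega, by omega, by simp⟩

theorem lt_of_endpoint_attach {c c' : Color} {s p : Square n}
    (h : endpoint Q c (attach Q s) = .sq p c') : s.1 < p.1 ∧ (p.1 : ℕ) + 4 ≤ n := by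
  rcases endpoint_attach_cases Q c s with ⟨t, ht⟩ | ⟨p', h1, h2, h3⟩
  · rw [ht] at h; cases h
  · rw [h3] at h; cases h; exact ⟨h1, h2⟩

theorem color_endpoint (c : Color) (x : Edge n) : (endpoint Q c x).color = c := by
  have ha : ∀ s, (endpoint Q c (attach Q s)).color = c := by
    intro s
    rcases endpoint_attach_cases Q c s with ⟨t, ht⟩ | ⟨p', h1, h2, h3⟩
    · rw [ht]; rfl
    · rw [h3]; rfl
  induction x using edge_cases with
  | h1 t => obtain ⟨t, h⟩ := (endpoint_hex Q c t).1; rw [h]; rfl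
  | h2 t => obtain ⟨t, h⟩ := (endpoint_hex Q c t).2; rw [h]; rfl
  | h3 s => rw [endpoint_far]; rfl
  | h4 c' s =>
    rcases eq_or_eq_other c c' with rfl | rfl
    · rw [endpoint_side]; exact ha s
    · rw [endpoint_side_other]; rfl

theorem mem_ends {v : Vertex n} {x : Edge n} :
    v ∈ ends Q x ↔ endpoint Q v.color x = v := by
  have hb := color_endpoint Q .black x
  have hw := color_endpoint Q .white x
  unfold ends
  rw [Sym2.mem_iff]
  constructor
  · rintro (rfl | rfl)
    · rw [hb]
    · rw [hw]
  · intro h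
    cases hc : v.color <;> rw [hc] at h <;> simp [h]

/-- The base graph has no multiple edges. -/
theorem ends_injective : Function.Injective (ends Q) := by
  intro x y h
  have hc : ∀ c, endpoint Q c x = endpoint Q c y := by
    intro c
    have h1 : endpoint Q c x ∈ ends Q x := by
      rw [mem_ends, color_endpoint]
    rw [h, mem_ends, color_endpoint] at h1
    exact h1.symm
  have irr : ∀ (c c' : Color) (s : Square n), endpoint Q c (attach Q s) ≠ .sq s c' := by
    intro c c' s h; exact absurd (lt_of_endpoint_attach Q h).1 (lt_irrefl _)
  clear h
  have hexsq : ∀ (t : Fin 3) (z : Edge n), (∀ c, endpoint Q c z = endpoint Q c (.hexOut t)) ∨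
      (∀ c, endpoint Q c z = endpoint Q c (.hexIn t)) → ∃ t, z = .hexOut t ∨ z = .hexIn t := by
    intro t z hz
    have hz' : ∀ c, ∃ t', endpoint Q c z = .hex t' c := by
      intro c
      rcases hz with hz | hz
      · rw [hz]; exact (endpoint_hex Q c t).1
      · rw [hz]; exact (endpoint_hex Q c t).2
    induction z using edge_cases with
    | h1 t => exact ⟨t, Or.inl rfl⟩
    | h2 t => exact ⟨t, Or.inr rfl⟩
    | h3 s => obtain ⟨t, h⟩ := hz' .black; simp at h
    | h4 c s => obtain ⟨t, h⟩ := hz' c.other; simp at h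
  have hexhex : ∀ t t' : Fin 3, (∀ c, endpoint Q c (.hexOut t) = endpoint Q c (.hexIn t')) →
      False := by
    intro t t' h
    have h1 := h .black
    have h2 := h .white
    simp only [endpoint, Vertex.hex.injEq, and_true] at h1 h2
    subst h2
    clear h; revert t; decide
  have outcase : ∀ (t : Fin 3) (z : Edge n), (∀ c, endpoint Q c z = endpoint Q c (.hexOut t)) →
      z = .hexOut t := by
    intro t z hz
    rcases hexsq t z (Or.inl hz) with ⟨t', rfl | rfl⟩
    · have := hz .black; simp at this; rw [this]
    · exact (hexhex t t' fun c => (hz c).symm).elim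
  have incase : ∀ (t : Fin 3) (z : Edge n), (∀ c, endpoint Q c z = endpoint Q c (.hexIn t)) →
      z = .hexIn t := by
    intro t z hz
    rcases hexsq t z (Or.inr hz) with ⟨t', rfl | rfl⟩
    · exact (hexhex t' t hz).elim
    · have := hz .white; simp [endpoint] at this; rw [this]
  have farside : ∀ (c : Color) (s s' : Square n),
      ¬ ∀ c', endpoint Q c' (.far s) = endpoint Q c' (side c s') := by
    intro c s s' h
    have h1 := h c.other
    simp at h1; subst h1
    have h2 := h c
    simp only [endpoint_far, endpoint_side] at h2
    exact irr _ _ _ h2.symm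
  induction x using edge_cases with
  | h1 t => exact (outcase t y fun c => (hc c).symm).symm
  | h2 t => exact (incase t y fun c => (hc c).symm).symm
  | h3 s =>
    induction y using edge_cases with
    | h1 t => exact outcase t _ hc
    | h2 t => exact incase t _ hc
    | h3 s' => have := hc .black; simp at this; rw [this]
    | h4 c s' => exact (farside c s s' hc).elim
  | h4 c s =>
    induction y using edge_cases with
    | h1 t => exact outcase t _ hc
    | h2 t => exact incase t _ hc
    | h3 s' => exact (farside c s' s fun c => (hc c).symm).elim
    | h4 c' s' =>
      rcases eq_or_eq_other c c' with rfl | rfl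
      · have := hc c'.other; simp at this; rw [this]
      · have h1 := hc c
        have h2 := hc c.other
        simp only [endpoint_side, endpoint_side_other, endpoint_other_side] at h1 h2
        have h3 := (lt_of_endpoint_attach Q h1).1
        have h4 := (lt_of_endpoint_attach Q h2.symm).1
        exact absurd h3 h4.asymm

section Sums

variable {M : Type*} [AddCommGroup M]

/-- Sums over the edges. -/
theorem sum_edge (f : Edge n → M) (c : Color) : ∑ x, f x =
    ∑ t, (f (.hexOut t) + f (hexInAt c t)) +
      ∑ s : Square n, (f (.far s) + f (side c.other s) + f (side c s)) := by
  let φ : (Fin 3 ⊕ Fin 3) ⊕ (Square n ⊕ Square n ⊕ Square n) ≃ Edge n :=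
    { toFun := Sum.elim (Sum.elim .hexOut .hexIn) (Sum.elim .far (Sum.elim .sideB .sideW))
      invFun := fun x => match x with
        | .hexOut t => .inl (.inl t)
        | .hexIn t => .inl (.inr t)
        | .far s => .inr (.inl s)
        | .sideB s => .inr (.inr (.inl s))
        | .sideW s => .inr (.inr (.inr s))
      left_inv := by rintro ((t | t) | (s | s | s)) <;> rfl
      right_inv := by rintro (t | t | s | s | s) <;> rfl }
  have h2 : ∑ t : Fin 3, f (hexInAt c t) = ∑ t : Fin 3, f (.hexIn t) := by
    cases c
    · simp only [hexInAt]
      exact Equiv.sum_comp (Equiv.subRight (1 : Fin 3)) fun t => f (.hexIn t)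
    · rfl
  rw [← Equiv.sum_comp φ]
  simp only [Fintype.sum_sum_type, φ, Equiv.coe_fn_mk, Sum.elim_inl, Sum.elim_inr,
    Finset.sum_add_distrib, h2]
  cases c <;> simp only [side, Color.other] <;> abel

/-- The sum of the values of `f` on the edges whose end of colour `c` is `v`. -/
def vertexSum (f : Edge n → M) (c : Color) (v : Vertex n) : M :=
  ∑ x, if endpoint Q c x = v then f x else 0

theorem vertexSum_eq (f : Edge n → M) (c : Color) (v : Vertex n) : vertexSum Q f c v =
    ∑ t, (if .hex t c = v then f (.hexOut t) + f (hexInAt c t) else 0) +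
      ∑ s : Square n, ((if .sq s c = v then f (.far s) + f (side c.other s) else 0) +
        if endpoint Q c (attach Q s) = v then f (side c s) else 0) := by
  unfold vertexSum
  rw [sum_edge _ c]
  simp only [endpoint_hexOut, endpoint_hexInAt, endpoint_far, endpoint_side_other, endpoint_side]
  congr 1
  · refine Finset.sum_congr rfl fun t _ => ?_
    split_ifs <;> simp
  · refine Finset.sum_congr rfl fun s _ => ?_
    split_ifs <;> simp

/-- If the weight of an edge is a sum of contributions of the tiles that it bounds, then its vertex
sums are sums of contributions of the tiles.  Here `g k b` is the contribution of the tile `k` to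
those of its own edges that run from black to white (`b = true`) or from white to black around it,
and `r s` is the contribution of the square `s` to the edge that it shares with its parent. -/
theorem vertexSum_tiles (g : Fin n → Bool → M) (r : Square n → M) (c : Color) (v : Vertex n) :
    vertexSum Q (fun x => g (own x) (outward Q x) + ∑ s, if attach Q s = x then r s else 0) c v =
    ∑ t, (if .hex t c = v then g hexTile true + g hexTile false else 0) +
      ∑ s : Square n, ((if .sq s c = v then g s.1 true + g s.1 false else 0) +
        if endpoint Q c (attach Q s) = v then g s.1 (Q.arrow (parent s) s.1) + r s else 0) := by
  have h1 : vertexSum Q (fun x => g (own x) (outward Q x) +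
      ∑ s, if attach Q s = x then r s else 0) c v =
      vertexSum Q (fun x => g (own x) (outward Q x)) c v +
        ∑ s, if endpoint Q c (attach Q s) = v then r s else 0 := by
    unfold vertexSum
    have : ∀ x, (if endpoint Q c x = v then (g (own x) (outward Q x) +
        ∑ s, if attach Q s = x then r s else 0) else 0) =
        (if endpoint Q c x = v then g (own x) (outward Q x) else 0) +
          ∑ s, if attach Q s = x then
            (if endpoint Q c (attach Q s) = v then r s else 0) else 0 := by
      intro x
      split_ifs with h
      · congr 1
        refine Finset.sum_congr rfl fun s _ => ?_
        by_cases h2 : attach Q s = x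
        · simp [h2, h]
        · simp [h2]
      · rw [zero_add, Finset.sum_eq_zero]
        intro s _
        by_cases h2 : attach Q s = x
        · simp [h2, h]
        · simp [h2]
    simp only [this, Finset.sum_add_distrib]
    congr 1
    rw [Finset.sum_comm]
    simp
  rw [h1, vertexSum_eq, add_assoc, ← Finset.sum_add_distrib]
  congr 1
  · refine Finset.sum_congr rfl fun t _ => ?_
    cases c <;> rfl
  · refine Finset.sum_congr rfl fun s _ => ?_
    simp only [own_side, outward_side]
    have h3 : g (own (.far s)) (outward Q (.far s)) + g s.1 (Q.arrow (parent s) s.1) =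
        g s.1 true + g s.1 false := by
      simp only [own, outward, arrow_parent]
      cases Q.arrow s.1 (parent s) <;> simp [add_comm]
    rw [h3]
    split_ifs <;> simp [add_assoc]

end Sums

end

/-! ### Boundaries of sets of tiles -/

section

variable {n : ℕ} [hn : Fact (4 ≤ n)] (Q : DQuiver n)

open Classical in
/-- The boundary of a set `T` of tiles: the edges that bound exactly one tile of `T`. -/
noncomputable def bd (T : Finset (Fin n)) : Finset (Edge n) :=
  Finset.univ.filter fun x => ∃! k, k ∈ T ∧ x ∈ sides Q k

theorem encloses_iff {C : Finset (Edge n)} {T : Finset (Fin n)} :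
    Encloses Q C T ↔ C = bd Q T := by
  simp [Encloses, bd, Finset.ext_iff]

theorem mem_bd_outer {x : Edge n} (hx : IsOuter Q x) {T : Finset (Fin n)} :
    x ∈ bd Q T ↔ own x ∈ T := by
  have : ∀ k, x ∈ sides Q k ↔ own x = k := by
    intro k
    rw [mem_sides]
    exact or_iff_left (by rintro ⟨s, -, h⟩; exact hx s h)
  simp only [bd, Finset.mem_filter, Finset.mem_univ, true_and, this]
  constructor
  · rintro ⟨k, ⟨h1, rfl⟩, -⟩; exact h1
  · intro h; exact ⟨own x, ⟨h, rfl⟩, fun k hk => hk.2.symm⟩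

theorem mem_sides_attach {s : Square n} {k : Fin n} :
    attach Q s ∈ sides Q k ↔ k = parent s ∨ k = s.1 := by
  rw [mem_sides, own_attach]
  constructor
  · rintro (h | ⟨s', h1, h2⟩)
    · exact Or.inl h.symm
    · rw [← h1, attach_injective Q h2]; exact Or.inr rfl
  · rintro (h | h)
    · exact Or.inl h.symm
    · exact Or.inr ⟨s, h.symm, rfl⟩

theorem mem_bd_attach {s : Square n} {T : Finset (Fin n)} :
    attach Q s ∈ bd Q T ↔ ¬ (parent s ∈ T ↔ s.1 ∈ T) := by
  have hne := parent_ne s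
  simp only [bd, Finset.mem_filter, Finset.mem_univ, true_and, mem_sides_attach]
  constructor
  · rintro ⟨k, ⟨h1, h2⟩, h3⟩ h
    rcases h2 with rfl | rfl
    · exact hne (h3 _ ⟨h.1 h1, Or.inr rfl⟩).symm
    · exact hne (h3 _ ⟨h.2 h1, Or.inl rfl⟩)
  · intro h
    by_cases h1 : parent s ∈ T
    · have h2 : s.1 ∉ T := fun h2 => h ⟨fun _ => h2, fun _ => h1⟩
      refine ⟨parent s, ⟨h1, Or.inl rfl⟩, ?_⟩
      rintro k ⟨hk, rfl | rfl⟩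
      exacts [rfl, absurd hk h2]
    · have h2 : s.1 ∈ T := by by_contra h2; exact h ⟨fun h => absurd h h1, fun h => absurd h h2⟩
      refine ⟨s.1, ⟨h2, Or.inr rfl⟩, ?_⟩
      rintro k ⟨hk, rfl | rfl⟩
      exacts [absurd hk h1, rfl]

theorem bd_injective : Function.Injective (bd Q) := by
  intro T T' h
  ext k
  obtain ⟨x, rfl, hx⟩ := exists_isOuter Q k
  rw [← mem_bd_outer Q hx, ← mem_bd_outer Q hx, h]

theorem bd_nonempty {T : Finset (Fin n)} (hT : T.Nonempty) : (bd Q T).Nonempty := by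
  obtain ⟨k, hk⟩ := hT
  obtain ⟨x, rfl, hx⟩ := exists_isOuter Q k
  exact ⟨x, (mem_bd_outer Q hx).2 hk⟩

theorem sum_attach {M : Type*} [AddCommMonoid M] (s : Square n) (r : Square n → M) :
    ∑ s', (if attach Q s' = attach Q s then r s' else 0) = r s := by
  rw [Finset.sum_eq_single s]
  · simp
  · intro s' _ h; rw [if_neg (fun e => h (attach_injective Q e))]
  · simp

theorem sum_outer {M : Type*} [AddCommMonoid M] {x : Edge n} (hx : IsOuter Q x)
    (r : Square n → M) : ∑ s, (if attach Q s = x then r s else 0) = 0 :=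
  Finset.sum_eq_zero fun s _ => if_neg (hx s)

/-- The indicator function of a boundary, modulo 2, as a sum of contributions of tiles. -/
theorem indicator_bd_zmod (T : Finset (Fin n)) (x : Edge n) :
    (if x ∈ bd Q T then (1 : ZMod 2) else 0) = (if own x ∈ T then 1 else 0) +
      ∑ s : Square n, if attach Q s = x then (if s.1 ∈ T then 1 else 0) else 0 := by
  rcases isOuter_or_attach Q x with hx | ⟨s, rfl⟩
  · rw [sum_outer Q hx, add_zero]; simp [mem_bd_outer Q hx]
  · rw [sum_attach Q s (fun s => if s.1 ∈ T then (1 : ZMod 2) else 0), own_attach]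
    simp only [mem_bd_attach]
    by_cases h1 : parent s ∈ T <;> by_cases h2 : s.1 ∈ T <;> simp [h1, h2]; decide

/-- The integral version of `indicator_bd_zmod`: an edge between two tiles of `T` is counted twice,
and this is corrected at the square that it is glued along. -/
theorem indicator_bd_int (T : Finset (Fin n)) (x : Edge n) :
    (if x ∈ bd Q T then (1 : ℤ) else 0) = (if own x ∈ T then 1 else 0) +
      ∑ s : Square n, if attach Q s = x then
        ((if s.1 ∈ T then 1 else 0) - if s.1 ∈ T ∧ parent s ∈ T then 2 else 0) else 0 := by
  rcases isOuter_or_attach Q x with hx | ⟨s, rfl⟩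
  · rw [sum_outer Q hx, add_zero]; simp [mem_bd_outer Q hx]
  · rw [sum_attach Q s (fun s => (if s.1 ∈ T then (1 : ℤ) else 0) -
      if s.1 ∈ T ∧ parent s ∈ T then 2 else 0), own_attach]
    simp only [mem_bd_attach]
    by_cases h1 : parent s ∈ T <;> by_cases h2 : s.1 ∈ T <;> simp [h1, h2]

theorem card_bd (T : Finset (Fin n)) : ((bd Q T).card : ℤ) = (if hexTile ∈ T then 6 else 0) +
    ∑ s : Square n, if s.1 ∈ T then (if parent s ∈ T then 2 else 4) else 0 := by
  have h : ((bd Q T).card : ℤ) = ∑ x, if x ∈ bd Q T then (1 : ℤ) else 0 := by simp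
  rw [h]
  simp only [indicator_bd_int, Finset.sum_add_distrib]
  rw [Finset.sum_comm (s := Finset.univ (α := Edge n)), sum_edge _ .white]
  have h1 : ∑ t : Fin 3, ((if own (Edge.hexOut t : Edge n) ∈ T then (1 : ℤ) else 0) +
      if own (hexInAt .white t : Edge n) ∈ T then 1 else 0) = if hexTile ∈ T then 6 else 0 := by
    by_cases h : (hexTile : Fin n) ∈ T <;> simp [hexInAt, h]
  rw [h1, add_assoc, ← Finset.sum_add_distrib]
  congr 1
  refine Finset.sum_congr rfl fun s _ => ?_
  rw [Finset.sum_ite_eq]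
  simp only [own_side, own_far]
  by_cases h1 : parent s ∈ T <;> by_cases h2 : s.1 ∈ T <;> simp [h1, h2]

/-- The edges of `f` have even degree everywhere. -/
def IsEven (f : Edge n → ZMod 2) : Prop := ∀ c v, vertexSum Q f c v = 0

variable {Q}

theorem IsEven.add {f g : Edge n → ZMod 2} (hf : IsEven Q f) (hg : IsEven Q g) :
    IsEven Q (f + g) := by
  intro c v
  have : vertexSum Q (f + g) c v = vertexSum Q f c v + vertexSum Q g c v := by
    unfold vertexSum
    rw [← Finset.sum_add_distrib]
    refine Finset.sum_congr rfl fun x _ => ?_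
    split_ifs <;> simp
  rw [this, hf, hg, add_zero]

variable (Q)

theorem isEven_bd (T : Finset (Fin n)) :
    IsEven Q fun x => if x ∈ bd Q T then (1 : ZMod 2) else 0 := by
  intro c v
  have h := vertexSum_tiles Q (M := ZMod 2) (fun k _ => if k ∈ T then 1 else 0)
    (fun s => if s.1 ∈ T then 1 else 0) c v
  have h2 : ∀ a : ZMod 2, a + a = 0 := by decide
  simp only [h2, ite_self, Finset.sum_const_zero] at h
  simp only [indicator_bd_zmod]
  exact h

theorem zmod_two_eq {a b : ZMod 2} (h : a + b = 0) : a = b := by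
  revert a b; decide

/-- An even set of edges that misses an edge of every tile is empty: by induction towards the
hexagon, each square has all or none of its own edges. -/
theorem IsEven.eq_zero {f : Edge n → ZMod 2} (hf : IsEven Q f)
    (h : ∀ k, ∃ x, own x = k ∧ f x = 0) : f = 0 := by
  have hsq : ∀ k : Fin n, ∀ s : Square n, s.1 = k →
      f (.far s) = 0 ∧ ∀ c, f (side c s) = 0 := by
    intro k
    induction k using WellFoundedLT.induction with
    | ind k ih =>
      rintro s rfl
      have hs : ∀ c : Color, f (.far s) = f (side c.other s) := by
        intro c
        have h1 := hf c (.sq s c)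
        rw [vertexSum_eq] at h1
        simp only [reduceCtorEq, if_false, Finset.sum_const_zero, zero_add,
          Finset.sum_add_distrib] at h1
        rw [Finset.sum_eq_single s, Finset.sum_eq_zero] at h1
        · simp only [if_true, add_zero] at h1
          exact zmod_two_eq h1
        · intro s' _
          split_ifs with h2
          · exact (ih s'.1 (lt_of_endpoint_attach Q h2).1 s' rfl).2 c
          · rfl
        · intro s' _ h2; rw [if_neg]; simpa using h2
        · simp
      have hs' : ∀ c : Color, f (side c s) = f (.far s) := by
        intro c; have := hs c.other; simpa using this.symm
      obtain ⟨x, hx, h0⟩ := h s.1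
      have hfar : f (.far s) = 0 := by
        have aux : ∀ x, own x = s.1 → f x = 0 → f (.far s) = 0 := by
          intro x
          induction x using edge_cases with
          | h1 t => intro h; exact absurd (eq_hexTile.1 h.symm) s.2
          | h2 t => intro h; exact absurd (eq_hexTile.1 h.symm) s.2
          | h3 s' => intro h h0; rwa [← show s' = s from Subtype.ext h]
          | h4 c s' =>
            intro h h0
            rw [own_side] at h
            rw [show s' = s from Subtype.ext h, hs'] at h0
            exact h0
        exact aux x hx h0
      exact ⟨hfar, fun c => by rw [hs', hfar]⟩
  have hhex : ∀ c t, f (.hexOut t) = f (hexInAt c t) := by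
    intro c t
    have h1 := hf c (.hex t c)
    rw [vertexSum_eq] at h1
    simp only [(hsq _ _ rfl).2, ite_self, reduceCtorEq, if_false, add_zero, Finset.sum_const_zero,
      Vertex.hex.injEq, and_true, Finset.sum_ite_eq', Finset.mem_univ, if_true] at h1
    exact zmod_two_eq h1
  have hin : ∀ t, f (.hexIn t) = f (.hexOut t) := fun t => (hhex .white t).symm
  have hout : ∀ t, f (.hexOut (t + 1)) = f (.hexOut t) := by
    intro t
    have := hhex .black (t + 1)
    rw [this, ← hin]; simp [hexInAt]
  have hout' : ∀ t, f (.hexOut t) = f (.hexOut 0) := by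
    have h1 := hout 0
    have h2 := hout 1
    simp only [Fin.isValue, zero_add] at h1
    have e : (1 : Fin 3) + 1 = 2 := rfl
    rw [e] at h2
    intro t
    fin_cases t
    · rfl
    · exact h1
    · exact h2.trans h1
  obtain ⟨x, hx, h0⟩ := h hexTile
  have h00 : f (.hexOut 0) = 0 := by
    have aux : ∀ x, own x = hexTile → f x = 0 → f (.hexOut 0) = 0 := by
      intro x
      induction x using edge_cases with
      | h1 t => intro _ h; rwa [hout'] at h
      | h2 t => intro _ h; rwa [hin, hout'] at h
      | h3 s => intro h; exact absurd (eq_hexTile.1 h) s.2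
      | h4 c s => intro h; rw [own_side] at h; exact absurd (eq_hexTile.1 h) s.2
    exact aux x hx h0
  ext x
  induction x using edge_cases with
  | h1 t => rw [hout', h00]; rfl
  | h2 t => rw [hin, hout', h00]; rfl
  | h3 s => exact (hsq _ s rfl).1
  | h4 c s => exact (hsq _ s rfl).2 c

/-- Every even set of edges is the boundary of a set of tiles: add the boundaries of the tiles whose
chosen boundary edge belongs to the set, and apply `IsEven.eq_zero` to the sum. -/
theorem exists_eq_bd {C : Finset (Edge n)}
    (hC : IsEven Q fun x => if x ∈ C then (1 : ZMod 2) else 0) : ∃ T, C = bd Q T := by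
  choose y hy hyo using fun k => exists_isOuter Q k
  let T : Finset (Fin n) := Finset.univ.filter fun k => y k ∈ C
  refine ⟨T, ?_⟩
  have h := IsEven.eq_zero Q (hC.add (isEven_bd Q T)) fun k => ⟨y k, hy k, by
    simp only [Pi.add_apply, mem_bd_outer Q (hyo k), hy]
    by_cases h : y k ∈ C <;> simp [T, h] ; decide⟩
  ext x
  have hx := congrFun h x
  simp only [Pi.add_apply, Pi.zero_apply] at hx
  have := zmod_two_eq hx
  by_cases h1 : x ∈ C <;> by_cases h2 : x ∈ bd Q T <;> simp_all

end

/-! ### Cycles of the base graph -/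

section

variable {n : ℕ} [hn : Fact (4 ≤ n)] (Q : DQuiver n)

instance : Finite (Vertex n) := by
  refine Finite.of_surjective
    (fun a : (Fin 3 × Bool) ⊕ (Square n × Bool) => match a with
      | .inl (t, b) => Vertex.hex t (if b then .black else .white)
      | .inr (s, b) => Vertex.sq s (if b then .black else .white)) ?_
  rintro (⟨t, _ | _⟩ | ⟨s, _ | _⟩)
  · exact ⟨.inl (t, true), rfl⟩
  · exact ⟨.inl (t, false), rfl⟩
  · exact ⟨.inr (s, true), rfl⟩
  · exact ⟨.inr (s, false), rfl⟩

theorem ends_eq (c : Color) (x : Edge n) :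
    ends Q x = s(endpoint Q c x, endpoint Q c.other x) := by
  cases c
  · rfl
  · exact Sym2.eq_swap

theorem endpoint_ne (c : Color) (x y : Edge n) : endpoint Q c x ≠ endpoint Q c.other y := by
  intro h
  have := congrArg Vertex.color h
  rw [color_endpoint, color_endpoint] at this
  exact other_ne c this.symm

theorem not_isDiag_ends (x : Edge n) : ¬ (ends Q x).IsDiag := by
  rw [ends_eq Q .black, Sym2.mk_isDiag_iff]
  exact endpoint_ne Q _ x x

/-- The graph formed by a set of edges. -/
def edgeGraph (K : Set (Edge n)) : SimpleGraph (Vertex n) :=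
  SimpleGraph.fromEdgeSet (ends Q '' K)

theorem mem_edgeSet_edgeGraph {K : Set (Edge n)} {e : Sym2 (Vertex n)} :
    e ∈ (edgeGraph Q K).edgeSet ↔ ∃ x ∈ K, ends Q x = e := by
  simp only [edgeGraph, SimpleGraph.edgeSet_fromEdgeSet, Set.mem_sdiff, Set.mem_image]
  constructor
  · rintro ⟨h, -⟩; exact h
  · rintro ⟨x, hx, rfl⟩; exact ⟨⟨x, hx, rfl⟩, not_isDiag_ends Q x⟩

theorem edgeGraph_adj {K : Set (Edge n)} {x : Edge n} (hx : x ∈ K) (c : Color) :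
    (edgeGraph Q K).Adj (endpoint Q c x) (endpoint Q c.other x) := by
  rw [← SimpleGraph.mem_edgeSet, ← ends_eq, mem_edgeSet_edgeGraph]
  exact ⟨x, hx, rfl⟩

theorem edgeGraph_adj_iff {K : Set (Edge n)} {u v : Vertex n} : (edgeGraph Q K).Adj u v ↔
    ∃ x ∈ K, endpoint Q u.color x = u ∧ endpoint Q u.color.other x = v := by
  rw [← SimpleGraph.mem_edgeSet, mem_edgeSet_edgeGraph]
  constructor
  · rintro ⟨x, hx, h⟩
    have h1 : u ∈ ends Q x := by rw [h]; simp
    rw [mem_ends] at h1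
    refine ⟨x, hx, h1, ?_⟩
    rw [ends_eq Q u.color, h1] at h
    exact Sym2.congr_right.1 h
  · rintro ⟨x, hx, h1, h2⟩
    exact ⟨x, hx, by rw [ends_eq Q u.color, h1, h2]⟩

theorem baseGraph_eq : baseGraph Q = edgeGraph Q Set.univ := by
  simp [baseGraph, edgeGraph]

theorem mem_edgeSet_baseGraph {e : Sym2 (Vertex n)} :
    e ∈ (baseGraph Q).edgeSet ↔ ∃ x, ends Q x = e := by
  rw [baseGraph_eq, mem_edgeSet_edgeGraph]; simp

variable {Q}

theorem card_filter_zmod (K : Finset (Edge n)) (c : Color) (v : Vertex n) :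
    vertexSum Q (fun x => if x ∈ K then (1 : ZMod 2) else 0) c v =
      ((K.filter fun x => endpoint Q c x = v).card : ZMod 2) := by
  unfold vertexSum
  rw [Finset.card_filter, Nat.cast_sum, ← Finset.sum_filter_add_sum_filter_not Finset.univ (· ∈ K)]
  rw [Finset.sum_eq_zero (s := Finset.univ.filter fun x => x ∉ K), add_zero]
  · rw [Finset.filter_mem_eq_inter, Finset.univ_inter]
    refine Finset.sum_congr rfl fun x hx => ?_
    simp [hx]
  · intro x hx; simp at hx; simp [hx]

/-- Even sets of edges, in terms of degrees. -/
theorem isEven_iff {K : Finset (Edge n)} :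
    IsEven Q (fun x => if x ∈ K then (1 : ZMod 2) else 0) ↔
      ∀ c v, Even (K.filter fun x => endpoint Q c x = v).card := by
  simp only [IsEven, card_filter_zmod, ZMod.natCast_eq_zero_iff_even]

theorem filter_endpoint_of_ne {K : Finset (Edge n)} {c : Color} {v : Vertex n} (h : v.color ≠ c) :
    (K.filter fun x => endpoint Q c x = v) = ∅ := by
  rw [Finset.filter_eq_empty_iff]
  rintro x - rfl
  exact h (color_endpoint Q c x)

theorem IsCycle.nonempty {C : Finset (Edge n)} (hC : IsCycle Q C) : C.Nonempty := by
  obtain ⟨u, p, hp, hC⟩ := hC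
  have h1 := hp.three_le_length
  rw [← SimpleGraph.Walk.length_edges] at h1
  obtain ⟨e, he⟩ := List.exists_mem_of_length_pos (l := p.edges) (by omega)
  obtain ⟨x, rfl⟩ := (mem_edgeSet_baseGraph Q).1 (p.edges_subset_edgeSet he)
  exact ⟨x, (hC x).2 he⟩

theorem IsCycle.isEven {C : Finset (Edge n)} (hC : IsCycle Q C) :
    IsEven Q (fun x => if x ∈ C then (1 : ZMod 2) else 0) := by
  classical
  obtain ⟨u, p, hp, hC⟩ := hC
  rw [isEven_iff]
  intro c v
  by_cases hc : v.color = c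
  · subst hc
    have h := (hp.isTrail.even_countP_edges_iff v).2 (fun h => absurd rfl h)
    convert h using 1
    rw [List.countP_eq_length_filter, ← List.toFinset_card_of_nodup
      (hp.isTrail.edges_nodup.filter _), List.toFinset_filter]
    refine Finset.card_bij (fun x _ => ends Q x) ?_ ?_ ?_
    · intro x hx
      rw [Finset.mem_filter] at hx ⊢
      exact ⟨List.mem_toFinset.2 ((hC x).1 hx.1), by simpa using (mem_ends Q).2 hx.2⟩
    · intro x _ y _ h; exact ends_injective Q h
    · intro e he
      rw [Finset.mem_filter, List.mem_toFinset] at he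
      obtain ⟨x, rfl⟩ := (mem_edgeSet_baseGraph Q).1 (p.edges_subset_edgeSet he.1)
      exact ⟨x, Finset.mem_filter.2 ⟨(hC x).2 he.1, (mem_ends Q).1 (by simpa using he.2)⟩, rfl⟩
  · rw [filter_endpoint_of_ne hc]; simp

theorem IsCycle.card_filter_le {C : Finset (Edge n)} (hC : IsCycle Q C) (c : Color)
    (v : Vertex n) : (C.filter fun x => endpoint Q c x = v).card ≤ 2 := by
  classical
  obtain ⟨u, p, hp, hC⟩ := hC
  rcases Finset.eq_empty_or_nonempty (C.filter fun x => endpoint Q c x = v) with h | ⟨x, hx⟩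
  · simp [h]
  rw [Finset.mem_filter] at hx
  have hv : v ∈ p.support := by
    have h1 := (hC x).1 hx.1
    rw [ends_eq Q c, hx.2] at h1
    exact p.fst_mem_support_of_mem_edges h1
  rw [← hp.ncard_neighborSet_toSubgraph_eq_two hv, ← Set.ncard_coe_finset]
  refine Set.ncard_le_ncard_of_injOn (fun x => endpoint Q c.other x) ?_ ?_ ?_
  · intro y hy
    rw [Finset.mem_coe, Finset.mem_filter] at hy
    have h1 := (hC y).1 hy.1
    rw [ends_eq Q c, hy.2] at h1
    rw [SimpleGraph.Subgraph.mem_neighborSet, ← SimpleGraph.Subgraph.mem_edgeSet]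
    exact p.mem_edges_toSubgraph.2 h1
  · intro y hy z hz h
    rw [Finset.mem_coe, Finset.mem_filter] at hy hz
    apply ends_injective Q
    rw [ends_eq Q c, ends_eq Q c, hy.2, hz.2]
    exact congrArg _ h
  · exact Set.toFinite _

theorem _root_.SimpleGraph.Walk.forall_mem_support {V : Type*} {G : SimpleGraph V} {U : Set V}
    {u v : V} (p : G.Walk u v) (h : ∀ a b, s(a, b) ∈ p.edges → a ∈ U → b ∈ U) (hu : u ∈ U) :
    ∀ w ∈ p.support, w ∈ U := by
  induction p with
  | nil => simpa using hu
  | cons hadj p ih =>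
    intro w hw
    rw [SimpleGraph.Walk.support_cons, List.mem_cons] at hw
    rcases hw with rfl | hw
    · exact hu
    · refine ih (fun a b hab => h a b ?_) (h _ _ ?_ hu) w hw
      · rw [SimpleGraph.Walk.edges_cons]; exact List.mem_cons_of_mem _ hab
      · rw [SimpleGraph.Walk.edges_cons]; exact List.mem_cons_self ..

/-- A cycle does not contain a proper nonempty even set of edges: all vertices of a cycle have
degree 2 in it, so the set and its complement in the cycle would have no vertex in common. -/
theorem IsCycle.eq_of_subset {C K : Finset (Edge n)} (hC : IsCycle Q C) (hKC : K ⊆ C)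
    (hK : IsEven Q fun x => if x ∈ K then (1 : ZMod 2) else 0) (hne : K.Nonempty) : K = C := by
  classical
  have hL : IsEven Q fun x => if x ∈ C \ K then (1 : ZMod 2) else 0 := by
    convert hC.isEven.add hK using 1
    ext x
    by_cases h1 : x ∈ C <;> by_cases h2 : x ∈ K <;> simp [h1, h2]
    · decide
    · exact absurd (hKC h2) h1
  rw [isEven_iff] at hK hL
  by_contra hKC'
  obtain ⟨y, hyC, hyK⟩ := Finset.exists_of_ssubset (hKC.ssubset_of_ne hKC')
  obtain ⟨x, hx⟩ := hne
  -- a vertex of degree two in each of the two parts would have degree four in the cycle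
  have hdisj : ∀ c v, ∀ z ∈ K, endpoint Q c z = v → ∀ z' ∈ C \ K, endpoint Q c z' ≠ v := by
    intro c v z hz hzv z' hz' hzv'
    have pos : ∀ L : Finset (Edge n), Even (L.filter fun x => endpoint Q c x = v).card →
        (∃ z ∈ L, endpoint Q c z = v) → 2 ≤ (L.filter fun x => endpoint Q c x = v).card := by
      rintro L hL ⟨z, hz, hzv⟩
      have : 0 < (L.filter fun x => endpoint Q c x = v).card :=
        Finset.card_pos.2 ⟨z, Finset.mem_filter.2 ⟨hz, hzv⟩⟩
      obtain ⟨m, hm⟩ := hL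
      omega
    have h1 := pos K (hK c v) ⟨z, hz, hzv⟩
    have h2 := pos _ (hL c v) ⟨z', hz', hzv'⟩
    have h3 := hC.card_filter_le c v
    have h4 : (C.filter fun x => endpoint Q c x = v).card =
        (K.filter fun x => endpoint Q c x = v).card +
          ((C \ K).filter fun x => endpoint Q c x = v).card := by
      rw [← Finset.card_union_of_disjoint (Finset.disjoint_filter_filter Finset.disjoint_sdiff),
        ← Finset.filter_union, Finset.union_sdiff_of_subset hKC]
    omega
  obtain ⟨u, p, hp, hCp⟩ := hC
  let U : Set (Vertex n) := {v | ∃ z ∈ K, v ∈ ends Q z}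
  have hstep : ∀ a b, s(a, b) ∈ p.edges → a ∈ U → b ∈ U := by
    rintro a b hab ⟨z, hz, ha⟩
    obtain ⟨z', hz'⟩ := (mem_edgeSet_baseGraph Q).1 (p.edges_subset_edgeSet hab)
    have hz'C : z' ∈ C := (hCp z').2 (hz' ▸ hab)
    have ha' : a ∈ ends Q z' := by rw [hz']; simp
    rw [mem_ends] at ha ha'
    have hz'K : z' ∈ K := by
      by_contra h
      exact hdisj _ _ z hz ha z' (Finset.mem_sdiff.2 ⟨hz'C, h⟩) ha'
    exact ⟨z', hz'K, by rw [hz']; simp⟩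
  have hx' := (hCp x).1 (hKC hx)
  have hy' := (hCp y).1 hyC
  have ha : endpoint Q .black x ∈ p.support := p.fst_mem_support_of_mem_edges hx'
  have hb : endpoint Q .black y ∈ p.support := p.fst_mem_support_of_mem_edges hy'
  have hbU : endpoint Q .black y ∈ U := by
    refine SimpleGraph.Walk.forall_mem_support (U := U) (p.rotate _ ha)
      (fun a b hab => hstep a b ?_)
      ⟨x, hx, ?_⟩ _ ?_
    · exact (p.rotate_edges _ ha).mem_iff.1 hab
    · rw [ends_eq Q .black]; simp
    · exact (p.mem_support_rotate_iff _ ha).2 hb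
  obtain ⟨z, hz, hzb⟩ := hbU
  rw [mem_ends, color_endpoint] at hzb
  exact hdisj _ _ z hz hzb y (Finset.mem_sdiff.2 ⟨hyC, hyK⟩) rfl

/-- A nonempty even set of edges contains a cycle, since the last edge of a longest path in a forest
ends in a vertex of degree one. -/
theorem exists_isCycle_subset {K : Finset (Edge n)}
    (hK : IsEven Q fun x => if x ∈ K then (1 : ZMod 2) else 0) (hne : K.Nonempty) :
    ∃ C ⊆ K, IsCycle Q C := by
  classical
  have hac : ¬ (edgeGraph Q (K : Set (Edge n))).IsAcyclic := by
    intro hac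
    have : Nonempty (Vertex n) := ⟨.hex 0 .black⟩
    obtain ⟨u, v, p, hp, hmax⟩ :=
      SimpleGraph.Walk.exists_isPath_forall_isPath_length_le_length
        (edgeGraph Q (K : Set (Edge n)))
    obtain ⟨x, hx⟩ := hne
    have h1 := hmax _ _ _ (SimpleGraph.Path.singleton
      (edgeGraph_adj Q (K := (K : Set (Edge n))) (Finset.mem_coe.2 hx) .black)).2
    rw [SimpleGraph.Path.singleton_coe] at h1
    have hnn : ¬ p.Nil := by
      intro h
      rw [← SimpleGraph.Walk.length_eq_zero_iff] at h
      simp [h] at h1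
    obtain ⟨y, hy, hyu, hysnd⟩ := (edgeGraph_adj_iff Q).1 (p.adj_snd hnn)
    obtain ⟨z, hz, hzy⟩ : ∃ z ∈ K.filter fun x => endpoint Q u.color x = u, z ≠ y := by
      apply Finset.exists_mem_ne
      have h2 := (isEven_iff.1 hK) u.color u
      have : 0 < (K.filter fun x => endpoint Q u.color x = u).card :=
        Finset.card_pos.2 ⟨y, Finset.mem_filter.2 ⟨hy, hyu⟩⟩
      obtain ⟨m, hm⟩ := h2
      omega
    rw [Finset.mem_filter] at hz
    have hadj := edgeGraph_adj Q (K := (K : Set (Edge n))) (Finset.mem_coe.2 hz.1) u.color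
    rw [hz.2] at hadj
    by_cases hs : endpoint Q u.color.other z ∈ p.support
    · have h3 := hac.eq_snd_of_adj_start hp hadj hs
      apply hzy
      apply ends_injective Q
      rw [ends_eq Q u.color, ends_eq Q u.color, hyu, hz.2, hysnd, h3]
    · have h4 := hmax _ _ _ (hp.cons hs (h := hadj.symm))
      simp at h4
  simp only [SimpleGraph.IsAcyclic, not_forall, not_not] at hac
  obtain ⟨v, p, hp⟩ := hac
  have hle : edgeGraph Q (K : Set (Edge n)) ≤ baseGraph Q := by
    rw [baseGraph_eq]
    exact SimpleGraph.fromEdgeSet_mono (Set.image_mono (Set.subset_univ _))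
  refine ⟨Finset.univ.filter fun x => ends Q x ∈ p.edges, ?_, v, p.mapLe hle,
    (SimpleGraph.Walk.isCycle_mapLe hle).2 hp, ?_⟩
  · intro x hx
    rw [Finset.mem_filter] at hx
    obtain ⟨y, hy, hyx⟩ := (mem_edgeSet_edgeGraph Q).1 (p.edges_subset_edgeSet hx.2)
    rw [← ends_injective Q hyx]
    exact hy
  · intro x
    rw [SimpleGraph.Walk.edges_mapLe_eq_edges]
    simp

/-- A nonempty set of tiles that is connected in the diagram: a nonempty subset that contains with a
tile also its neighbours in `T` is equal to `T`. -/
def TileConnected (T : Finset (Fin n)) : Prop :=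
  T.Nonempty ∧ ∀ T' ⊆ T, T'.Nonempty →
    (∀ s : Square n, s.1 ∈ T → parent s ∈ T → (s.1 ∈ T' ↔ parent s ∈ T')) → T' = T

/-- The cycles of the base graph are the boundaries of the connected sets of tiles, because both are
the minimal nonempty even sets of edges. -/
theorem isCycle_iff {C : Finset (Edge n)} :
    IsCycle Q C ↔ ∃ T, TileConnected T ∧ C = bd Q T := by
  constructor
  · intro hC
    obtain ⟨T, rfl⟩ := exists_eq_bd Q hC.isEven
    refine ⟨T, ⟨?_, ?_⟩, rfl⟩
    · rw [Finset.nonempty_iff_ne_empty]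
      rintro rfl
      obtain ⟨x, hx⟩ := hC.nonempty
      simp [bd] at hx
    · intro T' hT' hne hcl
      apply bd_injective Q
      refine hC.eq_of_subset ?_ (isEven_bd Q T') (bd_nonempty Q hne)
      intro x hx
      rcases isOuter_or_attach Q x with h | ⟨s, rfl⟩
      · rw [mem_bd_outer Q h] at hx ⊢; exact hT' hx
      · rw [mem_bd_attach] at hx ⊢
        have := hcl s
        have h1 := @hT' s.1
        have h2 := @hT' (parent s)
        tauto
  · rintro ⟨T, ⟨hne, hT⟩, rfl⟩
    obtain ⟨C, hCT, hC⟩ := exists_isCycle_subset (isEven_bd Q T) (bd_nonempty Q hne)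
    obtain ⟨T', rfl⟩ := exists_eq_bd Q hC.isEven
    have hne' : T'.Nonempty := by
      rw [Finset.nonempty_iff_ne_empty]
      rintro rfl
      obtain ⟨x, hx⟩ := hC.nonempty
      simp [bd] at hx
    have hsub : T' ⊆ T := by
      intro k hk
      obtain ⟨x, rfl, hx⟩ := exists_isOuter Q k
      exact (mem_bd_outer Q hx).1 (hCT ((mem_bd_outer Q hx).2 hk))
    rw [← hT T' hsub hne' ?_]
    · exact hC
    · intro s h1 h2
      by_contra h
      have h3 : attach Q s ∈ bd Q T' := (mem_bd_attach Q).2 (fun e => h e.symm)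
      exact (mem_bd_attach Q).1 (hCT h3) ⟨fun _ => h1, fun _ => h2⟩

end

/-! ### Connected sets of tiles -/

section

variable {n : ℕ} [hn : Fact (4 ≤ n)] (Q : DQuiver n)

/-- The path from the tile `k` to the hexagon passes through the square `s`. -/
def Below (s : Square n) (k : Fin n) : Prop := k = s.1 ∨ k < s.1 ∧ (s.1 : ℕ) + 4 ≤ n

instance (s : Square n) : DecidablePred (Below s) := fun _ => inferInstanceAs (Decidable (_ ∨ _))

theorem below_iff (s s' : Square n) : Below s s'.1 ↔ s' = s ∨ Below s (parent s') := by
  have := hn.out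
  have h1 := s.1.2
  have h2 := s'.1.2
  have h3 := s.2
  have h4 := s'.2
  simp only [Below, parent, Fin.lt_def, Fin.ext_iff, Subtype.ext_iff]
  omega

theorem not_below_parent (s : Square n) : ¬ Below s (parent s) := by
  have := hn.out
  have h1 := s.1.2
  have h3 := s.2
  simp only [Below, parent, Fin.lt_def, Fin.ext_iff]
  omega

theorem not_below_hexTile (s : Square n) : ¬ Below s hexTile := by
  have h3 := s.2
  have := hn.out
  simp only [Below, hexTile, Fin.lt_def, Fin.ext_iff]
  omega

theorem Below.antisymm {s s' : Square n} (h : Below s s'.1) (h' : Below s' s.1) : s = s' := by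
  simp only [Below, Fin.lt_def, Fin.ext_iff, Subtype.ext_iff] at *
  omega

/-- If a connected set of tiles contains a square but not its parent, it lies below this square. -/
theorem TileConnected.below {T : Finset (Fin n)} (hT : TileConnected T) {s : Square n}
    (hs : s.1 ∈ T) (hp : parent s ∉ T) {k : Fin n} (hk : k ∈ T) : Below s k := by
  have h := hT.2 (T.filter (Below s)) (Finset.filter_subset _ _)
    ⟨s.1, Finset.mem_filter.2 ⟨hs, Or.inl rfl⟩⟩ ?_
  · rw [← h] at hk; exact (Finset.mem_filter.1 hk).2
  · intro s' h1 h2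
    simp only [Finset.mem_filter, h1, h2, true_and]
    rw [below_iff]
    refine or_iff_right ?_
    rintro rfl
    exact hp h2

theorem sum_tiles {M : Type*} [AddCommMonoid M] (f : Fin n → M) :
    ∑ k, f k = f hexTile + ∑ s : Square n, f s.1 := by
  rw [← Finset.add_sum_erase _ _ (Finset.mem_univ hexTile)]
  congr 1
  refine Finset.sum_subtype _ (fun k => ?_) f
  simp [eq_hexTile]

/-- The length of a cycle is determined by the number of tiles that it encloses and by whether the
hexagon is among them. -/
theorem TileConnected.card_bd {T : Finset (Fin n)} (hT : TileConnected T) :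
    ((bd Q T).card : ℤ) = 2 * T.card + 2 + if hexTile ∈ T then 2 else 0 := by
  have h1 : (T.card : ℤ) = (if hexTile ∈ T then 1 else 0) +
      ∑ s : Square n, if s.1 ∈ T then 1 else 0 := by
    rw [← sum_tiles fun k => if k ∈ T then (1 : ℤ) else 0]; simp
  have h2 : ∑ s : Square n, (if s.1 ∈ T ∧ parent s ∉ T then (1 : ℤ) else 0) =
      if hexTile ∈ T then 0 else 1 := by
    split_ifs with hh
    · refine Finset.sum_eq_zero fun s _ => if_neg ?_
      rintro ⟨h1, h2⟩
      exact not_below_hexTile s (hT.below h1 h2 hh)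
    · obtain ⟨s, h3, h4⟩ : ∃ s : Square n, s.1 ∈ T ∧ parent s ∉ T := by
        by_contra! hc
        obtain ⟨k, hk⟩ := hT.1
        refine hh (root_induction (P := fun k => k ∈ T → hexTile ∈ T) id ?_ k hk)
        intro s ih hs
        exact ih (hc s hs)
      rw [Finset.sum_eq_single s]
      · simp [h3, h4]
      · intro s' _ hne
        refine if_neg ?_
        rintro ⟨h5, h6⟩
        exact hne ((hT.below h5 h6 h3).antisymm (hT.below h3 h4 h5))
      · simp
  rw [MixedDimer.card_bd, h1]
  have h3 : ∑ s : Square n, (if s.1 ∈ T then (if parent s ∈ T then (2 : ℤ) else 4) else 0) =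
      2 * (∑ s : Square n, if s.1 ∈ T then 1 else 0) +
        2 * ∑ s : Square n, (if s.1 ∈ T ∧ parent s ∉ T then (1 : ℤ) else 0) := by
    rw [Finset.mul_sum, Finset.mul_sum, ← Finset.sum_add_distrib]
    refine Finset.sum_congr rfl fun s _ => ?_
    by_cases h1 : parent s ∈ T <;> by_cases h2 : s.1 ∈ T <;> simp [h1, h2]
  rw [h3, h2]
  split_ifs <;> ring

/-- The length of the bounding cycle is strictly monotone on connected sets of tiles. -/
theorem TileConnected.eq_of_card_bd_le {T B : Finset (Fin n)} (hT : TileConnected T)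
    (hB : TileConnected B) (h : T ⊆ B) (hc : (bd Q B).card ≤ (bd Q T).card) : T = B := by
  refine Finset.eq_of_subset_of_card_le h ?_
  have h1 := hT.card_bd Q
  have h2 := hB.card_bd Q
  by_cases h3 : hexTile ∈ T
  · simp only [h3, h h3, if_true] at h1 h2; omega
  · simp only [h3, if_false] at h1
    split_ifs at h2 <;> omega

/-- `B` is a union of connected components of the subgraph of the diagram induced on `F`. -/
def ClosedIn (B F : Finset (Fin n)) : Prop :=
  ∀ s : Square n, s.1 ∈ F → parent s ∈ F → (s.1 ∈ B ↔ parent s ∈ B)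

/-- A connected subset of `F` lies in one connected component of `F`. -/
theorem TileConnected.subset_of_mem {T F B : Finset (Fin n)} (hT : TileConnected T) (hTF : T ⊆ F)
    (hB : ClosedIn B F) {k : Fin n} (hkT : k ∈ T) (hkB : k ∈ B) : T ⊆ B := by
  have h := hT.2 (T ∩ B) Finset.inter_subset_left ⟨k, Finset.mem_inter.2 ⟨hkT, hkB⟩⟩ ?_
  · rw [← h]; exact Finset.inter_subset_right
  · intro s h1 h2
    simp only [Finset.mem_inter, h1, h2, true_and]
    exact hB s (hTF h1) (hTF h2)

/-- The connected component of a tile in a set of tiles. -/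
theorem exists_component (F : Finset (Fin n)) {k₀ : Fin n} (hk : k₀ ∈ F) :
    ∃ B ⊆ F, k₀ ∈ B ∧ TileConnected B ∧ ClosedIn B F := by
  classical
  let B := F.filter fun k => ∀ A ⊆ F, ClosedIn A F → k₀ ∈ A → k ∈ A
  have hmin : ∀ A ⊆ F, ClosedIn A F → k₀ ∈ A → B ⊆ A := fun A h1 h2 h3 k hk =>
    (Finset.mem_filter.1 hk).2 A h1 h2 h3
  have hBF : B ⊆ F := Finset.filter_subset _ _
  have hcl : ClosedIn B F := by
    intro s h1 h2
    simp only [B, Finset.mem_filter, h1, h2, true_and]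
    exact forall₄_congr fun A _ h _ => h s h1 h2
  have hk₀ : k₀ ∈ B := Finset.mem_filter.2 ⟨hk, fun A _ _ h => h⟩
  refine ⟨B, hBF, hk₀, ⟨⟨k₀, hk₀⟩, ?_⟩, hcl⟩
  intro T' hT' ⟨k, hk⟩ hcl'
  have hclF : ClosedIn T' F := by
    intro s h1 h2
    have h3 := hcl s h1 h2
    constructor
    · intro h; exact (hcl' s (hT' h) (h3.1 (hT' h))).1 h
    · intro h; exact (hcl' s (h3.2 (hT' h)) (hT' h)).2 h
  by_cases h : k₀ ∈ T'
  · exact hT'.antisymm (hmin T' (hT'.trans hBF) hclF h)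
  · have h1 := hmin (B \ T') (Finset.sdiff_subset.trans hBF) ?_ (Finset.mem_sdiff.2 ⟨hk₀, h⟩)
    · exact absurd hk (Finset.mem_sdiff.1 (h1 (hT' hk))).2
    · intro s h1 h2
      rw [Finset.mem_sdiff, Finset.mem_sdiff, hcl s h1 h2, hclF s h1 h2]

end

/-! ### The weights obtained from the minimal configuration by flips -/

section

variable {n : ℕ} [hn : Fact (4 ≤ n)] (Q : DQuiver n)

theorem boundaryMatching_outer {x : Edge n} (hx : IsOuter Q x) (R : Finset (Fin n)) :
    boundaryMatching Q R x = if own x ∈ R ∧ outward Q x = true then 1 else 0 := by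
  have h : ∀ b, ¬ ∃ s : Square n, attach Q s = x ∧ outward Q x = b := by
    rintro b ⟨s, h, -⟩; exact hx s h
  have h' : ∀ (b : Bool) (k : Fin n), ¬ ∃ s : Square n, s.1 = k ∧ attach Q s = x ∧
      outward Q x = b := by
    rintro b k ⟨s, -, h, -⟩; exact hx s h
  unfold boundaryMatching
  simp only [mem_bwSides, mem_wbSides, h', or_false]
  refine if_congr ?_ rfl rfl
  constructor
  · rintro ⟨⟨k, h1, rfl, h2⟩, -⟩; exact ⟨h1, h2⟩
  · rintro ⟨h1, h2⟩
    exact ⟨⟨_, h1, rfl, h2⟩, by rintro ⟨k, -, -, h3⟩; simp [h2] at h3⟩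

theorem attach_mem_bwSides (s : Square n) (k : Fin n) : attach Q s ∈ bwSides Q k ↔
    k = if Q.arrow (parent s) s.1 then parent s else s.1 := by
  rw [mem_bwSides, own_attach, outward_attach]
  constructor
  · rintro (⟨rfl, h⟩ | ⟨s', rfl, h1, h2⟩)
    · simp [h]
    · simp [h2, attach_injective Q h1]
  · intro h
    split_ifs at h with h1
    · exact Or.inl ⟨h.symm, h1⟩
    · exact Or.inr ⟨s, h.symm, rfl, by simpa using h1⟩

theorem attach_mem_wbSides (s : Square n) (k : Fin n) : attach Q s ∈ wbSides Q k ↔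
    k = if Q.arrow (parent s) s.1 then s.1 else parent s := by
  rw [mem_wbSides, own_attach, outward_attach]
  constructor
  · rintro (⟨rfl, h⟩ | ⟨s', rfl, h1, h2⟩)
    · simp [h]
    · simp [h2, attach_injective Q h1]
  · intro h
    split_ifs at h with h1
    · exact Or.inr ⟨s, h.symm, rfl, h1⟩
    · exact Or.inl ⟨h.symm, by simpa using h1⟩

theorem boundaryMatching_attach (s : Square n) (R : Finset (Fin n)) :
    boundaryMatching Q R (attach Q s) =
      if Q.arrow (parent s) s.1 then (if parent s ∈ R ∧ s.1 ∉ R then 1 else 0)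
      else (if s.1 ∈ R ∧ parent s ∉ R then 1 else 0) := by
  unfold boundaryMatching
  simp only [attach_mem_bwSides, attach_mem_wbSides]
  split_ifs <;> simp_all

/-- The change of the weight of `x` under a flip of the tile `k`. -/
def flipVec (k : Fin n) (x : Edge n) : ℤ :=
  (if x ∈ wbSides Q k then 1 else 0) - if x ∈ bwSides Q k then 1 else 0

/-- The weights obtained from the minimal configuration by `e k` flips of every tile `k`. -/
def wt (d e : Fin n → ℤ) (x : Edge n) : ℤ :=
  minimalMatching Q d x + ∑ k, e k * flipVec Q k x

theorem flipVec_outer {x : Edge n} (hx : IsOuter Q x) (k : Fin n) :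
    flipVec Q k x = if own x = k then (if outward Q x then -1 else 1) else 0 := by
  have h' : ∀ (b : Bool) (k : Fin n), ¬ ∃ s : Square n, s.1 = k ∧ attach Q s = x ∧
      outward Q x = b := by
    rintro b k ⟨s, -, h, -⟩; exact hx s h
  simp only [flipVec, mem_bwSides, mem_wbSides, h', or_false]
  cases outward Q x <;> split_ifs <;> simp_all

theorem flipVec_attach (s : Square n) (k : Fin n) :
    flipVec Q k (attach Q s) = if Q.arrow (parent s) s.1 then
      (if s.1 = k then 1 else 0) - (if parent s = k then 1 else 0)
      else (if parent s = k then 1 else 0) - (if s.1 = k then 1 else 0) := by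
  simp only [flipVec, attach_mem_bwSides, attach_mem_wbSides]
  cases Q.arrow (parent s) s.1 <;> simp [eq_comm]

variable {Q} {d : Fin n → ℤ}

theorem minimalMatching_outer (hd : ∀ k, 0 ≤ d k ∧ d k ≤ 2) {x : Edge n} (hx : IsOuter Q x) :
    (minimalMatching Q d x : ℤ) = if outward Q x then d (own x) else 0 := by
  have := hd (own x)
  simp only [minimalMatching, boundaryMatching_outer Q hx, Finset.mem_filter, Finset.mem_univ,
    true_and]
  cases outward Q x
  · simp
  · simp only [and_true, if_true]
    split_ifs <;> push_cast <;> omega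

theorem minimalMatching_attach (hd : ∀ k, 0 ≤ d k ∧ d k ≤ 2) (s : Square n) :
    (minimalMatching Q d (attach Q s) : ℤ) = if Q.arrow (parent s) s.1 then
      max (d (parent s) - d s.1) 0 else max (d s.1 - d (parent s)) 0 := by
  have h1 := hd s.1
  have h2 := hd (parent s)
  simp only [minimalMatching, boundaryMatching_attach, Finset.mem_filter, Finset.mem_univ,
    true_and]
  cases Q.arrow (parent s) s.1
  · simp only [Bool.false_eq_true, if_false]
    split_ifs <;> push_cast <;> omega
  · simp only [if_true]
    split_ifs <;> push_cast <;> omega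

/-- On boundary edges the weights are `d - e` or `e`, so that they determine `e`. -/
theorem wt_outer (hd : ∀ k, 0 ≤ d k ∧ d k ≤ 2) (e : Fin n → ℤ) {x : Edge n} (hx : IsOuter Q x) :
    wt Q d e x = if outward Q x then d (own x) - e (own x) else e (own x) := by
  simp only [wt, minimalMatching_outer hd hx, flipVec_outer Q hx]
  simp only [mul_ite, mul_zero, Finset.sum_ite_eq, Finset.mem_univ, if_true]
  split_ifs <;> ring

theorem wt_attach (hd : ∀ k, 0 ≤ d k ∧ d k ≤ 2) (e : Fin n → ℤ) (s : Square n) :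
    wt Q d e (attach Q s) = if Q.arrow (parent s) s.1 then
      max (d (parent s) - d s.1) 0 - e (parent s) + e s.1
      else max (d s.1 - d (parent s)) 0 - e s.1 + e (parent s) := by
  simp only [wt, minimalMatching_attach hd, flipVec_attach]
  split_ifs <;> simp [mul_sub, Finset.sum_sub_distrib] <;> ring

theorem weightedFlip_eq (k : Fin n) (w : Edge n → ℤ) :
    weightedFlip Q k w = fun x => w x + flipVec Q k x := by
  funext x; simp only [weightedFlip, flipVec]; ring

theorem weightedFlip_iterate (k : Fin n) (m : ℕ) (w : Edge n → ℤ) :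
    (weightedFlip Q k)^[m] w = fun x => w x + m * flipVec Q k x := by
  induction m with
  | zero => simp
  | succ m ih =>
    rw [Function.iterate_succ_apply', ih, weightedFlip_eq]
    funext x; push_cast; ring

theorem weightedFlips_eq_wt {e : Fin n → ℤ} (he : ∀ k, 0 ≤ e k) :
    weightedFlips Q e (fun x => (minimalMatching Q d x : ℤ)) = wt Q d e := by
  have h : ∀ (l : List (Fin n)) (w : Edge n → ℤ),
      l.foldl (fun w i => (weightedFlip Q i)^[(e i).toNat] w) w =
        fun x => w x + (l.map fun k => e k * flipVec Q k x).sum := by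
    intro l
    induction l with
    | nil => intro w; simp
    | cons k l ih =>
      intro w
      rw [List.foldl_cons, ih, weightedFlip_iterate]
      funext x
      rw [List.map_cons, List.sum_cons, Int.toNat_of_nonneg (he k)]
      ring
  unfold weightedFlips
  rw [h]
  funext x
  rw [wt, Fin.sum_univ_def]

variable (Q d)

/-- The first two of Tran's conditions. -/
def Acceptable (e : Fin n → ℤ) : Prop :=
  (∀ i, 0 ≤ e i ∧ e i ≤ d i) ∧ ∀ i j, Q.arrow i j = true → e i - e j ≤ max (d i - d j) 0

variable {Q d}

/-- On the edge between the ends of an arrow, the weight is non-negative exactly if the arrow is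
acceptable. -/
theorem Acceptable.wt_nonneg (hd : ∀ k, 0 ≤ d k ∧ d k ≤ 2) {e : Fin n → ℤ}
    (he : Acceptable Q d e) (x : Edge n) : 0 ≤ wt Q d e x := by
  rcases isOuter_or_attach Q x with hx | ⟨s, rfl⟩
  · rw [wt_outer hd e hx]
    have := he.1 (own x)
    split_ifs <;> omega
  · rw [wt_attach hd]
    have := arrow_parent Q s
    split_ifs with h
    · have := he.2 _ _ h; omega
    · have := he.2 s.1 (parent s) (by simpa [h] using this); omega

/-- Conversely, non-negative weights come from acceptable vectors.  The bound `e ≤ d` follows by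
induction from the leaves, as tiles without boundary edges that run from black to white share such
an edge with a child. -/
theorem acceptable_of_nonneg (hd : ∀ k, 0 ≤ d k ∧ d k ≤ 2)
    (hchild : ∀ s : Square n, 1 ≤ d (parent s) → d s.1 ≤ d (parent s)) {e : Fin n → ℤ}
    (he : ∀ k, 0 ≤ e k) (he0 : ∀ k, d k = 0 → e k = 0) (h : ∀ x, 0 ≤ wt Q d e x) :
    Acceptable Q d e := by
  have hatt : ∀ i j, Q.arrow i j = true → e i - e j ≤ max (d i - d j) 0 := by
    intro i j hij
    have hadj := (Q.adj_iff i j).2 (Or.inl hij)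
    obtain ⟨s, ⟨rfl, rfl⟩ | ⟨rfl, rfl⟩⟩ := adj_iff_parent.1 hadj
    · have h1 := h (attach Q s)
      rw [wt_attach hd, if_neg (by simp [Q.asymm _ _ hij])] at h1
      omega
    · have h1 := h (attach Q s)
      rw [wt_attach hd, if_pos hij] at h1
      omega
  refine ⟨fun i => ⟨he i, ?_⟩, hatt⟩
  induction i using leaf_induction with
  | h k ih =>
    by_cases hk : d k = 0
    · rw [he0 k hk, hk]
    obtain ⟨x, hx, ho⟩ := exists_own_eq Q k true
    rcases isOuter_or_attach Q x with h1 | ⟨s, rfl⟩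
    · have := h x
      rw [wt_outer hd e h1, if_pos ho, hx] at this
      omega
    · rw [own_attach] at hx
      rw [outward_attach] at ho
      have h1 := ih s hx
      have h2 := hatt _ _ ho
      have h3 := hchild s
      have := hd k
      rw [hx] at h2 h3
      omega

variable (Q d)

/-- The configuration with the weights `wt Q d e`; these are non-negative if `e` is acceptable, and
otherwise negative weights are replaced by 0. -/
def config (e : Fin n → ℤ) (x : Edge n) : ℕ := (wt Q d e x).toNat

variable {Q d}

theorem Acceptable.coe_config (hd : ∀ k, 0 ≤ d k ∧ d k ≤ 2) {e : Fin n → ℤ}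
    (he : Acceptable Q d e) (x : Edge n) : (config Q d e x : ℤ) = wt Q d e x :=
  Int.toNat_of_nonneg (he.wt_nonneg hd x)

theorem wt_add_single (e : Fin n → ℤ) (k : Fin n) (x : Edge n) :
    wt Q d (e + Pi.single k 1) x = wt Q d e x + flipVec Q k x := by
  simp only [wt, Pi.add_apply, add_mul, Finset.sum_add_distrib, Pi.single_apply, ite_mul, one_mul,
    zero_mul, Finset.sum_ite_eq', Finset.mem_univ, if_true]
  ring

theorem wt_zero (x : Edge n) : wt Q d 0 x = minimalMatching Q d x := by simp [wt]

theorem exists_of_reachable {D : Edge n → ℕ}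
    (h : Relation.ReflTransGen (AllowableFlip Q d) (minimalMatching Q d) D) :
    ∃ e : Fin n → ℤ, (∀ k, 0 ≤ e k) ∧ (∀ k, d k = 0 → e k = 0) ∧ ∀ x, (D x : ℤ) = wt Q d e x := by
  induction h with
  | refl => exact ⟨0, fun _ => le_rfl, fun _ _ => rfl, fun x => (wt_zero x).symm⟩
  | tail _ h ih =>
    obtain ⟨e, he, he0, hD⟩ := ih
    obtain ⟨k, hk, -, h⟩ := h
    refine ⟨e + Pi.single k 1, ?_, ?_, ?_⟩
    · intro i
      have := he i
      simp only [Pi.add_apply, Pi.single_apply]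
      split_ifs <;> omega
    · intro i hi
      have hik : i ≠ k := by rintro rfl; omega
      simp [hik, he0 i hi]
    · intro x
      simp only [congrFun h x, weightedFlip_eq, wt_add_single, hD]

variable (Q) in
/-- An orientation of a tree is acyclic. -/
theorem exists_potential : ∃ φ : Fin n → ℤ, ∀ i j, Q.arrow i j = true → φ i < φ j := by
  let σ : Square n → ℤ := fun s => if Q.arrow (parent s) s.1 then 1 else -1
  let φ : Fin n → ℤ := fun k => ∑ s : Square n, if Below s k then σ s else 0
  have hφ : ∀ s : Square n, φ s.1 = φ (parent s) + σ s := by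
    intro s
    have : ∀ s' : Square n, (if Below s' s.1 then σ s' else 0) =
        (if Below s' (parent s) then σ s' else 0) + if s = s' then σ s' else 0 := by
      intro s'
      by_cases h : s = s'
      · subst h; simp [below_iff, not_below_parent]
      · simp [below_iff, h]
    simp only [φ, this, Finset.sum_add_distrib]
    simp
  refine ⟨φ, fun i j hij => ?_⟩
  obtain ⟨s, ⟨rfl, rfl⟩ | ⟨rfl, rfl⟩⟩ := adj_iff_parent.1 ((Q.adj_iff i j).2 (Or.inl hij))
  · simp [hφ, σ, Q.asymm _ _ hij]
  · simp [hφ, σ, hij]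

/-- Every acceptable vector is reached by allowable flips: the last one is at a tile that is
minimal among those with `e k > 0` for the acyclic orientation. -/
theorem Acceptable.reachable (hd : ∀ k, 0 ≤ d k ∧ d k ≤ 2) {e : Fin n → ℤ}
    (he : Acceptable Q d e) :
    Relation.ReflTransGen (AllowableFlip Q d) (minimalMatching Q d) (config Q d e) := by
  obtain ⟨φ, hφ⟩ := exists_potential Q
  have key : ∀ m : ℕ, ∀ e, Acceptable Q d e → ∑ k, e k = m →
      Relation.ReflTransGen (AllowableFlip Q d) (minimalMatching Q d) (config Q d e) := by
    intro m
    induction m with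
    | zero =>
      intro e he hm
      have h0 : e = 0 := by
        funext k
        exact (Finset.sum_eq_zero_iff_of_nonneg fun k _ => (he.1 k).1).1 hm k (Finset.mem_univ k)
      have : config Q d e = minimalMatching Q d := by
        funext x; simp [config, h0, wt_zero]
      rw [this]
    | succ m ih =>
      intro e he hm
      have hne : (Finset.univ.filter fun k => 0 < e k).Nonempty := by
        by_contra h
        rw [Finset.not_nonempty_iff_eq_empty, Finset.filter_eq_empty_iff] at h
        have : ∑ k, e k ≤ 0 := Finset.sum_nonpos fun k _ => not_lt.1 (h (Finset.mem_univ k))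
        omega
      obtain ⟨k, hk, hmin⟩ := Finset.exists_min_image _ φ hne
      rw [Finset.mem_filter] at hk
      have hstrict : ∀ j, Q.arrow j k = true → e j - e k < max (d j - d k) 0 := by
        intro j hj
        by_contra hc
        have := hφ j k hj
        have := hmin j (Finset.mem_filter.2 ⟨Finset.mem_univ _, by omega⟩)
        omega
      set e' : Fin n → ℤ := e - Pi.single k 1 with he'
      have hee : e = e' + Pi.single k 1 := by simp [he']
      have hval : ∀ i, e' i = e i - if i = k then 1 else 0 := by
        intro i; simp [he', Pi.single_apply]
      have hacc : Acceptable Q d e' := by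
        constructor
        · intro i
          have := he.1 i
          rw [hval]
          split_ifs with h
          · subst h; omega
          · omega
        · intro i j hij
          have h1 := he.2 i j hij
          rw [hval, hval]
          split_ifs with h2 h3 h3
          · omega
          · omega
          · subst h3; have := hstrict i hij; omega
          · omega
      refine (ih e' hacc ?_).tail ⟨k, by have := he.1 k; omega, ?_, ?_⟩
      · have : ∑ i, e i = ∑ i, e' i + 1 := by
          conv_lhs => rw [hee]
          simp [Finset.sum_add_distrib]
        push_cast at hm
        omega
      · intro x hx
        have h1 := he.wt_nonneg hd x
        rw [hee, wt_add_single, flipVec, if_pos hx,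
          if_neg (disjoint_bwSides_wbSides Q k hx)] at h1
        have h2 := hacc.coe_config hd x
        omega
      · funext x
        simp only [weightedFlip_eq, he.coe_config hd, hacc.coe_config hd]
        conv_lhs => rw [hee]
        rw [wt_add_single]
  obtain ⟨m, hm⟩ := Int.eq_ofNat_of_zero_le (Finset.sum_nonneg fun k _ => (he.1 k).1)
  exact key m e he hm

end

/-! ### The peeling procedure -/

section

variable {n : ℕ} [hn : Fact (4 ≤ n)] {Q : DQuiver n} {d e : Fin n → ℤ}

theorem Acceptable.attach_le (he : Acceptable Q d e) (s : Square n) :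
    (Q.arrow (parent s) s.1 = true → e (parent s) - e s.1 ≤ max (d (parent s) - d s.1) 0) ∧
    (Q.arrow (parent s) s.1 = false → e s.1 - e (parent s) ≤ max (d s.1 - d (parent s)) 0) := by
  refine ⟨he.2 _ _, fun h => he.2 _ _ ?_⟩
  have := arrow_parent Q s
  simpa [h] using this

/-- The states of the peeling procedure: `v` is a vector with `0 ≤ v ≤ e` such that two adjacent
tiles are filled equally until one of them is full, and `N` is what is left over of the
superimposition of `config Q d e` and the minimal configuration after the removal of the boundaries
of the sets `{v ≥ t}`, `t ≥ 1`. -/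
structure PeelState (Q : DQuiver n) (d e : Fin n → ℤ) (N : Edge n → ℕ) (v : Fin n → ℤ) : Prop where
  nonneg : ∀ k, 0 ≤ v k
  le : ∀ k, v k ≤ e k
  fill : ∀ s : Square n, min (v s.1) (e (parent s)) ≤ v (parent s) ∧
    min (v (parent s)) (e s.1) ≤ v s.1
  eq_outer : ∀ x, IsOuter Q x →
    (N x : ℤ) = if outward Q x then 2 * d (own x) - e (own x) - v (own x) else e (own x) - v (own x)
  eq_attach : ∀ s : Square n, (N (attach Q s) : ℤ) =
    (if Q.arrow (parent s) s.1 then 2 * max (d (parent s) - d s.1) 0 - e (parent s) + e s.1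
      else 2 * max (d s.1 - d (parent s)) 0 - e s.1 + e (parent s)) - |v (parent s) - v s.1|

theorem PeelState.initial (hd : ∀ k, 0 ≤ d k ∧ d k ≤ 2) (he : Acceptable Q d e) :
    PeelState Q d e (fun x => config Q d e x + minimalMatching Q d x) 0 where
  nonneg _ := le_rfl
  le k := (he.1 k).1
  fill s := by simp
  eq_outer x hx := by
    push_cast
    rw [he.coe_config hd, wt_outer hd e hx, minimalMatching_outer hd hx]
    split_ifs <;> simp
    ring
  eq_attach s := by
    push_cast
    rw [he.coe_config hd, wt_attach hd, minimalMatching_attach hd]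
    split_ifs <;> simp <;> ring

variable {N : Edge n → ℕ} {v : Fin n → ℤ}

/-- The cycles in a state of the peeling procedure enclose only tiles with `v k < e k`.  A tile with
`v k = e k` would have an own edge from white to black that is shared with a child and does not
belong to the cycle; then the child is enclosed as well and has `v = e`, contrary to the induction
hypothesis. -/
theorem PeelState.lt_of_mem (hchild : ∀ s : Square n, 1 ≤ d (parent s) → d s.1 ≤ d (parent s))
    (he : Acceptable Q d e) (h : PeelState Q d e N v) {T : Finset (Fin n)}
    (hT : ∀ x ∈ bd Q T, 0 < N x) {k : Fin n} (hk : k ∈ T) : v k < e k := by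
  induction k using leaf_induction with
  | h k ih =>
    by_contra hc
    have hk0 := h.le k
    have hdk : 1 ≤ d k := by
      obtain ⟨x, rfl, hx⟩ := exists_isOuter Q k
      have h1 := hT x ((mem_bd_outer Q hx).2 hk)
      have h2 := h.eq_outer x hx
      have h3 := he.1 (own x)
      split_ifs at h2 <;> omega
    obtain ⟨x, rfl, hxo⟩ := exists_own_eq Q k false
    rcases isOuter_or_attach Q x with hx | ⟨s, rfl⟩
    · have h1 := hT x ((mem_bd_outer Q hx).2 hk)
      have h2 := h.eq_outer x hx
      simp only [hxo, Bool.false_eq_true, if_false] at h2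
      omega
    · rw [outward_attach] at hxo
      rw [own_attach] at hk hk0 hdk hc
      have h1 := hchild s hdk
      have h2 := (he.attach_le s).2 hxo
      have h3 := h.eq_attach s
      have h4 := h.le s.1
      simp only [hxo, Bool.false_eq_true, if_false] at h3
      rw [abs_of_nonneg (by omega)] at h3
      have h5 : s.1 ∈ T := by
        by_contra h5
        have := hT _ ((mem_bd_attach Q).2 fun h => h5 (h.1 hk))
        omega
      have := ih s (own_attach Q s).symm h5
      omega

/-- The vector obtained by adding 1 on the tiles in `B`. -/
def raise (v : Fin n → ℤ) (B : Finset (Fin n)) (k : Fin n) : ℤ := v k + if k ∈ B then 1 else 0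

/-- The effect of filling a connected component of `{v < e}` on the edge of a square and its parent.
-/
theorem PeelState.attach_of_component (he : Acceptable Q d e) (h : PeelState Q d e N v)
    {B : Finset (Fin n)} (hB : ∀ k ∈ B, v k < e k)
    (hcl : ClosedIn B (Finset.univ.filter fun k => v k < e k)) (s : Square n) :
    (attach Q s ∈ bd Q B → 0 < N (attach Q s)) ∧
      |raise v B (parent s) - raise v B s.1| =
        |v (parent s) - v s.1| + if attach Q s ∈ bd Q B then 1 else 0 := by
  have h1 := h.eq_attach s
  have h2 := h.fill s
  have h3 := h.le s.1
  have h4 := h.le (parent s)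
  have h5 := hcl s
  have h6 := he.attach_le s
  simp only [Finset.mem_filter, Finset.mem_univ, true_and] at h5
  have h7 := hB s.1
  have h8 := hB (parent s)
  simp only [mem_bd_attach, raise]
  by_cases hs : s.1 ∈ B <;> by_cases hp : parent s ∈ B
  · simp [hs, hp]
  · have hpe : v (parent s) = e (parent s) := by
      by_contra hne
      exact hp ((h5 (h7 hs) (by omega)).1 hs)
    have h9 := h7 hs
    have h10 : v (parent s) ≤ v s.1 := by omega
    rw [abs_of_nonpos (by omega)] at h1
    simp only [hs, hp, if_true, if_false, not_false_eq_true, iff_true, forall_const]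
    rw [abs_of_nonpos (by omega), abs_of_nonpos (by omega)]
    refine ⟨?_, by ring⟩
    cases ha : Q.arrow (parent s) s.1
    · simp only [ha, Bool.false_eq_true, if_false] at h1
      have := h6.2 ha; omega
    · simp only [ha, if_true] at h1
      have := h6.1 ha; omega
  · have hpe : v s.1 = e s.1 := by
      by_contra hne
      exact hs ((h5 (by omega) (h8 hp)).2 hp)
    have h9 := h8 hp
    have h10 : v s.1 ≤ v (parent s) := by omega
    rw [abs_of_nonneg (by omega)] at h1
    simp only [hs, hp, if_true, if_false, true_iff, not_false_eq_true, forall_const]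
    rw [abs_of_nonneg (by omega), abs_of_nonneg (by omega)]
    refine ⟨?_, by ring⟩
    cases ha : Q.arrow (parent s) s.1
    · simp only [ha, Bool.false_eq_true, if_false] at h1
      have := h6.2 ha; omega
    · simp only [ha, if_true] at h1
      have := h6.1 ha; omega
  · simp [hs, hp]

/-- The boundary of a connected component of `{v < e}` can be peeled off. -/
theorem PeelState.pos_of_component (he : Acceptable Q d e) (h : PeelState Q d e N v)
    {B : Finset (Fin n)} (hB : ∀ k ∈ B, v k < e k)
    (hcl : ClosedIn B (Finset.univ.filter fun k => v k < e k)) : ∀ x ∈ bd Q B, 0 < N x := by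
  intro x hx
  rcases isOuter_or_attach Q x with ho | ⟨s, rfl⟩
  · have h1 := hB _ ((mem_bd_outer Q ho).1 hx)
    have h2 := h.eq_outer x ho
    have h3 := he.1 (own x)
    split_ifs at h2 <;> omega
  · exact (h.attach_of_component he hB hcl s).1 hx

theorem PeelState.next (he : Acceptable Q d e) (h : PeelState Q d e N v)
    {B : Finset (Fin n)} (hB : ∀ k ∈ B, v k < e k)
    (hcl : ClosedIn B (Finset.univ.filter fun k => v k < e k)) {N' : Edge n → ℕ}
    (hN : ∀ x, N x = N' x + if x ∈ bd Q B then 1 else 0) :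
    PeelState Q d e N' (raise v B) where
  nonneg k := by
    have := h.nonneg k
    unfold raise; split_ifs <;> omega
  le k := by
    have := h.le k
    have := hB k
    unfold raise; split_ifs with h1
    · have := this h1; omega
    · omega
  fill s := by
    have h2 := h.fill s
    have h3 := h.le s.1
    have h4 := h.le (parent s)
    have h5 := hcl s
    simp only [Finset.mem_filter, Finset.mem_univ, true_and] at h5
    have h7 := hB s.1
    have h8 := hB (parent s)
    unfold raise
    by_cases hs : s.1 ∈ B <;> by_cases hp : parent s ∈ B <;>
      simp only [hs, hp, true_implies, if_true, if_false] at *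
    · omega
    · have : ¬ v (parent s) < e (parent s) := fun h => by simpa using h5 h7 h
      omega
    · have : ¬ v s.1 < e s.1 := fun h => by simpa using h5 h h8
      omega
    · omega
  eq_outer x hx := by
    have h1 := h.eq_outer x hx
    have h2 := hN x
    simp only [mem_bd_outer Q hx] at h2
    unfold raise
    split_ifs at h1 h2 ⊢ <;> omega
  eq_attach s := by
    have h1 := h.eq_attach s
    have h2 := hN (attach Q s)
    rw [(h.attach_of_component he hB hcl s).2]
    split_ifs at h1 h2 ⊢ <;> omega

/-- A peeling step adds 1 on a connected component of the set of tiles with `v k < e k`: all cycles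
enclose connected subsets of such components, and shrinking the set shortens the cycle. -/
theorem PeelState.step (hchild : ∀ s : Square n, 1 ≤ d (parent s) → d s.1 ≤ d (parent s))
    (he : Acceptable Q d e) (h : PeelState Q d e N v) {C : Finset (Edge n)}
    (hC : C ∈ cyclesIn Q N) (hmax : ∀ C' ∈ cyclesIn Q N, C'.card ≤ C.card) :
    ∃ B : Finset (Fin n), C = bd Q B ∧ B.Nonempty ∧ (∀ k ∈ B, v k < e k) ∧
      ClosedIn B (Finset.univ.filter fun k => v k < e k) := by
  obtain ⟨hC, hpos⟩ := hC
  obtain ⟨T, hT, rfl⟩ := isCycle_iff.1 hC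
  have hTF : T ⊆ Finset.univ.filter fun k => v k < e k := fun k hk =>
    Finset.mem_filter.2 ⟨Finset.mem_univ _, h.lt_of_mem hchild he hpos hk⟩
  obtain ⟨k, hk⟩ := hT.1
  obtain ⟨B, hBF, hkB, hB, hcl⟩ := exists_component _ (hTF hk)
  have hTB := hT.subset_of_mem hTF hcl hk hkB
  have hBlt : ∀ k ∈ B, v k < e k := fun k hk => (Finset.mem_filter.1 (hBF hk)).2
  have h1 := hmax (bd Q B) ⟨isCycle_iff.2 ⟨B, hB, rfl⟩, h.pos_of_component he hBlt hcl⟩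
  rw [hT.eq_of_card_bd_le Q hB hTB h1]
  exact ⟨B, rfl, hB.1, hBlt, hcl⟩

theorem PeelState.peelStep (hchild : ∀ s : Square n, 1 ≤ d (parent s) → d s.1 ≤ d (parent s))
    (he : Acceptable Q d e) (h : PeelState Q d e N v) {s : (Edge n → ℕ) × (Fin n → ℤ)}
    (hs : PeelStep Q (N, v) s) : PeelState Q d e s.1 s.2 ∧ ∑ k, v k < ∑ k, s.2 k := by
  obtain ⟨C, T, hC, hmax, henc, h1, h2⟩ := hs
  obtain ⟨B, rfl, hne, hlt, hcl⟩ := h.step hchild he hC hmax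
  rw [encloses_iff] at henc
  obtain rfl := bd_injective Q henc
  have h3 : s.2 = raise v B := funext h2
  rw [h3]
  refine ⟨h.next he hlt hcl h1, ?_⟩
  obtain ⟨k, hk⟩ := hne
  refine Finset.sum_lt_sum (fun k _ => ?_) ⟨k, Finset.mem_univ k, ?_⟩
  · unfold raise; split_ifs <;> omega
  · simp [raise, hk]

/-- As long as `v ≠ e`, the procedure continues. -/
theorem PeelState.exists_peelStep
    (hchild : ∀ s : Square n, 1 ≤ d (parent s) → d s.1 ≤ d (parent s))
    (he : Acceptable Q d e) (h : PeelState Q d e N v) {k : Fin n} (hk : v k < e k) :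
    ∃ s, PeelStep Q (N, v) s := by
  obtain ⟨B, hBF, -, hB, hcl⟩ := exists_component (Finset.univ.filter fun k => v k < e k)
    (Finset.mem_filter.2 ⟨Finset.mem_univ k, hk⟩)
  have hBlt : ∀ k ∈ B, v k < e k := fun k hk => (Finset.mem_filter.1 (hBF hk)).2
  obtain ⟨C, hC, hmax⟩ := Set.exists_max_image (cyclesIn Q N) Finset.card (Set.toFinite _)
    ⟨bd Q B, isCycle_iff.2 ⟨B, hB, rfl⟩, h.pos_of_component he hBlt hcl⟩
  obtain ⟨T, rfl, -, -, -⟩ := h.step hchild he hC hmax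
  refine ⟨(fun x => N x - if x ∈ bd Q T then 1 else 0, raise v T), bd Q T, T, hC, hmax,
    (encloses_iff Q).2 rfl, fun x => ?_, fun k => rfl⟩
  have := hC.2 x
  dsimp only
  split_ifs with hx
  · have := this hx; omega
  · omega

theorem PeelState.exists_outcome
    (hchild : ∀ s : Square n, 1 ≤ d (parent s) → d s.1 ≤ d (parent s))
    (he : Acceptable Q d e) (h : PeelState Q d e N v) :
    ∃ s, Relation.ReflTransGen (PeelStep Q) (N, v) s ∧ ¬ ∃ s', PeelStep Q s s' := by
  have key : ∀ m : ℕ, ∀ N v, PeelState Q d e N v → ∑ k, e k - ∑ k, v k ≤ m →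
      ∃ s, Relation.ReflTransGen (PeelStep Q) (N, v) s ∧ ¬ ∃ s', PeelStep Q s s' := by
    intro m
    induction m with
    | zero =>
      intro N v h hm
      refine ⟨_, .refl, ?_⟩
      rintro ⟨s, hs⟩
      obtain ⟨h1, h2⟩ := h.peelStep hchild he hs
      have := Finset.sum_le_sum fun k (_ : k ∈ Finset.univ) => h1.le k
      omega
    | succ m ih =>
      intro N v h hm
      by_cases hs : ∃ s, PeelStep Q (N, v) s
      · obtain ⟨s, hs⟩ := hs
        obtain ⟨h1, h2⟩ := h.peelStep hchild he hs
        obtain ⟨s', h3, h4⟩ := ih _ _ h1 (by push_cast at hm; omega)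
        exact ⟨s', h3.head hs, h4⟩
      · exact ⟨_, .refl, hs⟩
  exact key (∑ k, e k - ∑ k, v k).toNat N v h (Int.self_le_toNat _)

/-- When no cycle is left, `v = e`, and what is left over is even. -/
theorem PeelState.final (hchild : ∀ s : Square n, 1 ≤ d (parent s) → d s.1 ≤ d (parent s))
    (he : Acceptable Q d e) (h : PeelState Q d e N v) (hs : ¬ ∃ s, PeelStep Q (N, v) s) :
    v = e ∧ cyclesIn Q N = ∅ ∧ ∀ x, Even (N x) := by
  have hve : v = e := by
    funext k
    by_contra hk
    exact hs (h.exists_peelStep hchild he (lt_of_le_of_ne (h.le k) hk))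
  subst hve
  refine ⟨rfl, ?_, ?_⟩
  · rw [Set.eq_empty_iff_forall_notMem]
    rintro C ⟨hC, hpos⟩
    obtain ⟨T, hT, rfl⟩ := isCycle_iff.1 hC
    obtain ⟨k, hk⟩ := hT.1
    exact lt_irrefl _ (h.lt_of_mem hchild he hpos hk)
  · intro x
    rw [← Int.even_coe_nat, even_iff_two_dvd]
    rcases isOuter_or_attach Q x with hx | ⟨s, rfl⟩
    · rw [h.eq_outer x hx]
      split_ifs <;> omega
    · rw [h.eq_attach s]
      rcases abs_cases (v (parent s) - v s.1) with ⟨h1, -⟩ | ⟨h1, -⟩ <;> rw [h1] <;>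
        split_ifs <;> omega

/-- The peeling procedure recovers `e` from `config Q d e`. -/
theorem peelOutcome (hd : ∀ k, 0 ≤ d k ∧ d k ≤ 2)
    (hchild : ∀ s : Square n, 1 ≤ d (parent s) → d s.1 ≤ d (parent s)) (he : Acceptable Q d e) :
    (∃ N v, PeelOutcome Q d (config Q d e) N v) ∧
      ∀ N v, PeelOutcome Q d (config Q d e) N v →
        v = e ∧ cyclesIn Q N = ∅ ∧ ∀ x, Even (N x) := by
  have h0 := PeelState.initial hd he
  refine ⟨?_, ?_⟩
  · obtain ⟨⟨N, v⟩, h1, h2⟩ := h0.exists_outcome hchild he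
    exact ⟨N, v, h1, h2⟩
  · rintro N v ⟨h1, h2⟩
    have h3 : ∀ s, Relation.ReflTransGen (PeelStep Q)
        (fun x => config Q d e x + minimalMatching Q d x, 0) s → PeelState Q d e s.1 s.2 := by
      intro s hs
      induction hs with
      | refl => exact h0
      | tail _ hstep ih => exact (ih.peelStep hchild he hstep).1
    exact (h3 _ h1).final hchild he h2

/-! ### The cycles of a configuration -/

/-- The cycles in a configuration enclose only tiles with `(d k, e k) = (2, 1)`: by induction from
the leaves, the own edges of an enclosed tile in the two directions force `e k < d k` and `0 < e k`.
-/
theorem Acceptable.eq_of_mem (hd : ∀ k, 0 ≤ d k ∧ d k ≤ 2)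
    (hchild : ∀ s : Square n, 1 ≤ d (parent s) → d s.1 ≤ d (parent s)) (he : Acceptable Q d e)
    {T : Finset (Fin n)} (hT : ∀ x ∈ bd Q T, 0 < config Q d e x) {k : Fin n} (hk : k ∈ T) :
    d k = 2 ∧ e k = 1 := by
  have hT' : ∀ x ∈ bd Q T, 0 < wt Q d e x := by
    intro x hx
    have := hT x hx
    have := he.coe_config hd x
    omega
  have hlt : ∀ k, k ∈ T → e k < d k := by
    intro k
    induction k using leaf_induction with
    | h k ih =>
      intro hk
      by_contra hc
      have hdk : 1 ≤ d k := by
        obtain ⟨x, rfl, hx⟩ := exists_isOuter Q k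
        have h1 := hT' x ((mem_bd_outer Q hx).2 hk)
        rw [wt_outer hd e hx] at h1
        have h3 := he.1 (own x)
        split_ifs at h1 <;> omega
      obtain ⟨x, rfl, hxo⟩ := exists_own_eq Q k true
      rcases isOuter_or_attach Q x with hx | ⟨s, rfl⟩
      · have h1 := hT' x ((mem_bd_outer Q hx).2 hk)
        rw [wt_outer hd e hx, if_pos hxo] at h1
        omega
      · rw [outward_attach] at hxo
        rw [own_attach] at hk hdk hc
        have h1 := hchild s hdk
        have h2 := (he.attach_le s).1 hxo
        have h3 := wt_attach (Q := Q) hd e s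
        rw [if_pos hxo] at h3
        have h4 := he.1 s.1
        have h5 : s.1 ∈ T := by
          by_contra h5
          have := hT' _ ((mem_bd_attach Q).2 fun h => h5 (h.1 hk))
          omega
        have := ih s (own_attach Q s).symm h5
        omega
  have hpos : ∀ k, k ∈ T → 0 < e k := by
    intro k
    induction k using leaf_induction with
    | h k ih =>
      intro hk
      by_contra hc
      have hdk := hlt k hk
      obtain ⟨x, rfl, hxo⟩ := exists_own_eq Q k false
      rcases isOuter_or_attach Q x with hx | ⟨s, rfl⟩
      · have h1 := hT' x ((mem_bd_outer Q hx).2 hk)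
        rw [wt_outer hd e hx, if_neg (by simp [hxo])] at h1
        omega
      · rw [outward_attach] at hxo
        rw [own_attach] at hk hdk hc
        have h0 := he.1 (parent s)
        have h1 := hchild s (by omega)
        have h2 := (he.attach_le s).2 hxo
        have h3 := wt_attach (Q := Q) hd e s
        rw [if_neg (by simp [hxo])] at h3
        have h4 := he.1 s.1
        have h5 : s.1 ∈ T := by
          by_contra h5
          have := hT' _ ((mem_bd_attach Q).2 fun h => h5 (h.1 hk))
          omega
        have := ih s (own_attach Q s).symm h5
        omega
  have h1 := hlt k hk
  have h2 := hpos k hk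
  have h3 := hd k
  omega

variable (d e)

open Classical in
/-- The set of tiles of a connected component of `S`. -/
noncomputable def tiles (C : (graphS d e).ConnectedComponent) : Finset (Fin n) :=
  Finset.univ.filter fun k => k ∈ Subtype.val '' C.supp

variable {d e}

theorem mem_tiles {C : (graphS d e).ConnectedComponent} {k : Fin n} :
    k ∈ tiles d e C ↔ ∃ h : d k = 2 ∧ e k = 1, (graphS d e).connectedComponentMk ⟨k, h⟩ = C := by
  simp [tiles]

theorem mem_tiles_iff_mem_image {C : (graphS d e).ConnectedComponent} {k : Fin n} :
    k ∈ tiles d e C ↔ k ∈ Subtype.val '' C.supp := by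
  simp [tiles]

theorem closedIn_tiles (C : (graphS d e).ConnectedComponent) :
    ClosedIn (tiles d e C) (Finset.univ.filter fun k => d k = 2 ∧ e k = 1) := by
  intro s h1 h2
  simp only [Finset.mem_filter, Finset.mem_univ, true_and] at h1 h2
  have : (graphS d e).connectedComponentMk ⟨s.1, h1⟩ =
      (graphS d e).connectedComponentMk ⟨parent s, h2⟩ :=
    SimpleGraph.ConnectedComponent.connectedComponentMk_eq_of_adj
      (show (dynkinD n).Adj s.1 (parent s) from adj_parent s)
  rw [mem_tiles, mem_tiles]
  exact ⟨fun ⟨_, h⟩ => ⟨h2, this.symm.trans h⟩, fun ⟨_, h⟩ => ⟨h1, this.trans h⟩⟩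

theorem tileConnected_tiles (C : (graphS d e).ConnectedComponent) :
    TileConnected (tiles d e C) := by
  constructor
  · obtain ⟨⟨k, hk⟩, h⟩ := C.nonempty_supp
    exact ⟨k, mem_tiles.2 ⟨hk, h⟩⟩
  · rintro T' hT' ⟨k, hk⟩ hcl
    refine hT'.antisymm fun l hl => ?_
    obtain ⟨hk2, hkC⟩ := mem_tiles.1 (hT' hk)
    obtain ⟨hl2, hlC⟩ := mem_tiles.1 hl
    have hr : (graphS d e).Reachable ⟨k, hk2⟩ ⟨l, hl2⟩ :=
      SimpleGraph.ConnectedComponent.exact (hkC.trans hlC.symm)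
    obtain ⟨p⟩ := hr
    have hstep : ∀ a b : {i : Fin n // d i = 2 ∧ e i = 1}, (graphS d e).Adj a b →
        a.1 ∈ T' → b.1 ∈ T' := by
      intro a b hab ha
      obtain ⟨_, haC⟩ := mem_tiles.1 (hT' ha)
      have hb : b.1 ∈ tiles d e C := mem_tiles.2 ⟨b.2,
        (SimpleGraph.ConnectedComponent.connectedComponentMk_eq_of_adj hab).symm.trans haC⟩
      have hab' : (dynkinD n).Adj a.1 b.1 := hab
      obtain ⟨s, ⟨h1, h2⟩ | ⟨h1, h2⟩⟩ := adj_iff_parent.1 hab'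
      · rw [← h2] at hb ⊢
        rw [← h1] at ha
        exact (hcl s (hT' ha) hb).1 ha
      · rw [← h1] at hb ⊢
        rw [← h2] at ha
        exact (hcl s hb (hT' ha)).2 ha
    exact SimpleGraph.Walk.forall_mem_support
      (U := {a : {i : Fin n // d i = 2 ∧ e i = 1} | a.1 ∈ T'}) p
      (fun a b hab ha => hstep a b (p.adj_of_mem_edges hab) ha) hk _ p.end_mem_support

theorem nu_eq_zero {C : (graphS d e).ConnectedComponent} : nu Q d e C = 0 ↔
    ∀ i j, IsCritical Q d e i j → i ∉ tiles d e C ∧ j ∉ tiles d e C := by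
  unfold nu
  rw [Set.ncard_eq_zero, Set.eq_empty_iff_forall_notMem]
  simp only [Set.mem_ofPred_eq, Prod.forall, mem_tiles_iff_mem_image, not_and, not_or]

/-- The boundary of a component of `S` belongs to the configuration exactly if no critical arrow
meets the component: an edge of this boundary has weight 0 exactly if its arrow is critical. -/
theorem nu_eq_zero_iff (hd : ∀ k, 0 ≤ d k ∧ d k ≤ 2) (he : Acceptable Q d e)
    {C : (graphS d e).ConnectedComponent} :
    nu Q d e C = 0 ↔ ∀ x ∈ bd Q (tiles d e C), 0 < config Q d e x := by
  have hcl := closedIn_tiles C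
  have hmem : ∀ k ∈ tiles d e C, d k = 2 ∧ e k = 1 := fun k hk => (mem_tiles.1 hk).1
  rw [nu_eq_zero]
  constructor
  · intro h x hx
    have hc := he.coe_config hd x
    suffices 0 < wt Q d e x by omega
    rcases isOuter_or_attach Q x with ho | ⟨s, rfl⟩
    · have h1 := hmem _ ((mem_bd_outer Q ho).1 hx)
      rw [wt_outer hd e ho]
      split_ifs <;> omega
    · rw [mem_bd_attach] at hx
      have h1 := hcl s
      simp only [Finset.mem_filter, Finset.mem_univ, true_and] at h1
      have h2 := hmem s.1
      have h3 := hmem (parent s)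
      have h4 := he.attach_le s
      have h5 := he.1 s.1
      have h6 := he.1 (parent s)
      have h7 := hd s.1
      have h8 := hd (parent s)
      have h9 := h s.1 (parent s)
      have h10 := h (parent s) s.1
      have h11 := arrow_parent Q s
      have h12 : ¬ ((d s.1 = 2 ∧ e s.1 = 1) ∧ d (parent s) = 2 ∧ e (parent s) = 1) :=
        fun h => hx (h1 h.1 h.2).symm
      rw [wt_attach hd]
      simp only [IsCritical] at h9 h10
      by_cases hs : s.1 ∈ tiles d e C <;> by_cases hp : parent s ∈ tiles d e C
      · exact absurd ⟨fun _ => hs, fun _ => hp⟩ hx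
      · obtain ⟨h13, h14⟩ := h2 hs
        have h15 : ¬ (d (parent s) = 2 ∧ e (parent s) = 1) := fun h => h12 ⟨⟨h13, h14⟩, h⟩
        cases ha : Q.arrow (parent s) s.1
        · rw [ha] at h11
          have h16 : ¬ ((d s.1 = 2 ∧ e s.1 = 1 ∧ d (parent s) = 1 ∧ e (parent s) = 0) ∨
              (d s.1 = 1 ∧ e s.1 = 1 ∧ d (parent s) = 2 ∧ e (parent s) = 1)) :=
            fun h' => (h9 ⟨by simpa using h11, h'⟩).1 hs
          have h17 := h4.2 ha
          simp only [Bool.false_eq_true, if_false]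
          omega
        · have h16 : ¬ ((d (parent s) = 2 ∧ e (parent s) = 1 ∧ d s.1 = 1 ∧ e s.1 = 0) ∨
              (d (parent s) = 1 ∧ e (parent s) = 1 ∧ d s.1 = 2 ∧ e s.1 = 1)) :=
            fun h' => (h10 ⟨ha, h'⟩).2 hs
          have h17 := h4.1 ha
          simp only [if_true]
          omega
      · obtain ⟨h13, h14⟩ := h3 hp
        have h15 : ¬ (d s.1 = 2 ∧ e s.1 = 1) := fun h => h12 ⟨h, h13, h14⟩
        cases ha : Q.arrow (parent s) s.1
        · rw [ha] at h11
          have h16 : ¬ ((d s.1 = 2 ∧ e s.1 = 1 ∧ d (parent s) = 1 ∧ e (parent s) = 0) ∨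
              (d s.1 = 1 ∧ e s.1 = 1 ∧ d (parent s) = 2 ∧ e (parent s) = 1)) :=
            fun h' => (h9 ⟨by simpa using h11, h'⟩).2 hp
          have h17 := h4.2 ha
          simp only [Bool.false_eq_true, if_false]
          omega
        · have h16 : ¬ ((d (parent s) = 2 ∧ e (parent s) = 1 ∧ d s.1 = 1 ∧ e s.1 = 0) ∨
              (d (parent s) = 1 ∧ e (parent s) = 1 ∧ d s.1 = 2 ∧ e s.1 = 1)) :=
            fun h' => (h10 ⟨ha, h'⟩).1 hp
          have h17 := h4.1 ha
          simp only [if_true]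
          omega
      · exact absurd ⟨fun h => absurd h hp, fun h => absurd h hs⟩ hx
  · intro h i j hij
    by_contra hc
    have hc' : ¬ (i ∈ tiles d e C ↔ j ∈ tiles d e C) := by
      have h1 := hmem i
      have h2 := hmem j
      obtain ⟨-, h3⟩ := hij
      intro hiff
      rw [hiff, and_self, not_not] at hc
      have := h1 (hiff.2 hc)
      have := h2 hc
      omega
    obtain ⟨harr, hval⟩ := hij
    obtain ⟨s, ⟨rfl, rfl⟩ | ⟨rfl, rfl⟩⟩ := adj_iff_parent.1 ((Q.adj_iff i j).2 (Or.inl harr))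
    · have h1 := h _ ((mem_bd_attach Q).2 fun h => hc' h.symm)
      have h2 := he.coe_config hd (attach Q s)
      rw [wt_attach hd, if_neg (by simp [Q.asymm _ _ harr])] at h2
      omega
    · have h1 := h _ ((mem_bd_attach Q).2 hc')
      have h2 := he.coe_config hd (attach Q s)
      rw [wt_attach hd, if_pos harr] at h2
      omega

/-- The cycles of a configuration are the boundaries of the components of `S` that no critical arrow
meets. -/
theorem ncard_enclosingCycles (hd : ∀ k, 0 ≤ d k ∧ d k ≤ 2)
    (hchild : ∀ s : Square n, 1 ≤ d (parent s) → d s.1 ≤ d (parent s)) (he : Acceptable Q d e) :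
    (enclosingCycles Q (config Q d e)).ncard =
      Set.ncard {C : (graphS d e).ConnectedComponent | nu Q d e C = 0} := by
  symm
  refine Set.ncard_congr (fun C _ => bd Q (tiles d e C)) ?_ ?_ ?_
  · intro C hC
    exact ⟨⟨isCycle_iff.2 ⟨_, tileConnected_tiles C, rfl⟩, (nu_eq_zero_iff hd he).1 hC⟩,
      _, (tileConnected_tiles C).1, (encloses_iff Q).2 rfl⟩
  · intro C C' _ _ h
    have h := bd_injective Q h
    obtain ⟨k, hk⟩ := (tileConnected_tiles C).1
    obtain ⟨h1, h2⟩ := mem_tiles.1 hk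
    rw [h] at hk
    obtain ⟨h3, h4⟩ := mem_tiles.1 hk
    exact h2.symm.trans h4
  · rintro K ⟨⟨hK, hpos⟩, -⟩
    obtain ⟨T, hT, rfl⟩ := isCycle_iff.1 hK
    have hmem : ∀ k ∈ T, d k = 2 ∧ e k = 1 := fun k hk => he.eq_of_mem hd hchild hpos hk
    have hTS : T ⊆ Finset.univ.filter fun k => d k = 2 ∧ e k = 1 := fun k hk =>
      Finset.mem_filter.2 ⟨Finset.mem_univ k, hmem k hk⟩
    obtain ⟨k, hk⟩ := hT.1
    let C := (graphS d e).connectedComponentMk ⟨k, hmem k hk⟩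
    have hkC : k ∈ tiles d e C := mem_tiles.2 ⟨hmem k hk, rfl⟩
    have hclT : ClosedIn T (Finset.univ.filter fun k => d k = 2 ∧ e k = 1) := by
      intro s h1 h2
      simp only [Finset.mem_filter, Finset.mem_univ, true_and] at h1 h2
      by_contra h
      have h3 := hpos _ ((mem_bd_attach Q).2 fun e => h e.symm)
      have h4 := he.coe_config hd (attach Q s)
      rw [wt_attach hd] at h4
      split_ifs at h4 <;> omega
    have hTC : T = tiles d e C := by
      refine (hT.subset_of_mem hTS (closedIn_tiles C) hk hkC).antisymm ?_
      refine (tileConnected_tiles C).subset_of_mem (fun l hl => ?_) hclT hkC hk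
      exact Finset.mem_filter.2 ⟨Finset.mem_univ l, (mem_tiles.1 hl).1⟩
    rw [hTC] at hpos ⊢
    exact ⟨C, (nu_eq_zero_iff hd he).2 hpos, rfl⟩

end

/-! ### Positive roots -/

section

variable {n : ℕ} [hn : Fact (4 ≤ n)] {Q : DQuiver n} {d e : Fin n → ℤ}

/-- The properties of the positive roots that matter for the configurations: a tile in the support
has no child with a larger entry; at most one square has a larger entry than its parent, and none if
the hexagon is in the support (otherwise the entries are at most 1 and one of the leaves `n - 2`,
`n - 1` has entry 0); and, if 2 occurs, the entry before the first 2 is 1, all entries from there to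
the hexagon are 2, and those of the two leaves are 1. -/
structure RootLike (d : Fin n → ℤ) : Prop where
  bounds : ∀ k, 0 ≤ d k ∧ d k ≤ 2
  child_le : ∀ s : Square n, 1 ≤ d (parent s) → d s.1 ≤ d (parent s)
  le_parent : 1 ≤ d hexTile → ∀ s : Square n, d s.1 ≤ d (parent s)
  top_unique : ∀ s s' : Square n, d (parent s) < d s.1 → d (parent s') < d s'.1 → s = s'
  le_one : d hexTile = 0 → ∀ k, d k ≤ 1
  leaf_zero : d hexTile = 0 → ∀ s s' : Square n, (s.1 : ℕ) + 1 = n → (s'.1 : ℕ) + 2 = n →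
    d s.1 = 0 ∨ d s'.1 = 0
  two : (∀ k, d k ≤ 1) ∨ ∃ j : ℕ, 1 ≤ j ∧ j + 3 ≤ n ∧ (∀ k : Fin n, (k : ℕ) < j → d k ≤ 1) ∧
    (∀ k : Fin n, (k : ℕ) + 1 = j → d k = 1) ∧
    (∀ k : Fin n, j ≤ (k : ℕ) → (k : ℕ) + 3 ≤ n → d k = 2) ∧
    ∀ k : Fin n, n < (k : ℕ) + 3 → d k = 1

theorem IsPositiveRoot.rootLike (hd : IsPositiveRoot n d) : RootLike d := by
  have hn4 := hn.out
  rcases hd with ⟨i, j, hij, hj, hex, rfl⟩ | ⟨i, hi, rfl⟩ | ⟨i, j, hij, hj, rfl⟩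
  · constructor
    · intro k; split_ifs <;> omega
    · rintro ⟨⟨k, hk⟩, hs⟩; simp only [parent] at hs ⊢; split_ifs <;> omega
    · rintro h ⟨⟨k, hk⟩, hs⟩; simp only [parent, hexTile] at h hs ⊢; split_ifs at h ⊢ <;> omega
    · rintro ⟨⟨k, hk⟩, hs⟩ ⟨⟨k', hk'⟩, hs'⟩ h h'
      simp only [parent, Subtype.mk.injEq, Fin.mk.injEq] at h h' hs hs' ⊢
      split_ifs at h h' <;> omega
    · intro _ k; split_ifs <;> omega
    · rintro h ⟨⟨k, hk⟩, hs⟩ ⟨⟨k', hk'⟩, hs'⟩ h1 h2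
      simp only [hexTile] at h h1 h2 ⊢
      split_ifs at h ⊢ <;> omega
    · left; intro k; split_ifs <;> omega
  · constructor
    · intro k; split_ifs <;> omega
    · rintro ⟨⟨k, hk⟩, hs⟩; simp only [parent] at hs ⊢; split_ifs <;> omega
    · rintro h ⟨⟨k, hk⟩, hs⟩; simp only [parent, hexTile] at h hs ⊢; split_ifs at h ⊢ <;> omega
    · rintro ⟨⟨k, hk⟩, hs⟩ ⟨⟨k', hk'⟩, hs'⟩ h h'
      simp only [parent, Subtype.mk.injEq, Fin.mk.injEq] at h h' hs hs' ⊢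
      split_ifs at h h' <;> omega
    · intro _ k; split_ifs <;> omega
    · rintro h ⟨⟨k, hk⟩, hs⟩ ⟨⟨k', hk'⟩, hs'⟩ h1 h2
      simp only [hexTile] at h h1 h2 ⊢
      split_ifs at h ⊢ <;> omega
    · left; intro k; split_ifs <;> omega
  · constructor
    · intro k; split_ifs <;> omega
    · rintro ⟨⟨k, hk⟩, hs⟩; simp only [parent] at hs ⊢; split_ifs <;> omega
    · rintro h ⟨⟨k, hk⟩, hs⟩; simp only [parent, hexTile] at h hs ⊢; split_ifs at h ⊢ <;> omega
    · rintro ⟨⟨k, hk⟩, hs⟩ ⟨⟨k', hk'⟩, hs'⟩ h h'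
      simp only [parent, Subtype.mk.injEq, Fin.mk.injEq] at h h' hs hs' ⊢
      split_ifs at h h' <;> omega
    · intro h k; simp only [hexTile] at h; split_ifs at h <;> omega
    · rintro h ⟨⟨k, hk⟩, hs⟩ ⟨⟨k', hk'⟩, hs'⟩ h1 h2
      simp only [hexTile] at h h1 h2 ⊢
      split_ifs at h ⊢ <;> omega
    · right
      refine ⟨j, by omega, hj, ?_, ?_, ?_, ?_⟩ <;> intro k <;> split_ifs <;> omega

/-! ### Valences -/

theorem coe_valence (M : Edge n → ℕ) (v : Vertex n) :
    (valence Q M v : ℤ) = vertexSum Q (fun x => (M x : ℤ)) v.color v := by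
  unfold valence vertexSum
  rw [Finset.sum_filter, Nat.cast_sum]
  refine Finset.sum_congr rfl fun x _ => ?_
  have h : (endpoint Q .black x = v ∨ endpoint Q .white x = v) ↔ endpoint Q v.color x = v := by
    rw [← mem_ends, ends, Sym2.mem_iff, eq_comm, eq_comm (a := v) (b := endpoint Q .white x)]
  simp only [h]
  split_ifs <;> simp

/-- The valences of the configurations do not depend on `e`: a vertex that is not on the parent of
the square `s` gets the contribution `d s`, and the vertices of the hexagon get the contribution
`d hexTile`.  The remaining terms vanish except for the tile of the support of `d` that is closest
to the hexagon, when the hexagon does not belong to the support. -/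
theorem Acceptable.valence_config (hd : ∀ k, 0 ≤ d k ∧ d k ≤ 2) (he : Acceptable Q d e)
    (v : Vertex n) : (valence Q (config Q d e) v : ℤ) =
      ∑ t, (if .hex t v.color = v then d hexTile else 0) +
        ∑ s : Square n, ((if .sq s v.color = v then d s.1 else 0) +
          if endpoint Q v.color (attach Q s) = v then max (d s.1 - d (parent s)) 0 else 0) := by
  have h := vertexSum_tiles Q (M := ℤ) (fun k b => if b then d k - e k else e k)
    (fun s => if Q.arrow (parent s) s.1 then max (d (parent s) - d s.1) 0 - d (parent s) + e s.1
      else max (d s.1 - d (parent s)) 0 - e s.1) v.color v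
  have h1 : (fun x => (config Q d e x : ℤ)) = fun x =>
      (if outward Q x then d (own x) - e (own x) else e (own x)) + ∑ s, if attach Q s = x then
        (if Q.arrow (parent s) s.1 then max (d (parent s) - d s.1) 0 - d (parent s) + e s.1
          else max (d s.1 - d (parent s)) 0 - e s.1) else 0 := by
    funext x
    rw [he.coe_config hd]
    rcases isOuter_or_attach Q x with hx | ⟨s, rfl⟩
    · rw [wt_outer hd e hx, sum_outer Q hx, add_zero]
    · rw [wt_attach hd, sum_attach Q s (fun s => if Q.arrow (parent s) s.1 then
        max (d (parent s) - d s.1) 0 - d (parent s) + e s.1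
          else max (d s.1 - d (parent s)) 0 - e s.1), own_attach, outward_attach]
      split_ifs <;> ring
  rw [coe_valence, h1, h]
  have h2 : ∀ s : Square n, ((if Q.arrow (parent s) s.1 = true then d s.1 - e s.1 else e s.1) +
      if Q.arrow (parent s) s.1 then max (d (parent s) - d s.1) 0 - d (parent s) + e s.1
          else max (d s.1 - d (parent s)) 0 - e s.1) = max (d s.1 - d (parent s)) 0 := by
    intro s
    split_ifs <;> omega
  simp only [h2, if_true, Bool.false_eq_true, if_false, sub_add_cancel]

theorem Acceptable.valence_hex (hd : ∀ k, 0 ≤ d k ∧ d k ≤ 2) (he : Acceptable Q d e)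
    (t : Fin 3) (c : Color) : (valence Q (config Q d e) (.hex t c) : ℤ) = d hexTile +
      ∑ s : Square n, if endpoint Q c (attach Q s) = .hex t c then
        max (d s.1 - d (parent s)) 0 else 0 := by
  rw [he.valence_config hd]
  simp [Vertex.color]
  rfl

theorem Acceptable.valence_sq (hd : ∀ k, 0 ≤ d k ∧ d k ≤ 2) (he : Acceptable Q d e)
    (s : Square n) (c : Color) : (valence Q (config Q d e) (.sq s c) : ℤ) = d s.1 +
      ∑ s' : Square n, if endpoint Q c (attach Q s') = .sq s c then
        max (d s'.1 - d (parent s')) 0 else 0 := by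
  rw [he.valence_config hd]
  simp [Vertex.color, Finset.sum_add_distrib]
  rfl

theorem Acceptable.valence_eq (hd : ∀ k, 0 ≤ d k ∧ d k ≤ 2) (he : Acceptable Q d e)
    (v : Vertex n) : ∃ k, (valence Q (config Q d e) v : ℤ) = d k +
      ∑ s : Square n, if endpoint Q v.color (attach Q s) = v then
        max (d s.1 - d (parent s)) 0 else 0 := by
  cases v with
  | hex t c => exact ⟨_, he.valence_hex hd t c⟩
  | sq s c => exact ⟨_, he.valence_sq hd s c⟩

theorem Acceptable.exists_valence_eq (hd : RootLike d) (he : Acceptable Q d e)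
    (h : 1 ≤ d hexTile) (v : Vertex n) : ∃ k, (valence Q (config Q d e) v : ℤ) = d k := by
  obtain ⟨k, hk⟩ := he.valence_eq hd.bounds v
  refine ⟨k, ?_⟩
  rw [hk, Finset.sum_eq_zero, add_zero]
  intro s _
  have := hd.le_parent h s
  rw [max_eq_right (by omega), ite_self]

theorem Acceptable.isMixedDimer (hd : RootLike d) (he : Acceptable Q d e) :
    IsMixedDimer Q (config Q d e) := by
  intro v
  zify
  by_cases h : 1 ≤ d hexTile
  · obtain ⟨k, hk⟩ := he.exists_valence_eq hd h v
    rw [hk]; exact (hd.bounds k).2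
  · have h0 : d hexTile = 0 := by have := hd.bounds hexTile; omega
    obtain ⟨k, hk⟩ := he.valence_eq hd.bounds v
    have h1 := hd.le_one h0 k
    have h2 : ∑ s : Square n, (if endpoint Q v.color (attach Q s) = v then
        max (d s.1 - d (parent s)) 0 else 0) ≤ 1 := by
      by_cases hex : ∃ s : Square n, d (parent s) < d s.1
      · obtain ⟨s, hs⟩ := hex
        rw [Finset.sum_eq_single s]
        · have := hd.le_one h0 s.1
          have := hd.bounds (parent s)
          split_ifs <;> omega
        · intro s' _ hne
          have : ¬ d (parent s') < d s'.1 := fun h => hne (hd.top_unique _ _ h hs)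
          rw [max_eq_right (by omega), ite_self]
        · simp
      · push Not at hex
        rw [Finset.sum_eq_zero]
        · exact zero_le_one
        · intro s _
          have := hex s
          rw [max_eq_right (by omega), ite_self]
    omega

theorem Acceptable.le_valence_hex (hd : RootLike d) (he : Acceptable Q d e) (t : Fin 3)
    (c : Color) : d hexTile ≤ valence Q (config Q d e) (.hex t c) := by
  rw [he.valence_hex hd.bounds]
  refine le_add_of_nonneg_right (Finset.sum_nonneg fun s _ => ?_)
  split_ifs <;> simp

theorem Acceptable.le_valence_sq (hd : RootLike d) (he : Acceptable Q d e) (s : Square n)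
    (c : Color) : d s.1 ≤ valence Q (config Q d e) (.sq s c) := by
  rw [he.valence_sq hd.bounds]
  refine le_add_of_nonneg_right (Finset.sum_nonneg fun s _ => ?_)
  split_ifs <;> simp

theorem Acceptable.le_valence_attach (hd : RootLike d) (he : Acceptable Q d e) (c : Color)
    (s : Square n) : d s.1 ≤ valence Q (config Q d e) (endpoint Q c (attach Q s)) ∧
      d (parent s) ≤ valence Q (config Q d e) (endpoint Q c (attach Q s)) := by
  induction s using square_induction with
  | h s ih =>
    have h1 : d (parent s) ≤ valence Q (config Q d e) (endpoint Q c (attach Q s)) := by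
      rcases attach_cases Q s with ⟨hs, t, h | h⟩ | ⟨hs, p, hp, hp', h | ⟨c', h⟩⟩
      · obtain ⟨t', ht⟩ := (endpoint_hex Q c t).1
        rw [h, ht, parent_eq_hexTile s hs]; exact he.le_valence_hex hd _ _
      · obtain ⟨t', ht⟩ := (endpoint_hex Q c t).2
        rw [h, ht, parent_eq_hexTile s hs]; exact he.le_valence_hex hd _ _
      · rw [h, endpoint_far, ← hp']; exact he.le_valence_sq hd _ _
      · rw [h, ← hp']
        rcases eq_or_eq_other c c' with rfl | rfl
        · rw [endpoint_side]; exact (ih p hp hs).1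
        · rw [endpoint_side_other]; exact he.le_valence_sq hd _ _
    refine ⟨?_, h1⟩
    have h2 := hd.child_le s
    have h3 := hd.bounds (parent s)
    by_cases h4 : 1 ≤ d (parent s)
    · have := h2 h4; omega
    · obtain ⟨k, hk⟩ := he.valence_eq hd.bounds (endpoint Q c (attach Q s))
      have h5 := hd.bounds k
      rw [hk, color_endpoint]
      have h6 := Finset.single_le_sum (f := fun s' : Square n =>
        if endpoint Q c (attach Q s') = endpoint Q c (attach Q s) then
          max (d s'.1 - d (parent s')) 0 else 0) (fun s' _ => by split_ifs <;> simp)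
        (Finset.mem_univ s)
      simp only [if_true] at h6
      omega

theorem Acceptable.valenceCondition (hd : RootLike d) (he : Acceptable Q d e) :
    ValenceCondition Q d (config Q d e) := by
  intro k v hv
  have h1 : d k ≤ valence Q (config Q d e) v := by
    obtain ⟨x, hx, c, rfl⟩ := hv
    rw [mem_sides] at hx
    rcases hx with rfl | ⟨s, rfl, rfl⟩
    · induction x using edge_cases with
      | h1 t =>
        obtain ⟨t', ht⟩ := (endpoint_hex Q c t).1
        rw [ht]; exact he.le_valence_hex hd _ _
      | h2 t =>
        obtain ⟨t', ht⟩ := (endpoint_hex Q c t).2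
        rw [ht]; exact he.le_valence_hex hd _ _
      | h3 s => rw [endpoint_far]; exact he.le_valence_sq hd _ _
      | h4 c' s =>
        rw [own_side]
        rcases eq_or_eq_other c c' with rfl | rfl
        · rw [endpoint_side]; exact (he.le_valence_attach hd _ _).1
        · rw [endpoint_side_other]; exact he.le_valence_sq hd _ _
    · exact (he.le_valence_attach hd _ _).1
  have h2 := he.isMixedDimer hd v
  omega

end

/-! ### Critical arrows -/

section

variable {n : ℕ} [hn : Fact (4 ≤ n)] {Q : DQuiver n} {d e : Fin n → ℤ}

/-- The arrow between the square `s` and its parent is critical. -/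
def CriticalAt (Q : DQuiver n) (d e : Fin n → ℤ) (s : Square n) : Prop :=
  d s.1 = 1 ∧ d (parent s) = 2 ∧ e (parent s) = 1 ∧
    e s.1 = if Q.arrow (parent s) s.1 then 0 else 1

/-- All critical arrows join a square to its parent, with the 2 at the parent. -/
theorem isCritical_iff (hd : RootLike d) {i j : Fin n} : IsCritical Q d e i j ↔
    ∃ s, CriticalAt Q d e s ∧
      (i, j) = if Q.arrow (parent s) s.1 then (parent s, s.1) else (s.1, parent s) := by
  constructor
  · rintro ⟨ha, hv⟩
    obtain ⟨s, ⟨rfl, rfl⟩ | ⟨rfl, rfl⟩⟩ := adj_iff_parent.1 ((Q.adj_iff i j).2 (Or.inl ha))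
    · have := hd.child_le s
      refine ⟨s, ?_, by simp [Q.asymm _ _ ha]⟩
      simp only [CriticalAt, Q.asymm _ _ ha, Bool.false_eq_true, if_false]
      omega
    · have := hd.child_le s
      refine ⟨s, ?_, by simp [ha]⟩
      simp only [CriticalAt, ha, if_true]
      omega
  · rintro ⟨s, ⟨h1, h2, h3, h4⟩, h5⟩
    have h6 := arrow_parent Q s
    split_ifs at h4 h5 with ha
    · simp only [Prod.mk.injEq] at h5
      obtain ⟨rfl, rfl⟩ := h5
      exact ⟨ha, Or.inl ⟨h2, h3, h1, h4⟩⟩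
    · simp only [Prod.mk.injEq] at h5
      obtain ⟨rfl, rfl⟩ := h5
      exact ⟨by simpa [ha] using h6, Or.inr ⟨h1, h4, h2, h3⟩⟩

theorem nu_le_one_iff (hd : RootLike d) (C : (graphS d e).ConnectedComponent) : nu Q d e C ≤ 1 ↔
    ∀ s s', CriticalAt Q d e s → parent s ∈ tiles d e C → CriticalAt Q d e s' →
      parent s' ∈ tiles d e C → s = s' := by
  let f : Square n → Fin n × Fin n := fun s =>
    if Q.arrow (parent s) s.1 then (parent s, s.1) else (s.1, parent s)
  have hf : Function.Injective f := by
    intro s s' h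
    have key : ∀ s s' : Square n, s.1 = parent s' → parent s = s'.1 → s = s' := by
      intro s s' h1 h2
      have := (below_iff s s).1 (Or.inl rfl)
      have h3 : Below s s'.1 → s' = s ∨ Below s (parent s') := (below_iff s s').1
      exact absurd (h1 ▸ Or.inr ((below_iff s' s).2 (Or.inr (h2 ▸ Or.inl rfl)) : Below s' s.1))
        (by rintro (h | h)
            · exact parent_ne s (h2.trans h)
            · exact not_below_parent s' (h1 ▸ h))
    simp only [f] at h
    split_ifs at h <;> simp only [Prod.mk.injEq] at h
    · exact Subtype.ext h.2
    · exact key s s' h.2 h.1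
    · exact key s s' h.1 h.2
    · exact Subtype.ext h.1
  have himage : {a : Fin n × Fin n | IsCritical Q d e a.1 a.2 ∧
      (a.1 ∈ Subtype.val '' C.supp ∨ a.2 ∈ Subtype.val '' C.supp)} =
      f '' {s | CriticalAt Q d e s ∧ parent s ∈ tiles d e C} := by
    ext ⟨i, j⟩
    simp only [Set.mem_ofPred_eq, isCritical_iff hd, ← mem_tiles_iff_mem_image]
    simp only [Set.mem_image, Set.mem_ofPred_eq]
    have hs : ∀ s, CriticalAt Q d e s → s.1 ∉ tiles d e C := by
      rintro s ⟨h1, -⟩ h2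
      have := (mem_tiles.1 h2).1
      omega
    constructor
    · rintro ⟨⟨s, hc, h⟩, hm⟩
      refine ⟨s, ⟨hc, ?_⟩, h.symm⟩
      have h1 := hs s hc
      split_ifs at h <;> simp only [Prod.mk.injEq] at h <;> obtain ⟨rfl, rfl⟩ := h <;> tauto
    · rintro ⟨s, ⟨hc, hm⟩, h⟩
      refine ⟨⟨s, hc, h.symm⟩, ?_⟩
      simp only [f] at h
      split_ifs at h <;> simp only [Prod.mk.injEq] at h <;> obtain ⟨rfl, rfl⟩ := h <;> tauto
  unfold nu
  rw [himage, Set.ncard_image_of_injective _ hf, Set.ncard_le_one (Set.toFinite _)]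
  constructor
  · intro h s s' h1 h2 h3 h4
    exact h s ⟨h1, h2⟩ s' ⟨h3, h4⟩
  · rintro h s ⟨h1, h2⟩ s' ⟨h3, h4⟩
    exact h s s' h1 h2 h3 h4

/-! ### Cuts -/

theorem supportGraph_eq (M : Edge n → ℕ) : supportGraph Q M = edgeGraph Q {x | 0 < M x} := rfl

/-- A set of vertices that is closed under the edges of a configuration. -/
def IsCut (Q : DQuiver n) (M : Edge n → ℕ) (U : Set (Vertex n)) : Prop :=
  ∀ x, 0 < M x → ∀ c, endpoint Q c x ∈ U → endpoint Q c.other x ∈ U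

theorem IsCut.not_reachable {M : Edge n → ℕ} {U : Set (Vertex n)} (hU : IsCut Q M U)
    {u v : Vertex n} (hu : u ∈ U) (hv : v ∉ U) : ¬ (supportGraph Q M).Reachable u v := by
  rintro ⟨p⟩
  refine hv (SimpleGraph.Walk.forall_mem_support p (U := U) (fun a b hab ha => ?_) hu v
    p.end_mem_support)
  have hadj := p.adj_of_mem_edges hab
  rw [supportGraph_eq] at hadj
  obtain ⟨x, hx, h1, h2⟩ := (edgeGraph_adj_iff Q).1 hadj
  rw [← h2]
  exact hU x hx _ (h1.symm ▸ ha)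

/-- The vertices of the tiles `k` with `Below s k` that are not on the parent of `s`. -/
def lowerVerts (s : Square n) : Set (Vertex n) := {v | ∃ s' c, v = .sq s' c ∧ Below s s'.1}

theorem sq_mem_lowerVerts {s s' : Square n} {c : Color} :
    Vertex.sq s' c ∈ lowerVerts s ↔ Below s s'.1 := by
  constructor
  · rintro ⟨s'', c', h, hb⟩; cases h; exact hb
  · intro h; exact ⟨s', c, rfl, h⟩

theorem below_own_of_endpoint_mem {s : Square n} {c : Color} {x : Edge n}
    (h : endpoint Q c x ∈ lowerVerts s) : Below s (own x) := by
  obtain ⟨s', c', h, hb⟩ := h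
  induction x using edge_cases with
  | h1 t => obtain ⟨t', ht⟩ := (endpoint_hex Q c t).1; rw [ht] at h; cases h
  | h2 t => obtain ⟨t', ht⟩ := (endpoint_hex Q c t).2; rw [ht] at h; cases h
  | h3 s'' => rw [endpoint_far] at h; cases h; exact hb
  | h4 c'' s'' =>
    rw [own_side]
    rcases eq_or_eq_other c c'' with rfl | rfl
    · rw [endpoint_side] at h
      have h1 := lt_of_endpoint_attach Q h
      simp only [Below, Fin.lt_def, Fin.ext_iff] at *
      omega
    · rw [endpoint_side_other] at h; cases h; exact hb

theorem attach_eq_side {s s' : Square n} {c : Color} (h : attach Q s' = side c s) :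
    (s.1 : ℕ) = s'.1 + 1 ∧ (s.1 : ℕ) + 4 ≤ n ∧ parent s' = s.1 ∧
      (c = .white ↔ Even (n + (s.1 : ℕ))) := by
  have hp : parent s' = s.1 := by rw [← own_attach Q s', h, own_side]
  by_cases h1 : (s'.1 : ℕ) + 4 < n
  · rw [attach_of_lt Q s' h1] at h
    have h2 : (s.1 : ℕ) = s'.1 + 1 := by rw [← hp, ← nextSquare_val s' h1]; rfl
    refine ⟨h2, by omega, hp, ?_⟩
    rw [h2]
    cases c <;> simp only [side] at h <;> split_ifs at h with h3 h4 <;> simp_all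
  · rw [attach_of_le Q s' (by omega)] at h
    cases c <;> simp only [side] at h <;> split_ifs at h

/-- As the zig-zags turn alternately to the left and to the right, at most three squares meet in a
vertex. -/
theorem isOuter_side_of_attach_eq {s s' : Square n} {c : Color} (h : attach Q s' = side c s) :
    IsOuter Q (side c s') := by
  intro s'' h'
  obtain ⟨h1, -, -, h2⟩ := attach_eq_side h
  obtain ⟨h3, -, -, h4⟩ := attach_eq_side h'
  rw [h2, h1, ← add_assoc, Nat.even_add_one] at h4
  tauto

/-- The vertices on the parent of `s` of the edges below `s`. -/
theorem endpoint_of_below {s : Square n} (c : Color) {x : Edge n} (hx : Below s (own x)) :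
    endpoint Q c x ∈ lowerVerts s ∨ endpoint Q c x = endpoint Q c (attach Q s) ∧
      (x = side c s ∨ ∃ s', attach Q s' = side c s ∧ x = side c s') := by
  induction x using edge_cases with
  | h1 t => exact absurd hx (not_below_hexTile s)
  | h2 t => exact absurd hx (not_below_hexTile s)
  | h3 s' => left; rw [endpoint_far]; exact sq_mem_lowerVerts.2 hx
  | h4 c' s' =>
    rw [own_side] at hx
    rcases eq_or_eq_other c c' with rfl | rfl
    swap
    · left; rw [endpoint_side_other]; exact sq_mem_lowerVerts.2 hx
    rw [endpoint_side]
    rcases hx with hx | hx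
    · rw [show s' = s from Subtype.ext hx]; exact Or.inr ⟨rfl, Or.inl rfl⟩
    rw [Fin.lt_def] at hx
    rcases attach_cases Q s' with ⟨hs, -⟩ | ⟨hs, p, hp, -, h | ⟨c, h⟩⟩
    · omega
    · left
      rw [h, endpoint_far]
      refine sq_mem_lowerVerts.2 ?_
      simp only [Below, Fin.lt_def, Fin.ext_iff]; omega
    · rcases eq_or_eq_other c' c with rfl | rfl
      swap
      · left
        rw [h, endpoint_side_other]
        refine sq_mem_lowerVerts.2 ?_
        simp only [Below, Fin.lt_def, Fin.ext_iff]; omega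
      by_cases hps : p = s
      · subst hps
        right
        exact ⟨by rw [h, endpoint_side], Or.inr ⟨s', h, rfl⟩⟩
      · left
        have hps' : (p.1 : ℕ) ≠ s.1 := fun h => hps (Subtype.ext (Fin.ext h))
        rw [h, endpoint_side]
        rcases attach_cases Q p with ⟨hs, -⟩ | ⟨hs, p', hp', -, h' | ⟨c', h'⟩⟩
        · omega
        · rw [h', endpoint_far]
          refine sq_mem_lowerVerts.2 ?_
          simp only [Below, Fin.lt_def, Fin.ext_iff]; omega
        · rcases eq_or_eq_other c c' with rfl | rfl
          · exact absurd h (isOuter_side_of_attach_eq h' s')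
          · rw [h', endpoint_side_other]
            refine sq_mem_lowerVerts.2 ?_
            simp only [Below, Fin.lt_def, Fin.ext_iff]; omega

/-- The total weight of the edges below the square `s` at each of the two vertices that `s` shares
with its parent, apart from the edge that joins these vertices. -/
def lowerSum (Q : DQuiver n) (d e : Fin n → ℤ) (s : Square n) : ℤ :=
  if Q.arrow (parent s) s.1 then d s.1 - e s.1 else e s.1

theorem wt_side_outer (hd : ∀ k, 0 ≤ d k ∧ d k ≤ 2) {s : Square n} {c : Color}
    (h : IsOuter Q (side c s)) : wt Q d e (side c s) = lowerSum Q d e s := by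
  rw [wt_outer hd e h, outward_side, own_side, lowerSum]

/-- If the square `s'` is glued to the side `side c s`, two edges below `s` meet its parent in the
vertex of colour `c`; their total weight is the same as at the other vertex. -/
theorem wt_side_add_wt_side (hd : ∀ k, 0 ≤ d k ∧ d k ≤ 2) {s s' : Square n} {c : Color}
    (h : attach Q s' = side c s) (hle : d s'.1 ≤ d s.1) :
    wt Q d e (side c s) + wt Q d e (side c s') = lowerSum Q d e s := by
  rw [wt_side_outer hd (isOuter_side_of_attach_eq h)]
  have h1 : Q.arrow (parent s') s'.1 = Q.arrow (parent s) s.1 := by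
    rw [← outward_attach, h, outward_side]
  rw [← h, wt_attach hd, lowerSum, lowerSum, h1, (attach_eq_side h).2.2.1]
  split_ifs <;> omega

/-- If no edge below the square `s` meets its parent, the square can be cut off from its parent. -/
theorem Acceptable.isCut_lowerVerts (hd : RootLike d) (he : Acceptable Q d e) {s : Square n}
    (hchild : ∀ s', parent s' = s.1 → d s'.1 ≤ d s.1) (h0 : lowerSum Q d e s = 0) :
    IsCut Q (config Q d e) (lowerVerts s) := by
  intro x hx c hc
  rcases endpoint_of_below c.other (below_own_of_endpoint_mem hc) with h | ⟨-, h⟩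
  · exact h
  exfalso
  have h1 := he.coe_config hd.bounds x
  have key : ∀ c x, (x = side c s ∨ ∃ s', attach Q s' = side c s ∧ x = side c s') →
      wt Q d e x ≤ 0 := by
    rintro c x (rfl | ⟨s', h, rfl⟩)
    · rcases isOuter_or_attach Q (side c s) with ho | ⟨s', h⟩
      · rw [wt_side_outer hd.bounds ho, h0]
      · have h2 := wt_side_add_wt_side (e := e) hd.bounds h (hchild s' (attach_eq_side h).2.2.1)
        have h3 := he.wt_nonneg hd.bounds (side c s')
        omega
    · have h2 := wt_side_add_wt_side (e := e) hd.bounds h (hchild s' (attach_eq_side h).2.2.1)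
      have h3 := he.wt_nonneg hd.bounds (side c s)
      omega
  have := key _ _ h
  omega

theorem sum_le_valence (M : Edge n → ℕ) (v : Vertex n) (A : Finset (Edge n))
    (hA : ∀ x ∈ A, endpoint Q v.color x = v) : ∑ x ∈ A, (M x : ℤ) ≤ valence Q M v := by
  rw [coe_valence, vertexSum, ← Finset.sum_filter]
  refine Finset.sum_le_sum_of_subset_of_nonneg (fun x hx => ?_) fun x _ _ => by positivity
  simp [hA x hx]

theorem attach_ne_side (c : Color) {s s' : Square n} (h : attach Q s' = side c s) :
    attach Q s ≠ side c s' := by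
  intro h'
  have := (attach_eq_side h).1
  have := (attach_eq_side h').1
  omega

/-- If the valences at the two vertices that `s` shares with its parent are exhausted by the edges
below `s` and the common edge, then the square can be cut off together with these vertices. -/
theorem Acceptable.isCut_insert (hd : RootLike d) (he : Acceptable Q d e) {s : Square n}
    (hchild : ∀ s', parent s' = s.1 → d s'.1 ≤ d s.1)
    (h0 : ∀ v, valence Q (config Q d e) v ≤ wt Q d e (attach Q s) + lowerSum Q d e s) :
    IsCut Q (config Q d e) (lowerVerts s ∪ {v | ∃ c, v = endpoint Q c (attach Q s)}) := by
  intro x hx c hc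
  by_cases hb : Below s (own x)
  · rcases endpoint_of_below (Q := Q) c.other hb with h | ⟨h, -⟩
    · exact Or.inl h
    · exact Or.inr ⟨_, h⟩
  rcases hc with hc | ⟨c', hc⟩
  · exact absurd (below_own_of_endpoint_mem hc) hb
  have hcc : c' = c := by
    have := congrArg Vertex.color hc
    rw [color_endpoint, color_endpoint] at this
    exact this.symm
  subst hcc
  by_cases hxa : x = attach Q s
  · rw [hxa]; exact Or.inr ⟨_, rfl⟩
  exfalso
  set v := endpoint Q c' (attach Q s) with hv
  have hcol : v.color = c' := color_endpoint Q _ _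
  have h1 := h0 v
  have hxs : x ≠ side c' s := by
    rintro rfl; exact hb (by rw [own_side]; exact Or.inl rfl)
  have has : attach Q s ≠ side c' s := by
    intro h; have := (attach_eq_side h).1; omega
  rcases isOuter_or_attach Q (side c' s) with ho | ⟨s', h⟩
  · have h2 := sum_le_valence (Q := Q) (config Q d e) v {x, attach Q s, side c' s} (by
      rw [hcol]; simp [hc, hv])
    rw [Finset.sum_insert (by simp [hxa, hxs]), Finset.sum_pair has, he.coe_config hd.bounds,
      he.coe_config hd.bounds, he.coe_config hd.bounds, wt_side_outer hd.bounds ho] at h2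
    have := he.coe_config hd.bounds x
    omega
  · have hxs' : x ≠ side c' s' := by
      rintro rfl
      refine hb ?_
      rw [own_side, below_iff, (attach_eq_side h).2.2.1]
      exact Or.inr (Or.inl rfl)
    have hss' : side c' s ≠ side c' s' := by
      intro h'
      have h3 := congrArg own h'
      rw [own_side, own_side] at h3
      have := (attach_eq_side h).1
      rw [h3] at this
      omega
    have h2 := sum_le_valence (Q := Q) (config Q d e) v {x, attach Q s, side c' s, side c' s'} (by
      rw [hcol]; simp [hc, hv, ← endpoint_side Q c' s, ← h])
    rw [Finset.sum_insert (by simp [hxa, hxs, hxs']),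
      Finset.sum_insert (by simp [has, attach_ne_side c' h]), Finset.sum_pair hss',
      he.coe_config hd.bounds, he.coe_config hd.bounds, he.coe_config hd.bounds,
      he.coe_config hd.bounds] at h2
    have h3 := wt_side_add_wt_side (e := e) hd.bounds h (hchild s' (attach_eq_side h).2.2.1)
    have := he.coe_config hd.bounds x
    omega

/-- A necessary condition for the edges of the configuration to connect the square `s` to vertices
that are neither below `s` nor on the edge that `s` shares with its parent: neither the edges below
`s` have weight 0 at this edge, nor do they exhaust, together with it, the valences of its two ends.
-/
def IsOpen (Q : DQuiver n) (d e : Fin n → ℤ) (s : Square n) : Prop :=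
  if Q.arrow (parent s) s.1 then e s.1 < d s.1 ∧ 0 < e (parent s)
    else 0 < e s.1 ∧ e (parent s) < d (parent s)

/-- A square can be cut off, possibly together with the two vertices that it shares with its parent,
unless a path of edges can pass from the square to its parent. -/
theorem Acceptable.exists_isCut (hd : RootLike d) (he : Acceptable Q d e) {s : Square n}
    (hchild : ∀ s', parent s' = s.1 → d s'.1 ≤ d s.1) (hle : d s.1 ≤ d (parent s))
    (hval : ∀ v, (valence Q (config Q d e) v : ℤ) ≤ d (parent s))
    (hopen : ¬ IsOpen Q d e s) :
    ∃ U, IsCut Q (config Q d e) U ∧ lowerVerts s ⊆ U ∧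
      ∀ v ∈ U, v ∈ lowerVerts s ∨ ∃ c, v = endpoint Q c (attach Q s) := by
  by_cases h0 : lowerSum Q d e s = 0
  · exact ⟨_, he.isCut_lowerVerts hd hchild h0, subset_rfl, fun v => Or.inl⟩
  · refine ⟨_, he.isCut_insert hd hchild fun v => (hval v).trans ?_, Set.subset_union_left,
      fun v => id⟩
    have h1 := he.1 s.1
    have h2 := he.1 (parent s)
    rw [wt_attach hd.bounds]
    unfold IsOpen at hopen
    unfold lowerSum at h0 ⊢
    split_ifs at h0 hopen ⊢ <;> omega

end

/-! ### Tran's third condition implies that the configuration is node-monochromatic -/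

section

variable {n : ℕ} [hn : Fact (4 ≤ n)] {Q : DQuiver n} {d e : Fin n → ℤ}

theorem Acceptable.not_isOpen_of_le_one (he : Acceptable Q d e) {s : Square n} (h : d s.1 ≤ 1)
    (hp : d (parent s) = 1) : ¬ IsOpen Q d e s := by
  have h1 := he.attach_le s
  have h2 := he.1 s.1
  have h3 := he.1 (parent s)
  unfold IsOpen
  cases ha : Q.arrow (parent s) s.1
  · have := h1.2 ha; simp only [Bool.false_eq_true, if_false]; omega
  · have := h1.1 ha; simp only [if_true]; omega

/-- A passage from an entry 1 to an entry 2 is open only if its arrow is critical. -/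
theorem Acceptable.criticalAt_of_isOpen (he : Acceptable Q d e) {s : Square n} (h : d s.1 = 1)
    (hp : d (parent s) = 2) (ho : IsOpen Q d e s) : CriticalAt Q d e s := by
  have h1 := he.attach_le s
  have h2 := he.1 s.1
  have h3 := he.1 (parent s)
  unfold IsOpen at ho
  refine ⟨h, hp, ?_⟩
  cases ha : Q.arrow (parent s) s.1
  · have := h1.2 ha; simp only [ha, Bool.false_eq_true, if_false] at ho ⊢; omega
  · have := h1.1 ha; simp only [ha, if_true] at ho ⊢; omega

theorem Acceptable.eq_one_of_isOpen (he : Acceptable Q d e) {s : Square n} (h : d s.1 = 2)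
    (hp : d (parent s) = 2) (ho : IsOpen Q d e s) : e s.1 = 1 ∧ e (parent s) = 1 := by
  have h1 := he.attach_le s
  have h2 := he.1 s.1
  have h3 := he.1 (parent s)
  unfold IsOpen at ho
  cases ha : Q.arrow (parent s) s.1
  · have := h1.2 ha; simp only [ha, Bool.false_eq_true, if_false] at ho; omega
  · have := h1.1 ha; simp only [ha, if_true] at ho; omega

theorem parent_leaf {s : Square n} (hs : n < (s.1 : ℕ) + 3) : parent s = hexTile :=
  parent_eq_hexTile s (by omega)

theorem parent_ne_leaf {s : Square n} (hs : n < (s.1 : ℕ) + 3) (s' : Square n) :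
    parent s' ≠ s.1 := by
  have := hn.out
  simp only [parent, ne_eq, Fin.ext_iff]; omega

theorem parent_val {s : Square n} (hs : (s.1 : ℕ) + 4 ≤ n) : (parent s : ℕ) = s.1 + 1 := by
  simp only [parent]; omega

theorem below_or_of_mem_cut {s : Square n} {U : Set (Vertex n)}
    (hU : ∀ v ∈ U, v ∈ lowerVerts s ∨ ∃ c, v = endpoint Q c (attach Q s)) {s' : Square n}
    {c : Color} (h : Vertex.sq s' c ∈ U) :
    Below s s'.1 ∨ (s.1 : ℕ) < s'.1 ∧ (s'.1 : ℕ) + 4 ≤ n := by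
  rcases hU _ h with h | ⟨c', h⟩
  · exact Or.inl (sq_mem_lowerVerts.1 h)
  · exact Or.inr (lt_of_endpoint_attach Q h.symm)

/-- A leaf that is not open is cut off from all other squares. -/
theorem Acceptable.not_reachable_leaf (hd : RootLike d) (he : Acceptable Q d e) {s s' : Square n}
    (hs : n < (s.1 : ℕ) + 3) (hss' : s' ≠ s) (hle : d s.1 ≤ d (parent s))
    (hval : d s.1 = 0 ∨ ∀ v, (valence Q (config Q d e) v : ℤ) ≤ d (parent s))
    (ho : d s.1 = 0 ∨ ¬ IsOpen Q d e s) (c c' : Color) :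
    ¬ (supportGraph Q (config Q d e)).Reachable (.sq s c) (.sq s' c') := by
  have hchild : ∀ s', parent s' = s.1 → d s'.1 ≤ d s.1 := fun s' h =>
    absurd h (parent_ne_leaf hs s')
  have : ∃ U, IsCut Q (config Q d e) U ∧ lowerVerts s ⊆ U ∧
      ∀ v ∈ U, v ∈ lowerVerts s ∨ ∃ c, v = endpoint Q c (attach Q s) := by
    by_cases h0 : d s.1 = 0
    · refine ⟨_, he.isCut_lowerVerts hd hchild ?_, subset_rfl, fun v => Or.inl⟩
      have := he.1 s.1
      unfold lowerSum; split_ifs <;> omega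
    · exact he.exists_isCut hd hchild hle (hval.resolve_left h0) (ho.resolve_left h0)
  obtain ⟨U, hU, h1, h2⟩ := this
  refine hU.not_reachable (h1 (sq_mem_lowerVerts.2 (Or.inl rfl))) fun h3 => ?_
  rcases below_or_of_mem_cut h2 h3 with h4 | h4
  · rcases h4 with h4 | h4
    · exact hss' (Subtype.ext h4)
    · omega
  · omega

theorem isNode_red {v : Vertex n} (h : IsNode Q d .red v) :
    ∃ (s : Square n) (c : Color), (s.1 : ℕ) + 1 = n ∧ v = .sq s c := by
  obtain ⟨s, hs, c, rfl⟩ := h; exact ⟨s, c, hs, rfl⟩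

theorem isNode_blue {v : Vertex n} (h : IsNode Q d .blue v) :
    ∃ (s : Square n) (c : Color), (s.1 : ℕ) + 2 = n ∧ v = .sq s c := by
  obtain ⟨s, hs, c, rfl⟩ := h; exact ⟨s, c, hs, rfl⟩

/-- The green nodes lie on squares before the first tile with `d j = 2`. -/
theorem isNode_green {v : Vertex n} (h : IsNode Q d .green v) : ∃ j : Fin n, d j = 2 ∧
    (∀ i < j, d i ≠ 2) ∧ ∃ (s : Square n) (c : Color), s.1 < j ∧ v = .sq s c := by
  obtain ⟨j, hj, hmin, p, hp, ⟨-, c, rfl⟩ | ⟨k, hk, hns, c, hc, rfl | rfl⟩⟩ := h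
  · exact ⟨j, hj, hmin, p, c, by rw [Fin.lt_def]; omega, rfl⟩
  · refine ⟨j, hj, hmin, p, c, by rw [Fin.lt_def]; omega, ?_⟩
    have hpk : (p.1 : ℕ) = k.1 + 1 := by omega
    have hjn := j.2
    have hp3 := p.2
    have hk4 : (k.1 : ℕ) + 4 < n := by omega
    have hpn : nextSquare k hk4 = p := Subtype.ext (Fin.ext (by simp only [nextSquare]; omega))
    have hpj : parent p = j := Fin.ext (by simp only [parent]; omega)
    have hatt : ∃ c', attach Q k = side c' p := by
      rw [attach_of_lt Q k hk4, hpn, if_neg hns]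
      split_ifs
      exacts [⟨.white, rfl⟩, ⟨.black, rfl⟩]
    obtain ⟨c', hc'⟩ := hatt
    rw [hc'] at hc ⊢
    rcases eq_or_eq_other c c' with rfl | rfl
    · refine absurd ⟨attach Q p, ?_, c', ?_⟩ hc
      · rw [mem_sides, own_attach]; exact Or.inl hpj
      · rw [endpoint_side]
    · rw [endpoint_side_other]
  · exact ⟨j, hj, hmin, k, c, by rw [Fin.lt_def]; omega, rfl⟩

/-- If the squares from `j` on are all open, then all the tiles `j, …, n - 3` belong to the same
component of `S`. -/
theorem Acceptable.mem_tiles_of_isOpen (he : Acceptable Q d e) {j : ℕ}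
    (hd2 : ∀ k : Fin n, j ≤ (k : ℕ) → (k : ℕ) + 3 ≤ n → d k = 2)
    (ho : ∀ s : Square n, j ≤ (s.1 : ℕ) → (s.1 : ℕ) + 4 ≤ n → IsOpen Q d e s)
    {C : (graphS d e).ConnectedComponent} (hC : hexTile ∈ tiles d e C) (k : Fin n)
    (h1 : j ≤ (k : ℕ)) (h2 : (k : ℕ) + 3 ≤ n) : k ∈ tiles d e C := by
  revert h1 h2
  induction k using root_induction with
  | h0 => intro _ _; exact hC
  | h s ih =>
    intro h1 h2
    have hs4 : (s.1 : ℕ) + 4 ≤ n := by have := s.2; omega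
    have hpv := parent_val hs4
    have hp := ih (by omega) (by omega)
    have hds := hd2 s.1 h1 h2
    have hdp := hd2 (parent s) (by omega) (by omega)
    have h3 := he.eq_one_of_isOpen hds hdp (ho s h1 hs4)
    refine (closedIn_tiles C s ?_ ?_).2 hp
    · exact Finset.mem_filter.2 ⟨Finset.mem_univ _, hds, h3.1⟩
    · exact Finset.mem_filter.2 ⟨Finset.mem_univ _, hdp, h3.2⟩

/-- If a leaf is open, its arrow is critical.  If moreover all the passages from the hexagon down to
the last tile `j - 1` with entry 1 are open, then the tiles `j, …, n - 3` lie in one component of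
`S`, which meets a second critical arrow.  So there is a cut between the leaf and the green nodes.
-/
theorem Acceptable.not_reachable_green (hd : RootLike d) (he : Acceptable Q d e)
    (hnu : ∀ C : (graphS d e).ConnectedComponent, nu Q d e C ≤ 1) {s : Square n}
    (hs : n < (s.1 : ℕ) + 3) (c : Color) {v : Vertex n} (hv : IsNode Q d .green v) :
    ¬ (supportGraph Q (config Q d e)).Reachable (.sq s c) v := by
  obtain ⟨j, hj2, hjmin, s', c', hs', rfl⟩ := isNode_green hv
  rcases hd.two with h | ⟨J, hJ1, hJ3, hJlt, hJeq, hJ2, hJleaf⟩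
  · have := h j; omega
  have hjJ : (j : ℕ) = J := by
    refine le_antisymm ?_ ?_
    · by_contra h
      exact hjmin ⟨J, by omega⟩ (by rw [Fin.lt_def]; simp only; omega)
        (hJ2 ⟨J, by omega⟩ le_rfl hJ3)
    · by_contra h
      have := hJlt j (by omega); omega
  rw [Fin.lt_def] at hs'
  have hval : ∀ v, (valence Q (config Q d e) v : ℤ) ≤ 2 := fun v => by
    have := he.isMixedDimer hd v; omega
  have hpar := parent_leaf hs
  have hdh : d hexTile = 2 := hJ2 _ (by simp only [hexTile]; omega) (by simp only [hexTile]; omega)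
  have hds := hJleaf s.1 hs
  by_cases hcr : CriticalAt Q d e s
  -- the cut is at a square of the snake that is not open
  · have hex : ∃ s₀ : Square n, J ≤ (s₀.1 : ℕ) + 1 ∧ (s₀.1 : ℕ) + 4 ≤ n ∧ ¬ IsOpen Q d e s₀ := by
      by_contra! hall
      have heh : e hexTile = 1 := by rw [← hpar]; exact hcr.2.2.1
      let C := (graphS d e).connectedComponentMk ⟨hexTile, hdh, heh⟩
      have hC : hexTile ∈ tiles d e C := mem_tiles.2 ⟨⟨hdh, heh⟩, rfl⟩
      let p : Square n := ⟨⟨J - 1, by omega⟩, by simp only; omega⟩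
      have hpp : (parent p : ℕ) = J := by simp only [p, parent]; omega
      have hpc : CriticalAt Q d e p := by
        refine he.criticalAt_of_isOpen (hJeq _ (by simp only [p]; omega))
          (hJ2 _ (by omega) (by omega)) (hall p ?_ ?_) <;> simp only [p] <;> omega
      have hmem := he.mem_tiles_of_isOpen (Q := Q) hJ2 (fun s h1 h2 => hall s (by omega) h2) hC
        (parent p) (by omega) (by omega)
      have := (nu_le_one_iff hd C).1 (hnu C) p s hpc hmem hcr (by rw [hpar]; exact hC)
      have := congrArg (fun s : Square n => (s.1 : ℕ)) this
      simp only [p] at this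
      omega
    obtain ⟨s₀, h1, h2, h3⟩ := hex
    have hpv := parent_val h2
    have hdp : d (parent s₀) = 2 := hJ2 _ (by omega) (by omega)
    have hds0 : 1 ≤ d s₀.1 := by
      by_cases h : (s₀.1 : ℕ) + 1 = J
      · rw [hJeq _ h]
      · rw [hJ2 s₀.1 (by omega) (by omega)]; norm_num
    obtain ⟨U, hU, h4, h5⟩ := he.exists_isCut hd (s := s₀)
      (fun s' h => h ▸ hd.child_le s' (h ▸ hds0)) (hdp ▸ (hd.bounds _).2) (by rwa [hdp]) h3
    intro hr
    refine hU.not_reachable (h4 (sq_mem_lowerVerts.2 ?_)) ?_ hr.symm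
    · simp only [Below, Fin.lt_def, Fin.ext_iff]; omega
    · intro h6
      rcases below_or_of_mem_cut h5 h6 with h7 | h7
      · simp only [Below, Fin.lt_def, Fin.ext_iff] at h7; omega
      · omega
  -- the leaf is not open, and the cut is at the leaf
  · refine he.not_reachable_leaf hd hs ?_ (by rw [hpar]; omega) (Or.inr (by rwa [hpar, hdh]))
      (Or.inr fun ho => hcr (he.criticalAt_of_isOpen hds (hpar ▸ hdh) ho)) c c'
    rintro rfl
    omega

/-- If both leaves are open, then two critical arrows meet the component of the hexagon in `S`. -/
theorem Acceptable.not_reachable_red_blue (hd : RootLike d) (he : Acceptable Q d e)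
    (hnu : ∀ C : (graphS d e).ConnectedComponent, nu Q d e C ≤ 1) {s s' : Square n}
    (hs : (s.1 : ℕ) + 1 = n) (hs' : (s'.1 : ℕ) + 2 = n) (c c' : Color) :
    ¬ (supportGraph Q (config Q d e)).Reachable (.sq s c) (.sq s' c') := by
  have hpar := parent_leaf (s := s) (by omega)
  have hpar' := parent_leaf (s := s') (by omega)
  have hne : s' ≠ s := by rintro rfl; omega
  by_cases h0 : d hexTile = 0
  · rcases hd.leaf_zero h0 s s' hs hs' with h | h
    · exact he.not_reachable_leaf hd (by omega) hne (by rw [hpar]; omega) (Or.inl h) (Or.inl h) c c'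
    · exact fun hr => he.not_reachable_leaf hd (by omega) hne.symm (by rw [hpar']; omega)
        (Or.inl h) (Or.inl h) c' c hr.symm
  have h1 : 1 ≤ d hexTile := by have := hd.bounds hexTile; omega
  rcases hd.two with h | ⟨J, hJ1, hJ3, hJlt, hJeq, hJ2, hJleaf⟩
  · have hh : d hexTile = 1 := by have := h hexTile; omega
    have hval : ∀ v, (valence Q (config Q d e) v : ℤ) ≤ 1 := fun v => by
      obtain ⟨k, hk⟩ := he.exists_valence_eq hd h1 v
      rw [hk]; exact h k
    exact he.not_reachable_leaf hd (by omega) hne (by rw [hpar, hh]; exact h _)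
      (Or.inr (by rwa [hpar, hh]))
      (Or.inr (he.not_isOpen_of_le_one (h _) (by rw [hpar, hh]))) c c'
  · have hdh : d hexTile = 2 :=
      hJ2 _ (by simp only [hexTile]; omega) (by simp only [hexTile]; omega)
    have hval : ∀ v, (valence Q (config Q d e) v : ℤ) ≤ 2 := fun v => by
      have := he.isMixedDimer hd v; omega
    have hds := hJleaf s.1 (by omega)
    have hds' := hJleaf s'.1 (by omega)
    by_cases hcr : CriticalAt Q d e s
    · by_cases hcr' : CriticalAt Q d e s'
      · have heh : e hexTile = 1 := by rw [← hpar]; exact hcr.2.2.1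
        let C := (graphS d e).connectedComponentMk ⟨hexTile, hdh, heh⟩
        have hC : hexTile ∈ tiles d e C := mem_tiles.2 ⟨⟨hdh, heh⟩, rfl⟩
        exact absurd ((nu_le_one_iff hd C).1 (hnu C) s s' hcr (by rwa [hpar]) hcr'
          (by rwa [hpar'])) hne.symm
      · exact fun hr => he.not_reachable_leaf hd (by omega) hne.symm (by rw [hpar']; omega)
          (Or.inr (by rwa [hpar', hdh]))
          (Or.inr fun ho => hcr' (he.criticalAt_of_isOpen hds' (hpar' ▸ hdh) ho)) c' c hr.symm
    · exact he.not_reachable_leaf hd (by omega) hne (by rw [hpar]; omega)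
        (Or.inr (by rwa [hpar, hdh]))
        (Or.inr fun ho => hcr (he.criticalAt_of_isOpen hds (hpar ▸ hdh) ho)) c c'

theorem Acceptable.nodeMonochromatic (hd : RootLike d) (he : Acceptable Q d e)
    (hnu : ∀ C : (graphS d e).ConnectedComponent, nu Q d e C ≤ 1) :
    NodeMonochromatic Q d (config Q d e) := by
  have hrb : ∀ u v, IsNode Q d .red u → IsNode Q d .blue v →
      ¬ (supportGraph Q (config Q d e)).Reachable u v := by
    intro u v hu hv
    obtain ⟨s, c, hs, rfl⟩ := isNode_red hu
    obtain ⟨s', c', hs', rfl⟩ := isNode_blue hv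
    exact he.not_reachable_red_blue hd hnu hs hs' c c'
  have hrg : ∀ u v, IsNode Q d .red u → IsNode Q d .green v →
      ¬ (supportGraph Q (config Q d e)).Reachable u v := by
    intro u v hu hv
    obtain ⟨s, c, hs, rfl⟩ := isNode_red hu
    exact he.not_reachable_green hd hnu (by omega) c hv
  have hbg : ∀ u v, IsNode Q d .blue u → IsNode Q d .green v →
      ¬ (supportGraph Q (config Q d e)).Reachable u v := by
    intro u v hu hv
    obtain ⟨s, c, hs, rfl⟩ := isNode_blue hu
    exact he.not_reachable_green hd hnu (by omega) c hv
  intro a b u v hab hu hv hr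
  cases a <;> cases b
  · exact hab rfl
  · exact hrb u v hu hv hr
  · exact hrg u v hu hv hr
  · exact hrb v u hv hu hr.symm
  · exact hab rfl
  · exact hbg u v hu hv hr
  · exact hrg v u hv hu hr.symm
  · exact hbg v u hv hu hr.symm
  · exact hab rfl

end

/-! ### Node-monochromatic configurations satisfy Tran's third condition -/

section

variable {n : ℕ} [hn : Fact (4 ≤ n)] {Q : DQuiver n} {d e : Fin n → ℤ}

theorem Acceptable.reachable_of_pos (hd : ∀ k, 0 ≤ d k ∧ d k ≤ 2) (he : Acceptable Q d e)
    {x : Edge n} (hx : 0 < wt Q d e x) (c : Color) :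
    (supportGraph Q (config Q d e)).Reachable (endpoint Q c x) (endpoint Q c.other x) := by
  rw [supportGraph_eq]
  refine (edgeGraph_adj Q (K := {x | 0 < config Q d e x}) ?_ c).reachable
  have := he.coe_config hd x
  rw [Set.mem_ofPred_eq]
  omega

theorem CriticalAt.lowerSum_eq {s : Square n} (h : CriticalAt Q d e s) :
    lowerSum Q d e s = 1 := by
  obtain ⟨h1, -, -, h2⟩ := h
  unfold lowerSum
  split_ifs at h2 ⊢ <;> omega

/-- An outer side of a square with a critical arrow to its parent belongs to the configuration. -/
theorem Acceptable.reachable_side (hd : ∀ k, 0 ≤ d k ∧ d k ≤ 2) (he : Acceptable Q d e)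
    {s : Square n} (h : CriticalAt Q d e s) {c : Color} (ho : IsOuter Q (side c s)) :
    (supportGraph Q (config Q d e)).Reachable (endpoint Q c (attach Q s)) (.sq s c.other) := by
  have h1 := he.reachable_of_pos hd (x := side c s)
    (by rw [wt_side_outer hd ho, h.lowerSum_eq]; norm_num) c
  rwa [endpoint_side, endpoint_other_side] at h1

theorem isOuter_side_leaf {s : Square n} (hs : n < (s.1 : ℕ) + 3) (c : Color) :
    IsOuter Q (side c s) := by
  intro s' h
  have := attach_eq_side h
  omega

/-- A critical arrow `p - j` at the first tile `j` with `d j = 2` connects the edge shared by the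
tiles `p` and `j` to a green node. -/
theorem Acceptable.exists_green (hd : RootLike d) (he : Acceptable Q d e) {p : Square n}
    {j : Fin n} (hpj : parent p = j) (hp4 : (p.1 : ℕ) + 4 ≤ n) (hj : d j = 2)
    (hmin : ∀ i < j, d i ≠ 2) (hp : CriticalAt Q d e p) :
    ∃ c v, IsNode Q d .green v ∧
      (supportGraph Q (config Q d e)).Reachable (endpoint Q c (attach Q p)) v := by
  have hpv : (j : ℕ) = p.1 + 1 := by rw [← hpj, parent_val hp4]
  by_cases h0 : (p.1 : ℕ) = 0
  · refine ⟨.black, .sq p .white, ⟨j, hj, hmin, p, hpv.symm, Or.inl ⟨Or.inl (by omega), _, rfl⟩⟩,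
      he.reachable_side hd.bounds hp (c := .black) fun s' h => ?_⟩
    have := (attach_eq_side h).1
    omega
  let k : Square n := ⟨⟨p.1 - 1, by omega⟩, by simp only; omega⟩
  have hk : (k.1 : ℕ) + 1 = p.1 := by simp only [k]; omega
  have hk4 : (k.1 : ℕ) + 4 < n := by omega
  have hpn : nextSquare k hk4 = p := Subtype.ext (Fin.ext (by simp only [nextSquare]; omega))
  have hatt := attach_of_lt Q k hk4
  rw [hpn] at hatt
  by_cases hst : Straight Q k p
  · rw [if_pos hst] at hatt
    refine ⟨.black, .sq p .white, ⟨j, hj, hmin, p, hpv.symm,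
      Or.inl ⟨Or.inr ⟨k, by omega, hst⟩, _, rfl⟩⟩,
      he.reachable_side hd.bounds hp (c := .black) fun s' h => ?_⟩
    have h1 := (attach_eq_side h).1
    have h2 : s' = k := Subtype.ext (Fin.ext (by omega))
    rw [h2, hatt] at h
    simp [side] at h
  · rw [if_neg hst] at hatt
    obtain ⟨c, hc⟩ : ∃ c, attach Q k = side c p := by
      rw [hatt]
      split_ifs
      exacts [⟨.white, rfl⟩, ⟨.black, rfl⟩]
    have hcor : ¬ IsCorner Q j (endpoint Q c.other (attach Q k)) := by
      rw [hc, endpoint_other_side]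
      rintro ⟨x, hx, c', h⟩
      have hb : Below p (own x) := below_own_of_endpoint_mem (Q := Q) (c := c') (x := x)
        (by rw [← h]; exact sq_mem_lowerVerts.2 (Or.inl rfl))
      have hnb : ¬ Below p j := by rw [← hpj]; exact not_below_parent p
      rcases (mem_sides Q).1 hx with h1 | ⟨s, h1, rfl⟩
      · exact hnb (h1 ▸ hb)
      · rw [own_attach] at hb
        exact hnb (h1 ▸ (below_iff p s).2 (Or.inr hb))
    have hsum := wt_side_add_wt_side (e := e) hd.bounds hc (by
      have := hd.child_le k
      rw [(attach_eq_side hc).2.2.1] at this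
      exact this hp.1.ge)
    rw [hp.lowerSum_eq] at hsum
    have h1 := he.wt_nonneg hd.bounds (side c p)
    have hnode : ∀ v, (v = endpoint Q c.other (attach Q k) ∨ v = .sq k c.other) →
        IsNode Q d .green v := fun v hv =>
      ⟨j, hj, hmin, p, hpv.symm, Or.inr ⟨k, by omega, hst, c.other, hcor, hv⟩⟩
    by_cases h2 : 0 < wt Q d e (side c p)
    · refine ⟨c, _, hnode _ (Or.inl rfl), ?_⟩
      have := he.reachable_of_pos hd.bounds h2 c
      rwa [endpoint_side, ← hc] at this
    · refine ⟨c, _, hnode _ (Or.inr rfl), ?_⟩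
      have := he.reachable_of_pos hd.bounds (x := side c k) (by omega) c
      rwa [endpoint_side, hc, endpoint_side, endpoint_other_side] at this

/-- The boundary edges of the tiles in `S` belong to the configuration. -/
theorem wt_outer_pos (hd : ∀ k, 0 ≤ d k ∧ d k ≤ 2) {x : Edge n} (hx : IsOuter Q x)
    (h : d (own x) = 2 ∧ e (own x) = 1) : 0 < wt Q d e x := by
  rw [wt_outer hd e hx]; split_ifs <;> omega

/-- The boundary edges of a square `p` in `S` connect the edge to the preceding square `s` with the
edge to the parent of `p`. -/
theorem Acceptable.reachable_attach (hd : ∀ k, 0 ≤ d k ∧ d k ≤ 2) (he : Acceptable Q d e)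
    {s p : Square n} (hp : parent s = p.1) (h : d p.1 = 2 ∧ e p.1 = 1) (c : Color) :
    ∃ c', (supportGraph Q (config Q d e)).Reachable (endpoint Q c (attach Q s))
      (endpoint Q c' (attach Q p)) := by
  have honly : ∀ y, own y = p.1 → y ≠ attach Q s → IsOuter Q y := by
    intro y hy hne s' hs'
    have h1 : parent s' = p.1 := by rw [← own_attach Q s', hs', hy]
    have h2 : s' = s := by
      rw [← hp] at h1
      have h3 := s.2
      have h4 := s'.2
      have h5 := p.2
      have h6 := hn.out
      simp only [parent, Fin.ext_iff] at h1 hp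
      exact Subtype.ext (Fin.ext (by omega))
    exact hne (by rw [← hs', h2])
  have hreach : ∀ y, own y = p.1 → y ≠ attach Q s → ∀ c,
      (supportGraph Q (config Q d e)).Reachable (endpoint Q c y) (endpoint Q c.other y) :=
    fun y hy hne c => he.reachable_of_pos hd
      (wt_outer_pos hd (honly y hy hne) (hy.symm ▸ h)) c
  rcases attach_cases Q s with ⟨hs, -⟩ | ⟨hs, p', -, hp', hatt⟩
  · exact absurd (eq_hexTile.1 (hp.symm.trans (parent_eq_hexTile s hs))) p.2
  obtain rfl : p' = p := Subtype.ext (hp'.trans hp)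
  rcases hatt with hatt | ⟨c', hatt⟩
  · refine ⟨c.other, ?_⟩
    have h1 := hreach (side c.other p') (own_side _ _)
      (by rw [hatt]; cases c <;> simp [side, Color.other]) c
    rw [hatt, endpoint_far]
    rwa [endpoint_side_other, endpoint_side] at h1
  · rcases eq_or_eq_other c c' with rfl | rfl
    · exact ⟨c', by rw [hatt, endpoint_side]⟩
    · refine ⟨c, ?_⟩
      have h1 := hreach (.far p') rfl
        (by rw [hatt]; cases c <;> simp [side, Color.other]) c
      have h2 := hreach (side c p') (own_side _ _)
        (by rw [hatt]; cases c <;> simp [side, Color.other]) c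
      rw [hatt, endpoint_side_other]
      rw [endpoint_far, endpoint_far] at h1
      rw [endpoint_side, endpoint_other_side] at h2
      exact h1.trans h2.symm

/-- Paths along a sequence of squares in `S` up to the square before the hexagon. -/
theorem Acceptable.reachable_last (hd : ∀ k, 0 ≤ d k ∧ d k ≤ 2) (he : Acceptable Q d e)
    {a : Square n} (ha : (a.1 : ℕ) + 4 = n) (s : Square n) (hs4 : (s.1 : ℕ) + 4 ≤ n)
    (h : ∀ k : Fin n, s.1 < k → (k : ℕ) + 3 ≤ n → d k = 2 ∧ e k = 1) (c : Color) :
    ∃ c', (supportGraph Q (config Q d e)).Reachable (endpoint Q c (attach Q s))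
      (endpoint Q c' (attach Q a)) := by
  induction s using square_induction generalizing c with
  | h s ih =>
    by_cases hs : (s.1 : ℕ) + 4 = n
    · obtain rfl : s = a := Subtype.ext (Fin.ext (by omega))
      exact ⟨c, SimpleGraph.Reachable.refl _⟩
    · let p := nextSquare s (by omega)
      have hpv : (p.1 : ℕ) = s.1 + 1 := rfl
      have hp : parent s = p.1 := (nextSquare_val s _).symm
      obtain ⟨c', h1⟩ := he.reachable_attach hd hp
        (h p.1 (by rw [Fin.lt_def]; omega) (by omega)) c
      obtain ⟨c'', h2⟩ := ih p hpv (by omega) (by omega)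
        (fun k hk hk3 => h k (by rw [Fin.lt_def] at *; omega) hk3) c'
      exact ⟨c'', h1.trans h2⟩

theorem slot_of_attach {s : Square n} {t : Fin 3} (h : attach Q s = .hexOut t ∨
    attach Q s = .hexIn t) : n ≤ (s.1 : ℕ) + 4 ∧ slot s = t := by
  by_cases hs : (s.1 : ℕ) + 4 < n
  · rw [attach_of_lt Q s hs] at h
    split_ifs at h <;> simp at h
  · rw [attach_of_le Q s (by omega)] at h
    refine ⟨by omega, ?_⟩
    split_ifs at h <;> simpa using h

theorem slot_injective {s s' : Square n} (hs : n ≤ (s.1 : ℕ) + 4) (hs' : n ≤ (s'.1 : ℕ) + 4)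
    (h : slot s = slot s') : s = s' := by
  have h1 := s.2
  have h2 := s'.2
  have b := s.1.2
  have b' := s'.1.2
  apply Subtype.ext; apply Fin.ext
  simp only [slot] at h
  split_ifs at h <;> omega

/-- The two ends of the side of the hexagon that a square is glued to are connected to the black
vertices before and after it. -/
theorem Acceptable.reachable_hex (hd : ∀ k, 0 ≤ d k ∧ d k ≤ 2) (he : Acceptable Q d e)
    (h : d hexTile = 2 ∧ e hexTile = 1) {s : Square n} (hs : n ≤ (s.1 : ℕ) + 4) :
    ∃ c, (supportGraph Q (config Q d e)).Reachable (endpoint Q c (attach Q s))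
        (.hex (slot s) .black) ∧
      (supportGraph Q (config Q d e)).Reachable (endpoint Q c.other (attach Q s))
        (.hex (slot s + 1) .black) := by
  have hatt : attach Q s = .hexOut (slot s) ∨ attach Q s = .hexIn (slot s) := by
    rw [attach_of_le Q s hs]; split_ifs <;> simp
  rcases hatt with hatt | hatt
  · have ho : IsOuter Q (.hexIn (slot s)) := by
      intro s' h'
      have h1 := slot_of_attach (Or.inr h')
      rw [slot_injective h1.1 hs h1.2, hatt] at h'
      simp at h'
    have h1 := he.reachable_of_pos hd (wt_outer_pos hd ho h) .white
    refine ⟨.black, ?_, ?_⟩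
    · rw [hatt, endpoint_hexOut]
    · rw [hatt, endpoint_hexOut]
      simpa [endpoint, Color.other] using h1
  · have ho : IsOuter Q (.hexOut (slot s)) := by
      intro s' h'
      have h1 := slot_of_attach (Or.inl h')
      rw [slot_injective h1.1 hs h1.2, hatt] at h'
      simp at h'
    have h1 := he.reachable_of_pos hd (wt_outer_pos hd ho h) .white
    refine ⟨.white, ?_, ?_⟩
    · rw [hatt]
      simpa [endpoint, Color.other] using h1
    · rw [hatt]
      simp [endpoint, Color.other]

/-- A leaf with a critical arrow is connected to the hexagon. -/
theorem Acceptable.reachable_leaf (hd : ∀ k, 0 ≤ d k ∧ d k ≤ 2) (he : Acceptable Q d e)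
    {s : Square n} (hs : n < (s.1 : ℕ) + 3) (h : CriticalAt Q d e s) :
    (∃ c, (supportGraph Q (config Q d e)).Reachable (.hex (slot s) .black) (.sq s c)) ∧
      ∃ c, (supportGraph Q (config Q d e)).Reachable (.hex (slot s + 1) .black) (.sq s c) := by
  have hh : d hexTile = 2 ∧ e hexTile = 1 := by rw [← parent_leaf hs]; exact ⟨h.2.1, h.2.2.1⟩
  obtain ⟨c, h1, h2⟩ := he.reachable_hex hd hh (s := s) (by omega)
  exact ⟨⟨_, h1.symm.trans (he.reachable_side hd h (isOuter_side_leaf hs c))⟩,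
    ⟨_, h2.symm.trans (he.reachable_side hd h (isOuter_side_leaf hs c.other))⟩⟩

/-- At a leaf without critical arrow one can pass along the hexagon. -/
theorem Acceptable.reachable_pass (hd : ∀ k, 0 ≤ d k ∧ d k ≤ 2) (he : Acceptable Q d e)
    {s : Square n} (hs : n < (s.1 : ℕ) + 3) (hh : d hexTile = 2 ∧ e hexTile = 1)
    (hds : d s.1 = 1) (h : ¬ CriticalAt Q d e s) :
    (supportGraph Q (config Q d e)).Reachable (.hex (slot s) .black)
      (.hex (slot s + 1) .black) := by
  obtain ⟨c, h1, h2⟩ := he.reachable_hex hd hh (s := s) (by omega)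
  have hpos : 0 < wt Q d e (attach Q s) := by
    have h3 := he.1 s.1
    rw [wt_attach hd]
    unfold CriticalAt at h
    rw [parent_leaf hs] at h ⊢
    split_ifs at h ⊢ <;> omega
  exact h1.symm.trans ((he.reachable_of_pos hd hpos c).trans h2)

/-- Two critical arrows at one component of `S` would yield a path between nodes of different
colours: critical arrows occur only at the two leaves, which carry the red and the blue nodes, and
at the first tile with `d j = 2`, where there is a path to the green nodes. -/
theorem Acceptable.nu_le_one (hd : RootLike d) (he : Acceptable Q d e)
    (hm : NodeMonochromatic Q d (config Q d e)) (C : (graphS d e).ConnectedComponent) :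
    nu Q d e C ≤ 1 := by
  rw [nu_le_one_iff hd]
  have hn4 := hn.out
  let r : Square n := ⟨⟨n - 1, by omega⟩, by simp only; omega⟩
  let b : Square n := ⟨⟨n - 2, by omega⟩, by simp only; omega⟩
  let a : Square n := ⟨⟨n - 4, by omega⟩, by simp only; omega⟩
  have hrv : (r.1 : ℕ) + 1 = n := by simp only [r]; omega
  have hbv : (b.1 : ℕ) + 2 = n := by simp only [b]; omega
  have hav : (a.1 : ℕ) + 4 = n := by simp only [a]; omega
  have hr1 : slot r = 2 := by simp only [slot]; rw [if_neg (by omega), if_neg (by omega)]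
  have hb1 : slot b = 1 := by simp only [slot]; rw [if_neg (by omega), if_pos (by omega)]
  have ha1 : slot a = 0 := by simp only [slot]; rw [if_pos (by omega)]
  have hred : ∀ c, IsNode Q d .red (.sq r c) := fun c => ⟨r, hrv, c, rfl⟩
  have hblue : ∀ c, IsNode Q d .blue (.sq b c) := fun c => ⟨b, hbv, c, rfl⟩
  -- two critical arrows at the hexagon
  have hrb : CriticalAt Q d e r → CriticalAt Q d e b → False := by
    intro h1 h2
    obtain ⟨⟨c, h3⟩, -⟩ := he.reachable_leaf hd.bounds (s := r) (by omega) h1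
    obtain ⟨-, ⟨c', h4⟩⟩ := he.reachable_leaf hd.bounds (s := b) (by omega) h2
    rw [hr1] at h3
    rw [hb1] at h4
    exact hm .red .blue _ _ (by simp) (hred c) (hblue c') (h3.symm.trans h4)
  -- a critical arrow at the hexagon and one at the first tile with `d j = 2`
  have hgreen : ∀ p l : Square n, (l = r ∨ l = b) → CriticalAt Q d e l → CriticalAt Q d e p →
      (p.1 : ℕ) + 4 ≤ n → parent p ∈ tiles d e C → hexTile ∈ tiles d e C → False := by
    intro p l hl hlc hpc hp4 hpC hhC
    have hpv := parent_val hp4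
    rcases hd.two with h | ⟨J, hJ1, hJ3, hJlt, hJeq, hJ2, hJleaf⟩
    · have := h (parent p); have := hpc.2.1; omega
    have hmin : ∀ i < parent p, d i ≠ 2 := by
      intro i hi h2
      rw [Fin.lt_def] at hi
      have h3 := hpc.1
      by_cases h4 : J ≤ (p.1 : ℕ)
      · have := hJ2 p.1 h4 (by omega); omega
      · have := hJlt i (by omega); omega
    have hup : ∀ m : ℕ, ∀ k : Fin n, (k : ℕ) = p.1 + 1 + m → (k : ℕ) + 3 ≤ n →
        k ∈ tiles d e C := by
      intro m
      induction m with
      | zero => intro k hk _; rwa [show k = parent p from Fin.ext (by omega)]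
      | succ m ih =>
        intro k hk hk3
        let s : Square n := ⟨⟨k - 1, by omega⟩, by simp only; omega⟩
        have hsv : (s.1 : ℕ) + 1 = k := by simp only [s]; omega
        have hsC := ih s.1 (by omega) (by omega)
        have hps : parent s = k := Fin.ext (by rw [parent_val (by omega)]; exact hsv)
        by_contra hkC
        exact not_below_hexTile s
          ((tileConnected_tiles C).below hsC (by rwa [hps]) hhC)
    have hS : ∀ k : Fin n, p.1 < k → (k : ℕ) + 3 ≤ n → d k = 2 ∧ e k = 1 := by
      intro k hk hk3
      rw [Fin.lt_def] at hk
      exact (mem_tiles.1 (hup (k - (p.1 + 1)) k (by omega) hk3)).1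
    have hh := (mem_tiles.1 hhC).1
    obtain ⟨c, v, hv, h1⟩ := he.exists_green hd rfl hp4 hpc.2.1 hmin hpc
    obtain ⟨c', h2⟩ := he.reachable_last hd.bounds hav p hp4 hS c
    -- the green node `v` is connected to the square before the hexagon, hence to `b₀` or `b₁`;
    -- from there, paths around the hexagon reach a leaf, as they can pass at a leaf without
    -- critical arrow
    have hva := h1.symm.trans h2
    obtain ⟨c'', h3, h4⟩ := he.reachable_hex hd.bounds hh (s := a) (by omega)
    rw [ha1] at h3 h4
    have hdr := hJleaf r.1 (by omega)
    have hdb := hJleaf b.1 (by omega)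
    have hv01 : (supportGraph Q (config Q d e)).Reachable v (.hex 0 .black) ∨
        (supportGraph Q (config Q d e)).Reachable v (.hex 1 .black) := by
      rcases eq_or_eq_other c'' c' with rfl | rfl
      · exact Or.inl (hva.trans h3)
      · exact Or.inr (hva.trans h4)
    have hr := he.reachable_leaf hd.bounds (s := r) (by omega)
    have hb := he.reachable_leaf hd.bounds (s := b) (by omega)
    have hr' := he.reachable_pass hd.bounds (s := r) (by omega) hh hdr
    have hb' := he.reachable_pass hd.bounds (s := b) (by omega) hh hdb
    rw [hr1] at hr hr'
    rw [hb1] at hb hb'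
    have hR : ∀ c, ¬ (supportGraph Q (config Q d e)).Reachable v (.sq r c) := fun c =>
      hm .green .red _ _ (by simp) hv (hred c)
    have hB : ∀ c, ¬ (supportGraph Q (config Q d e)).Reachable v (.sq b c) := fun c =>
      hm .green .blue _ _ (by simp) hv (hblue c)
    have e20 : (2 : Fin 3) + 1 = 0 := rfl
    have e12 : (1 : Fin 3) + 1 = 2 := rfl
    rw [e20] at hr hr'
    rw [e12] at hb hb'
    rcases hl with rfl | rfl
    · obtain ⟨⟨c1, h5⟩, c2, h6⟩ := hr hlc
      rcases hv01 with h7 | h7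
      · exact hR _ (h7.trans h6)
      · by_cases hbc : CriticalAt Q d e b
        · exact hrb hlc hbc
        · exact hR _ (h7.trans ((hb' hbc).trans h5))
    · obtain ⟨⟨c1, h5⟩, c2, h6⟩ := hb hlc
      rcases hv01 with h7 | h7
      · by_cases hrc : CriticalAt Q d e r
        · exact hrb hrc hlc
        · exact hB _ (h7.trans ((hr' hrc).symm.trans h6))
      · exact hB _ (h7.trans h5)
  -- critical arrows can only occur at the leaves and before the first tile with `d j = 2`
  have hcases : ∀ s : Square n, s = r ∨ s = b ∨ (s.1 : ℕ) + 4 ≤ n := by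
    intro s
    have h1 := s.1.2
    have h2 := s.2
    by_cases h3 : (s.1 : ℕ) + 4 ≤ n
    · exact Or.inr (Or.inr h3)
    by_cases h4 : (s.1 : ℕ) + 1 = n
    · exact Or.inl (Subtype.ext (Fin.ext (by omega)))
    · exact Or.inr (Or.inl (Subtype.ext (Fin.ext (by omega))))
  have hleaf : ∀ s : Square n, s = r ∨ s = b → parent s = hexTile := by
    rintro s (rfl | rfl) <;> exact parent_leaf (by omega)
  intro s s' hs hsC hs' hsC'
  rcases hcases s with h | h | h <;> rcases hcases s' with h' | h' | h'
  · rw [h, h']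
  · exact (hrb (h ▸ hs) (h' ▸ hs')).elim
  · exact (hgreen s' s (Or.inl h) hs hs' h' hsC' (hleaf s (Or.inl h) ▸ hsC)).elim
  · exact (hrb (h' ▸ hs') (h ▸ hs)).elim
  · rw [h, h']
  · exact (hgreen s' s (Or.inr h) hs hs' h' hsC' (hleaf s (Or.inr h) ▸ hsC)).elim
  · exact (hgreen s s' (Or.inl h') hs' hs h hsC (hleaf s' (Or.inl h') ▸ hsC')).elim
  · exact (hgreen s s' (Or.inr h') hs' hs h hsC (hleaf s' (Or.inr h') ▸ hsC')).elim
  · rcases hd.two with h2 | ⟨J, hJ1, hJ3, hJlt, hJeq, hJ2, hJleaf⟩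
    · have := h2 (parent s); have := hs.2.1; omega
    have key : ∀ s : Square n, CriticalAt Q d e s → (s.1 : ℕ) + 4 ≤ n → (s.1 : ℕ) + 1 = J := by
      intro s hs h
      have h3 := parent_val h
      have h4 : ¬ J ≤ (s.1 : ℕ) := fun h5 => by
        have := hJ2 s.1 h5 (by omega); have := hs.1; omega
      have h5 : ¬ (parent s : ℕ) < J := fun h5 => by
        have := hJlt _ h5; have := hs.2.1; omega
      omega
    have h3 := key s hs h
    have h4 := key s' hs' h'
    exact Subtype.ext (Fin.ext (by omega))

end

/-! ### The bijection -/

section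

variable {n : ℕ} [hn : Fact (4 ≤ n)] {Q : DQuiver n} {d e : Fin n → ℤ}

theorem tranConditions_iff :
    TranConditions Q d e ↔ Acceptable Q d e ∧ ∀ C, nu Q d e C ≤ 1 :=
  ⟨fun h => ⟨⟨h.bounds, h.acceptable⟩, h.critical⟩, fun h => ⟨h.1.1, h.1.2, h.2⟩⟩

theorem config_mem_posetP (hd : RootLike d) (he : TranConditions Q d e) :
    config Q d e ∈ posetP Q d := by
  rw [tranConditions_iff] at he
  exact ⟨he.1.isMixedDimer hd, he.1.valenceCondition hd, he.1.reachable hd.bounds,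
    he.1.nodeMonochromatic hd he.2⟩

theorem Acceptable.config_injective (hd : ∀ k, 0 ≤ d k ∧ d k ≤ 2) {e' : Fin n → ℤ}
    (he : Acceptable Q d e) (he' : Acceptable Q d e') (h : config Q d e = config Q d e') :
    e = e' := by
  funext k
  obtain ⟨x, rfl, hx⟩ := exists_isOuter Q k
  have h1 := he.coe_config hd x
  rw [h, he'.coe_config hd, wt_outer hd e hx, wt_outer hd e' hx] at h1
  split_ifs at h1 <;> omega

theorem exists_config_eq (hd : RootLike d) {D : Edge n → ℕ} (hD : D ∈ posetP Q d) :
    ∃ e, TranConditions Q d e ∧ config Q d e = D := by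
  obtain ⟨-, -, hr, hm⟩ := hD
  obtain ⟨e, he, he0, hw⟩ := exists_of_reachable hr
  have hacc : Acceptable Q d e := acceptable_of_nonneg hd.bounds hd.child_le he he0
    fun x => hw x ▸ Int.natCast_nonneg _
  have hDe : config Q d e = D := by
    funext x
    have := hacc.coe_config hd.bounds x
    rw [← hw] at this
    exact_mod_cast this
  exact ⟨e, tranConditions_iff.2 ⟨hacc, hacc.nu_le_one hd (hDe ▸ hm)⟩, hDe⟩

/-- The vectors satisfying Tran's conditions correspond to the node-monochromatic configurations,
`e` to the configuration with multiplicities `wt Q d e`. -/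
noncomputable def configEquiv (hd : RootLike d) :
    {e : Fin n → ℤ // TranConditions Q d e} ≃ {D : Edge n → ℕ // D ∈ posetP Q d} :=
  Equiv.ofBijective (fun e => ⟨config Q d e.1, config_mem_posetP hd e.2⟩)
    ⟨fun e e' h => Subtype.ext ((tranConditions_iff.1 e.2).1.config_injective hd.bounds
        (tranConditions_iff.1 e'.2).1 (congrArg Subtype.val h)),
      fun D => by
        obtain ⟨e, he, h⟩ := exists_config_eq hd D.2
        exact ⟨⟨e, he⟩, Subtype.ext h⟩⟩

theorem coe_configEquiv (hd : RootLike d) (e : {e : Fin n → ℤ // TranConditions Q d e}) :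
    (configEquiv hd e).1 = config Q d e.1 := rfl

end

end MixedDimer

theorem theorem4p3 (n : ℕ) (hn : 4 ≤ n) (Q : DQuiver n) (d : Fin n → ℤ)
    (hd : IsPositiveRoot n d) :
    ∃ Φ : {D : Edge n → ℕ // D ∈ posetP Q d} ≃ {e : Fin n → ℤ // TranConditions Q d e},
      -- from `e` to `D`: weighted flips from the minimal matching
      (∀ e, (fun x => ((Φ.symm e).1 x : ℤ)) =
        weightedFlips Q e.1 (fun x => (minimalMatching Q d x : ℤ))) ∧
      -- from `D` to `e`: peel off maximal cycles from `D ⊔ M_-`; any choice of the cycles leads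
      -- to the same vector, and only 2-cycles are left over at the end
      (∀ D, (∃ N v, PeelOutcome Q d D.1 N v) ∧
        ∀ N v, PeelOutcome Q d D.1 N v →
          v = (Φ D).1 ∧ cyclesIn Q N = ∅ ∧ ∀ x, Even (N x)) ∧
      -- the number of enclosing cycles
      (∀ D, (enclosingCycles Q D.1).ncard =
        Set.ncard {C : (graphS d (Φ D).1).ConnectedComponent | nu Q d (Φ D).1 C = 0}) := by
  have : Fact (4 ≤ n) := ⟨hn⟩
  have hr : RootLike d := hd.rootLike
  refine ⟨(configEquiv hr).symm, fun e => ?_, fun D => ?_, fun D => ?_⟩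
  · rw [weightedFlips_eq_wt fun k => (e.2.bounds k).1]
    funext x
    exact (tranConditions_iff.1 e.2).1.coe_config hr.bounds x
  all_goals
    obtain ⟨e, rfl⟩ := (configEquiv hr).surjective D
    have he := (tranConditions_iff.1 e.2).1
    rw [Equiv.symm_apply_apply, coe_configEquiv]
  · exact peelOutcome hr.bounds hr.child_le he
  · exact ncard_enclosingCycles hr.bounds hr.child_le he
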